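/- Let $d\ge 2$ and $\beta>0$. For $n,N\ge 1$ let $\Lambda_n=(\mathbb Z/n\mathbb Z)^d$ be the discrete torus with its nearest-neighbour graph structure, and let $S=(S_x)_{x\in\Lambda_n}$ be a configuration of the spin $O(N)$ model on $\Lambda_n$ at inverse temperature $\beta$, i.e. a random element of $(\sqrt N\,\mathbb S^{N-1})^{\Lambda_n}$ with law $$\mu_{\Lambda_n,N,\beta}[\mathrm dS]=\frac1{Z_{\Lambda_n,N,\beta}}\exp\Big(\frac\beta2\sum_{x\sim y}S_x\cdot S_y\Big)\prod_{x\in\Lambda_n}\mathrm{Unif}_{\sqrt N\,\mathbb S^{N-1}}[\mathrm dS_x],$$ where the sum runs over ordered pairs of neighbours. For $m^2\ge 0$ let $\alpha=\frac{m^2}{2d+m^2}$ and $$G_{\mathbb Z^d,m^2}(x,y)=\frac{1-\alpha}{2d}\sum_{k\ge 0}(1-\alpha)^k\,\mathbb P^x[X_k=y]\in[0,\infty]\qquad(x,y\in\mathbb Z^d),$$ where $X$ under $\mathbb P^x$ is the simple random walk on $\mathbb Z^d$ started at $x$; write $G_{\mathbb Z^d}=G_{\mathbb Z^d,0}$ and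 $\beta_c=G_{\mathbb Z^d}(0,0)\in(0,\infty]$. When $G_{\mathbb Z^d,m^2}$ is finite, an $M$-vectorial $m^2$-massive GFF on $\mathbb Z^d$ consists of $M$ i.i.d. centred Gaussian processes indexed by $\mathbb Z^d$, each with covariance $G_{\mathbb Z^d,m^2}$; it is called an $M$-vectorial GFF if $m^2=0$. For $M\in\mathbb N$ and a finite set $U\subset\mathbb Z^d$ (projected canonically to $\Lambda_n$ for each $n$), let $\overline S_U=(S^i_x)_{x\in U}^{i=1,\dots,M}$ be the first $M$ spin coordinates on $U$ (for $N\ge M$). Then $\overline S_U$ converges in law as $N\to\infty$ followed by $n\to\infty$ (that is, for each $n$ its law has a weak limit as $N\to\infty$, and these limits converge weakly as $n\to\infty$) to the following limits. 1. If $\beta<\beta_c$: there is a mass $m^2>0$, depending only on $\beta$ and $d$, such that $G_{\mathbb Z^d,m^2}(x,x)=\beta$ for all $x\in\mathbb Z^d$, and for all $M$ and $U$ the limit is an $M$-vectorial $m^2$-massive GFF on $\mathbb Z^d$ restricted to $U$, scaled by $1/\sqrt\beta$. 2. If $\beta=\beta_c$: the limit is an $M$-vectorial GFF on $\mathbb Z^d$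 restricted to $U$, scaled by $1/\sqrt\beta$. 3. If $\beta>\beta_c$: the limit is an $M$-vectorial GFF on $\mathbb Z^d$ restricted to $U$, scaled by $1/\sqrt\beta$, plus an independent constant random drift $\sqrt{\frac{\beta-\beta_c}{\beta}}\;\overline Z\,\mathbf 1_U$, where $\overline Z$ is an $M$-dimensional standard normal vector. -/

import Mathlib

open MeasureTheory ProbabilityTheory Filter Topology

open scoped ENNReal

noncomputable section

namespace SpinON

/-! ### Lattices -/

/-- The nearest-neighbour graph on `R ^ d`: distinct points that differ by `1` in exactly one
coordinate. For `R = ℤ` this is the lattice `ℤ ^ d`, for `R = ZMod n` the discrete torus. -/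
def latticeGraph (d : ℕ) (R : Type) [CommRing R] : SimpleGraph (Fin d → R) where
  Adj x y := x ≠ y ∧ ∃ i : Fin d, y = x + Pi.single i 1 ∨ x = y + Pi.single i 1
  symm := ⟨fun _ _ h => ⟨h.1.symm, h.2.imp fun _ hi => hi.symm⟩⟩
  loopless := ⟨fun _ h => h.1 rfl⟩

/-- The discrete torus `(ℤ / nℤ) ^ d`. -/
abbrev Torus (d n : ℕ) : Type := Fin d → ZMod n

/-- The canonical projection `ℤ ^ d → (ℤ / nℤ) ^ d`. -/
def toTorus {d : ℕ} (n : ℕ) (x : Fin d → ℤ) : Torus d n := fun i => (x i : ZMod n)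

/-! ### The spin `O(N)` model -/

/-- The uniform probability measure on the sphere of radius `√N` in `ℝ ^ N`, as a measure on
`ℝ ^ N`: the normalised surface measure of the unit sphere, pushed forward by `v ↦ √N • v`. -/
def unifSphere (N : ℕ) : Measure (EuclideanSpace ℝ (Fin N)) :=
  let σ := (volume : Measure (EuclideanSpace ℝ (Fin N))).toSphere
  ((σ Set.univ)⁻¹ • σ).map
    (fun v : Metric.sphere (0 : EuclideanSpace ℝ (Fin N)) 1 =>
      √(N : ℝ) • (v : EuclideanSpace ℝ (Fin N)))

open Classical in
/-- `(β / 2) ∑_{x ∼ y} S_x · S_y`, the sum running over ordered pairs of neighbours. -/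
def energy (d n N : ℕ) [NeZero n] (β : ℝ) (S : Torus d n → EuclideanSpace ℝ (Fin N)) : ℝ :=
  β / 2 * ∑ x, ∑ y, if (latticeGraph d (ZMod n)).Adj x y then inner ℝ (S x) (S y) else 0

/-- The law of the spin `O(N)` model on the torus at inverse temperature `β`: the product of the
uniform measures on the spheres, with density proportional to `exp (energy S)`. -/
def spinMeasure (d n N : ℕ) [NeZero n] (β : ℝ) :
    Measure (Torus d n → EuclideanSpace ℝ (Fin N)) :=
  (Measure.pi fun _ => unifSphere N).tilted (energy d n N β)

/-- The first `M` spin coordinates of a configuration on the torus, seen at the points of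
`U ⊆ ℤ ^ d`. Coordinates beyond the `N`-th one, which only occur for `N < M`, are set to `0`. -/
def firstCoords {d : ℕ} (n N M : ℕ) (U : Finset (Fin d → ℤ))
    (S : Torus d n → EuclideanSpace ℝ (Fin N)) : U → Fin M → ℝ :=
  fun x i => if h : (i : ℕ) < N then S (toTorus n (x : Fin d → ℤ)) ⟨i, h⟩ else 0

instance isProbabilityMeasure_unifSphere (N : ℕ) [NeZero N] :
    IsProbabilityMeasure (unifSphere N) := by
  have : Nonempty (Fin N) := ⟨⟨0, Nat.pos_of_ne_zero (NeZero.ne N)⟩⟩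
  have h : IsProbabilityMeasure
      (((volume : Measure (EuclideanSpace ℝ (Fin N))).toSphere Set.univ)⁻¹ •
        (volume : Measure (EuclideanSpace ℝ (Fin N))).toSphere) := by
    constructor
    rw [Measure.smul_apply, smul_eq_mul]
    refine ENNReal.inv_mul_cancel ?_ (measure_ne_top _ _)
    rw [Ne, Measure.measure_univ_eq_zero]
    exact Measure.toSphere_ne_zero _
  exact Measure.isProbabilityMeasure_map (by fun_prop)

lemma norm_ae_unifSphere (N : ℕ) : ∀ᵐ v ∂unifSphere N, ‖v‖ = √(N : ℝ) := by
  rw [unifSphere, ae_map_iff (by fun_prop) (measurableSet_eq_fun (by fun_prop) (by fun_prop))]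
  refine Eventually.of_forall fun v => ?_
  rw [norm_smul, Real.norm_of_nonneg (Real.sqrt_nonneg _), norm_eq_of_mem_sphere, mul_one]

lemma continuous_energy (d n N : ℕ) [NeZero n] (β : ℝ) : Continuous (energy d n N β) := by
  unfold energy
  refine continuous_const.mul (continuous_finsetSum _ fun x _ =>
    continuous_finsetSum _ fun y _ => ?_)
  split_ifs
  · fun_prop
  · fun_prop

lemma integrable_exp_energy (d n N : ℕ) [NeZero n] [NeZero N] (β : ℝ) :
    Integrable (fun S => Real.exp (energy d n N β S))
      (Measure.pi fun _ : Torus d n => unifSphere N) := by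
  classical
  have hb : ∀ᵐ S ∂(Measure.pi fun _ : Torus d n => unifSphere N), ∀ x, ‖S x‖ = √(N : ℝ) := by
    rw [ae_all_iff]
    intro x
    exact (measurePreserving_eval (fun _ : Torus d n => unifSphere N) x).quasiMeasurePreserving.ae
      (norm_ae_unifSphere N)
  refine Integrable.of_bound
    (Real.continuous_exp.comp (continuous_energy d n N β)).aestronglyMeasurable
    (Real.exp (|β / 2| * ∑ _x : Torus d n, ∑ _y : Torus d n, (N : ℝ))) ?_
  filter_upwards [hb] with S hS
  rw [Real.norm_of_nonneg (Real.exp_pos _).le, Real.exp_le_exp]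
  refine (le_abs_self _).trans ?_
  rw [energy, abs_mul]
  refine mul_le_mul_of_nonneg_left ?_ (abs_nonneg _)
  refine (Finset.abs_sum_le_sum_abs _ _).trans (Finset.sum_le_sum fun x _ =>
    (Finset.abs_sum_le_sum_abs _ _).trans (Finset.sum_le_sum fun y _ => ?_))
  split_ifs
  · refine (abs_real_inner_le_norm _ _).trans ?_
    rw [hS, hS, Real.mul_self_sqrt (Nat.cast_nonneg _)]
  · simp

instance isProbabilityMeasure_spinMeasure (d n N : ℕ) [NeZero n] [NeZero N] (β : ℝ) :
    IsProbabilityMeasure (spinMeasure d n N β) :=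
  isProbabilityMeasure_tilted (integrable_exp_energy d n N β)

lemma measurable_firstCoords {d : ℕ} (n N M : ℕ) (U : Finset (Fin d → ℤ)) :
    Measurable (firstCoords n N M U) := by
  refine measurable_pi_lambda _ fun x => measurable_pi_lambda _ fun i => ?_
  unfold firstCoords
  split_ifs
  · fun_prop
  · fun_prop

/-- The law of `(S_x^i)`, `x ∈ U`, `i = 1, …, M`, for the spin `O(N)` model `S` on the torus of
side length `n` at inverse temperature `β`. -/
def spinLaw (d : ℕ) (β : ℝ) (M : ℕ) (U : Finset (Fin d → ℤ)) (n N : ℕ+) :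
    ProbabilityMeasure (U → Fin M → ℝ) :=
  ⟨(spinMeasure d n N β).map (firstCoords n N M U),
    Measure.isProbabilityMeasure_map (measurable_firstCoords n N M U).aemeasurable⟩

/-! ### Green's function and Gaussian free field on `ℤ ^ d` -/

/-- `walkProb d k x y` is the probability that the simple random walk on `ℤ ^ d` started at `x`
is at `y` after `k` steps. -/
def walkProb (d : ℕ) : ℕ → (Fin d → ℤ) → (Fin d → ℤ) → ℝ
  | 0, x, y => if x = y then 1 else 0
  | k + 1, x, y => (1 / (2 * (d : ℝ))) *
      ∑ i : Fin d, (walkProb d k (x + Pi.single i 1) y + walkProb d k (x - Pi.single i 1) y)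

/-- The Green's function of `-Δ + m²` on `ℤ ^ d`, with `-Δ f x = 2 d f x - ∑_{y ∼ x} f y`, as
the expected (killed) occupation time of the random walk: with `α = m² / (2d + m²)`,
`G (x, y) = (1 - α) / (2d) * ∑ₖ (1 - α) ^ k * P^x[X_k = y]`, a sum in `[0, ∞]`. -/
def green (d : ℕ) (m2 : ℝ) (x y : Fin d → ℤ) : ℝ≥0∞ :=
  let α : ℝ := m2 / (2 * d + m2)
  ∑' k : ℕ, ENNReal.ofReal ((1 - α) / (2 * d) * ((1 - α) ^ k * walkProb d k x y))

/-- The critical inverse temperature `G (0, 0)`, in `[0, ∞]`. -/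
def betaC (d : ℕ) : ℝ≥0∞ := green d 0 0 0

/-- The law of the restriction to `U` of the Gaussian free field on `ℤ ^ d` with squared mass
`m2`: the centred Gaussian law whose covariance matrix is the Green's function. -/
def gffLaw (d : ℕ) (m2 : ℝ) (U : Finset (Fin d → ℤ)) : Measure (U → ℝ) :=
  (multivariateGaussian 0 (Matrix.of fun x y : U => (green d m2 x y).toReal)).map
    (WithLp.ofLp : EuclideanSpace ℝ U → (U → ℝ))

instance isProbabilityMeasure_gffLaw (d : ℕ) (m2 : ℝ) (U : Finset (Fin d → ℤ)) :
    IsProbabilityMeasure (gffLaw d m2 U) :=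
  Measure.isProbabilityMeasure_map (by fun_prop)

/-- The law of `M` i.i.d. copies `φ¹, …, φᴹ` of the field on `U`, together with an independent
`M`-dimensional standard normal vector `Z`. -/
def gffNormalLaw (d : ℕ) (m2 : ℝ) (M : ℕ) (U : Finset (Fin d → ℤ)) :
    Measure ((Fin M → U → ℝ) × (Fin M → ℝ)) :=
  (Measure.pi fun _ : Fin M => gffLaw d m2 U).prod (Measure.pi fun _ : Fin M => gaussianReal 0 1)

/-- The law of `(β ^ (-1/2) φ_x^i)`, `x ∈ U`, `i = 1, …, M`, where `φ¹, …, φᴹ` are i.i.d.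
Gaussian free fields on `ℤ ^ d` with squared mass `m2`. -/
def scaledGFF (d : ℕ) (β m2 : ℝ) (M : ℕ) (U : Finset (Fin d → ℤ)) :
    ProbabilityMeasure (U → Fin M → ℝ) :=
  ⟨(Measure.pi fun _ : Fin M => gffLaw d m2 U).map (fun φ x i => 1 / √β * φ i x),
    Measure.isProbabilityMeasure_map (Measurable.aemeasurable (by fun_prop))⟩

/-- The law of `(β ^ (-1/2) φ_x^i + c Z^i)`, `x ∈ U`, `i = 1, …, M`, where `φ¹, …, φᴹ` are
i.i.d. massless Gaussian free fields on `ℤ ^ d` and `Z` is an independent `M`-dimensional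
standard normal vector. -/
def scaledGFFDrift (d : ℕ) (β c : ℝ) (M : ℕ) (U : Finset (Fin d → ℤ)) :
    ProbabilityMeasure (U → Fin M → ℝ) :=
  ⟨(gffNormalLaw d 0 M U).map (fun p x i => 1 / √β * p.1 i x + c * p.2 i), by
    have : IsProbabilityMeasure (gffNormalLaw d 0 M U) := by
      unfold gffNormalLaw; infer_instance
    exact Measure.isProbabilityMeasure_map (Measurable.aemeasurable (by fun_prop))⟩

/-- The laws `μ n N` converge weakly to `ν` as `N → ∞` followed by `n → ∞`: for each `n` the weak
limit as `N → ∞` exists, and these limits converge weakly to `ν` as `n → ∞`. -/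
def IteratedLimit {E : Type*} [TopologicalSpace E] [MeasurableSpace E] [OpensMeasurableSpace E]
    (μ : ℕ+ → ℕ+ → ProbabilityMeasure E) (ν : ProbabilityMeasure E) : Prop :=
  ∃ κ : ℕ+ → ProbabilityMeasure E,
    (∀ n, Tendsto (fun N => μ n N) atTop (𝓝 (κ n))) ∧ Tendsto κ atTop (𝓝 ν)

end SpinON

end

/-!
The spin `O(N)` model is a Gaussian field conditioned on its norms. On a fixed torus with adjacency
matrix `A`, the energy only changes by a constant on the product of spheres when a multiple of the
identity is added to the quadratic form. So one may choose the mass `m` for which the Green's matrix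
`G = (2 d + m - A)⁻¹` has constant diagonal `β` (`exists_posDef_unit_diag`, `exists_isTorusGreen`),
and the model becomes `N` independent Gaussian fields with covariance `C = G / β`, conditioned on
`‖φ x‖ ^ 2 = N` at every site, an event of typical size because `C x x = 1`.

For `N → ∞`, polar coordinates and Fourier inversion write the characteristic function of finitely
many components as a ratio of Fourier integrals (`integral_pi_unifSphere_eq`,
`integral_exp_tilted_eq`). After rescaling by `√N`, the `N - M` untested components contribute
the same Gaussian weight to both integrals, by the central limit theorem for squares, and dominated
convergence applies since the Fourier transform of the squares of a nondegenerate Gaussian vector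
decays (`exists_norm_sqCharFun_pow_le`). Hence the components become independent Gaussian fields
with covariance `C` (`tendsto_integral_exp_tilted`, `tendsto_spinLaw`).

For `n → ∞`, only the limit of the matrices `G` is needed (`iteratedLimit_spinLaw`). The random walk
expansion `G = ∑ A ^ k / (2 d + m) ^ (k + 1)`, and the coincidence of the walks on the torus and on
the lattice until they can wind around, give the limit as long as the mass stays away from `0`. For
`β < β_c` the Green's function of the lattice takes the value `β` at exactly one positive mass, and
monotonicity in the mass makes the masses of the tori converge to it (`tendsto_green_of_mass_pos`).

For `β ≥ β_c` the masses tend to `0`, and the expansion of `G` itself may lose mass at infinity: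
this is the origin of the constant drift. The increments `G (0, 0) - G (0, x)` do not. The remainder
of their expansion after `2 j` terms is `(2 d + m) ^ (-2 j)` times the variogram of `A ^ (2 j) G`, a
positive semidefinite matrix whose variogram over one edge is at most `A ^ (2 j) (0, 0)` by the
equation for `G`; by the triangle inequality the same holds at any fixed `x`, up to a constant that
does not depend on the torus (`exists_variogram_le`). Return probabilities tend to `0`, the massless
Green's function being finite, so the increments converge to those of the lattice
(`tendsto_green_increment`). As `G (0, 0) = β`, the limit of `G (x, y)` is the massless Green's
function plus the constant `β - β_c` (`tendsto_green_of_betaC_le`).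
-/

namespace SpinON

/-! ### Product measures and convergence in law -/

lemma lintegral_fin_nat_prod_eq_prod {n : ℕ} {X : Fin n → Type*} [∀ i, MeasurableSpace (X i)]
    (μ : (i : Fin n) → Measure (X i)) [∀ i, SigmaFinite (μ i)] (f : (i : Fin n) → X i → ℝ≥0∞)
    (hf : ∀ i, Measurable (f i)) :
    ∫⁻ x, ∏ i, f i (x i) ∂(Measure.pi μ) = ∏ i, ∫⁻ x, f i x ∂(μ i) := by
  induction n with
  | zero => simp
  | succ n ih =>
    rw [← ((measurePreserving_piFinSuccAbove μ 0).symm).lintegral_comp_emb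
      (MeasurableEquiv.measurableEmbedding _)]
    simp only [Fin.prod_univ_succ, Fin.zero_succAbove]
    rw [← ih (fun i => μ i.succ) (fun i => f i.succ) (fun i => hf _), ← lintegral_prod_mul]
    · rfl
    · exact (hf 0).aemeasurable
    · exact (Finset.measurable_prod _ fun i _ => (hf _).comp (measurable_pi_apply i)).aemeasurable

/-- Tonelli's theorem for a product of functions of separate coordinates. -/
lemma lintegral_fintype_prod_eq_prod {ι : Type*} [Fintype ι] {X : ι → Type*}
    [∀ i, MeasurableSpace (X i)] (μ : (i : ι) → Measure (X i)) [∀ i, SigmaFinite (μ i)]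
    (f : (i : ι) → X i → ℝ≥0∞) (hf : ∀ i, Measurable (f i)) :
    ∫⁻ x, ∏ i, f i (x i) ∂(Measure.pi μ) = ∏ i, ∫⁻ x, f i x ∂(μ i) := by
  let e := (Fintype.equivFin ι).symm
  rw [← (measurePreserving_piCongrLeft _ e).lintegral_comp_emb
    (MeasurableEquiv.measurableEmbedding _)]
  simp_rw [← e.prod_comp, MeasurableEquiv.coe_piCongrLeft, Equiv.piCongrLeft_apply_apply]
  exact lintegral_fin_nat_prod_eq_prod _ (fun i => f (e i)) (fun i => hf _)

lemma pi_withDensity {ι : Type*} [Fintype ι] {X : ι → Type*}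
    [∀ i, MeasurableSpace (X i)] (μ : (i : ι) → Measure (X i)) [∀ i, SigmaFinite (μ i)]
    (f : (i : ι) → X i → ℝ≥0∞) (hf : ∀ i, Measurable (f i))
    [∀ i, SigmaFinite ((μ i).withDensity (f i))] :
    Measure.pi (fun i => (μ i).withDensity (f i)) =
      (Measure.pi μ).withDensity (fun x => ∏ i, f i (x i)) := by
  classical
  refine Measure.pi_eq fun s hs => ?_
  rw [withDensity_apply _ (MeasurableSet.univ_pi hs), ← lintegral_indicator (.univ_pi hs)]
  have : ∀ x : (i : ι) → X i, (Set.univ.pi s).indicator (fun x => ∏ i, f i (x i)) x =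
      ∏ i, (s i).indicator (f i) (x i) := by
    intro x
    by_cases hx : x ∈ Set.univ.pi s
    · rw [Set.indicator_of_mem hx]
      exact Finset.prod_congr rfl fun i _ => (Set.indicator_of_mem (hx i trivial) _).symm
    · rw [Set.indicator_of_notMem hx]
      simp only [Set.mem_pi, Set.mem_univ, true_implies, not_forall] at hx
      obtain ⟨i, hi⟩ := hx
      exact (Finset.prod_eq_zero (Finset.mem_univ i) (Set.indicator_of_notMem hi _)).symm
  simp_rw [this]
  rw [lintegral_fintype_prod_eq_prod _ _ fun i => (hf i).indicator (hs i)]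
  exact Finset.prod_congr rfl fun i _ => by
    rw [lintegral_indicator (hs i), withDensity_apply _ (hs i)]

lemma map_equiv_withDensity {X Y : Type*} [MeasurableSpace X] [MeasurableSpace Y] (μ : Measure X)
    (e : X ≃ᵐ Y) (f : X → ℝ≥0∞) :
    (μ.withDensity f).map e = (μ.map e).withDensity (f ∘ e.symm) := by
  ext s hs
  rw [e.map_apply, withDensity_apply _ (e.measurable hs), withDensity_apply _ hs,
    e.restrict_map, lintegral_map_equiv]
  simp

/-- Lévy's convergence theorem along any countably generated filter. -/
lemma tendsto_of_tendsto_charFun {E ι : Type*} [NormedAddCommGroup E] [InnerProductSpace ℝ E]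
    [FiniteDimensional ℝ E] [MeasurableSpace E] [BorelSpace E] {l : Filter ι}
    [l.IsCountablyGenerated] {μ : ι → ProbabilityMeasure E} {ν : ProbabilityMeasure E}
    (h : ∀ t : E, Tendsto (fun n => charFun (μ n : Measure E) t) l (𝓝 (charFun ν t))) :
    Tendsto μ l (𝓝 ν) :=
  tendsto_of_seq_tendsto fun _ hu =>
    ProbabilityMeasure.tendsto_of_tendsto_charFun fun t => (h t).comp hu

/-- Convergence in law of arrays from convergence of their characteristic functions. -/
lemma tendsto_array_of_tendsto_charFun {ι κ σ : Type*} [Fintype ι] [Fintype κ] {l : Filter σ}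
    [l.IsCountablyGenerated] {μ : σ → ProbabilityMeasure (ι → κ → ℝ)}
    {ν : ProbabilityMeasure (ι → κ → ℝ)}
    (h : ∀ ζ : κ → ι → ℝ, Tendsto
      (fun n => ∫ s, Complex.exp ((∑ i, ∑ x, ζ i x * s x i : ℝ) * Complex.I)
        ∂(μ n : Measure (ι → κ → ℝ))) l
      (𝓝 (∫ s, Complex.exp ((∑ i, ∑ x, ζ i x * s x i : ℝ) * Complex.I)
        ∂(ν : Measure (ι → κ → ℝ))))) :
    Tendsto μ l (𝓝 ν) := by
  let F : EuclideanSpace ℝ (ι × κ) → (ι → κ → ℝ) := fun v x i => v (x, i)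
  let G : (ι → κ → ℝ) → EuclideanSpace ℝ (ι × κ) := fun s => WithLp.toLp 2 fun p => s p.1 p.2
  have hF : Continuous F := by fun_prop
  have hG : Continuous G := by fun_prop
  have key : Tendsto (fun n => (μ n).map hG.aemeasurable) l (𝓝 (ν.map hG.aemeasurable)) := by
    refine tendsto_of_tendsto_charFun fun t => ?_
    have e : ∀ m : ProbabilityMeasure (ι → κ → ℝ),
        charFun (m.map hG.aemeasurable : Measure (EuclideanSpace ℝ (ι × κ))) t =
          ∫ s, Complex.exp ((∑ i, ∑ x, t (x, i) * s x i : ℝ) * Complex.I)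
            ∂(m : Measure (ι → κ → ℝ)) := by
      intro m
      rw [charFun_apply, ProbabilityMeasure.toMeasure_map,
        integral_map hG.aemeasurable (by fun_prop)]
      congr 1 with s
      congr 3
      rw [PiLp.inner_apply, Fintype.sum_prod_type_right]
      rfl
    simp_rw [e]
    exact h fun i x => t (x, i)
  have := ProbabilityMeasure.tendsto_map_of_tendsto_of_continuous _ _ key hF
  have e : ∀ m : ProbabilityMeasure (ι → κ → ℝ),
      (m.map hG.aemeasurable).map hF.aemeasurable = m := by
    intro m
    apply Subtype.ext
    change ((m : Measure (ι → κ → ℝ)).map G).map F = m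
    rw [Measure.map_map hF.measurable hG.measurable]
    exact Measure.map_id
  simpa only [e] using this

/-! ### Polar coordinates with the squared norm as radial variable -/

/-- The density of the image of the Lebesgue measure on `ℝ ^ N` under `φ ↦ ‖φ‖ ^ 2`. -/
noncomputable def radialDensity (N : ℕ) (u : ℝ) : ℝ :=
  (Set.Ioi 0).indicator (fun u =>
    ((volume : Measure (EuclideanSpace ℝ (Fin N))).toSphere Set.univ).toReal *
      (√u ^ (N - 1) / (2 * √u))) u

lemma radialDensity_nonneg (N : ℕ) (u : ℝ) : 0 ≤ radialDensity N u := by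
  unfold radialDensity
  exact Set.indicator_nonneg (fun _ _ => by positivity) u

lemma radialDensity_of_nonpos {N : ℕ} {u : ℝ} (hu : u ≤ 0) : radialDensity N u = 0 :=
  Set.indicator_of_notMem (by simpa using hu) _

lemma measurable_radialDensity (N : ℕ) : Measurable (radialDensity N) :=
  Measurable.indicator (by fun_prop) measurableSet_Ioi

lemma continuousAt_radialDensity (N : ℕ) {u : ℝ} (hu : 0 < u) :
    ContinuousAt (radialDensity N) u := by
  have h : ContinuousAt (fun u : ℝ =>
      ((volume : Measure (EuclideanSpace ℝ (Fin N))).toSphere Set.univ).toReal *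
      (√u ^ (N - 1) / (2 * √u))) u := by
    refine continuousAt_const.mul (ContinuousAt.div (by fun_prop) (by fun_prop) ?_)
    have : √u ≠ 0 := (Real.sqrt_pos.2 hu).ne'
    simpa using this
  refine ContinuousAt.congr h ?_
  filter_upwards [Ioi_mem_nhds hu] with v hv
  rw [radialDensity, Set.indicator_of_mem hv]

lemma toSphere_univ_ne_zero (N : ℕ) [NeZero N] :
    (volume : Measure (EuclideanSpace ℝ (Fin N))).toSphere Set.univ ≠ 0 := by
  have : Nonempty (Fin N) := ⟨⟨0, Nat.pos_of_ne_zero (NeZero.ne N)⟩⟩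
  rw [Ne, Measure.measure_univ_eq_zero]
  exact Measure.toSphere_ne_zero _

lemma radialDensity_pos (N : ℕ) [NeZero N] {u : ℝ} (hu : 0 < u) : 0 < radialDensity N u := by
  rw [radialDensity, Set.indicator_of_mem (Set.mem_Ioi.2 hu)]
  have := Real.sqrt_pos.2 hu
  have := ENNReal.toReal_pos (toSphere_univ_ne_zero N) (measure_ne_top _ _)
  positivity

lemma lintegral_unifSphere (N : ℕ) (F : EuclideanSpace ℝ (Fin N) → ℝ≥0∞) (hF : Measurable F) :
    ∫⁻ v, F v ∂unifSphere N =
      ((volume : Measure (EuclideanSpace ℝ (Fin N))).toSphere Set.univ)⁻¹ *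
        ∫⁻ θ, F (√(N : ℝ) • (θ : EuclideanSpace ℝ (Fin N)))
          ∂(volume : Measure (EuclideanSpace ℝ (Fin N))).toSphere := by
  rw [unifSphere, lintegral_map hF (by fun_prop), lintegral_smul_measure, smul_eq_mul]

/-- Integration in polar coordinates, with the squared norm as the radial variable. -/
lemma lintegral_eq_lintegral_polar (N : ℕ) [NeZero N] (F : EuclideanSpace ℝ (Fin N) → ℝ≥0∞)
    (hF : Measurable F) :
    ∫⁻ φ, F φ = ∫⁻ u, ENNReal.ofReal (radialDensity N u) *
      ∫⁻ v, F (√(u / N) • v) ∂unifSphere N := by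
  have hne : Nonempty (Fin N) := ⟨⟨0, Nat.pos_of_ne_zero (NeZero.ne N)⟩⟩
  have hN : (0 : ℝ) < N := Nat.cast_pos.2 (Nat.pos_of_ne_zero (NeZero.ne N))
  set σ := (volume : Measure (EuclideanSpace ℝ (Fin N))).toSphere with hσ
  have h0 : σ Set.univ ≠ 0 := toSphere_univ_ne_zero N
  have h1 : σ Set.univ ≠ ∞ := measure_ne_top _ _
  set K : ℝ → ℝ≥0∞ := fun r => ∫⁻ θ, F (r • (θ : EuclideanSpace ℝ (Fin N))) ∂σ with hK
  have hL : ∫⁻ φ, F φ = ∫⁻ r in Set.Ioi (0 : ℝ), ENNReal.ofReal (r ^ (N - 1)) * K r := by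
    have e1 : ∫⁻ φ, F φ = ∫⁻ x : ↥({0}ᶜ : Set (EuclideanSpace ℝ (Fin N))), F x.1
        ∂(Measure.comap Subtype.val volume) := by
      rw [lintegral_subtype_comap (measurableSet_singleton _).compl]
      rw [restrict_compl_singleton]
    have e2 := ((volume :
      Measure (EuclideanSpace ℝ (Fin N))).measurePreserving_homeomorphUnitSphereProd.symm
      (homeomorphUnitSphereProd _).toMeasurableEquiv).lintegral_comp
        (f := fun x : ↥({0}ᶜ : Set (EuclideanSpace ℝ (Fin N))) => F x.1)
        (hF.comp measurable_subtype_coe)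
    rw [e1, ← e2, lintegral_prod_symm _ (by
      refine (hF.comp measurable_subtype_coe).comp_aemeasurable ?_
      exact (MeasurableEquiv.measurable _).aemeasurable)]
    simp only [Homeomorph.toMeasurableEquiv_symm_coe, homeomorphUnitSphereProd_symm_apply_coe,
      finrank_euclideanSpace, Fintype.card_fin]
    have hKm : Measurable fun r : Set.Ioi (0 : ℝ) => K r := by
      refine Measurable.lintegral_prod_right' (ν := σ)
        (f := fun p : Set.Ioi (0 : ℝ) × Metric.sphere (0 : EuclideanSpace ℝ (Fin N)) 1 =>
          F ((p.1 : ℝ) • (p.2 : EuclideanSpace ℝ (Fin N)))) ?_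
      exact hF.comp (by fun_prop)
    rw [Measure.volumeIoiPow, lintegral_withDensity_eq_lintegral_mul _ (by fun_prop) hKm]
    exact lintegral_subtype_comap measurableSet_Ioi
      (fun r : ℝ => ENNReal.ofReal (r ^ (N - 1)) * K r)
  have hR : ∀ u, ENNReal.ofReal (radialDensity N u) * ∫⁻ v, F (√(u / N) • v) ∂unifSphere N =
      (Set.Ioi (0 : ℝ)).indicator
        (fun u => ENNReal.ofReal (√u ^ (N - 1) / (2 * √u)) * K √u) u := by
    intro u
    by_cases hu : 0 < u
    · rw [Set.indicator_of_mem (Set.mem_Ioi.2 hu), radialDensity,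
        Set.indicator_of_mem (Set.mem_Ioi.2 hu),
        lintegral_unifSphere N (fun v => F (√(u / N) • v)) (hF.comp (by fun_prop)),
        ENNReal.ofReal_mul ENNReal.toReal_nonneg, ENNReal.ofReal_toReal h1]
      have : ∀ θ : EuclideanSpace ℝ (Fin N), √(u / N) • √(N : ℝ) • θ = √u • θ := by
        intro θ
        rw [smul_smul, ← Real.sqrt_mul (by positivity), div_mul_cancel₀ _ hN.ne']
      simp_rw [this]
      rw [mul_mul_mul_comm, ENNReal.mul_inv_cancel h0 h1, one_mul]
    · rw [Set.indicator_of_notMem (by simpa using hu), radialDensity_of_nonpos (not_lt.1 hu)]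
      simp
  simp_rw [hR]
  rw [lintegral_indicator measurableSet_Ioi, hL]
  -- substitute `u = r ^ 2`
  have himg : (fun r : ℝ => r ^ 2) '' Set.Ioi 0 = Set.Ioi 0 := by
    ext u
    constructor
    · rintro ⟨r, hr, rfl⟩
      exact pow_pos (Set.mem_Ioi.1 hr) 2
    · intro hu
      exact ⟨√u, Real.sqrt_pos.2 hu, Real.sq_sqrt (Set.mem_Ioi.1 hu).le⟩
  have hinj : Set.InjOn (fun r : ℝ => r ^ 2) (Set.Ioi 0) := fun a ha b hb h =>
    (pow_left_inj₀ (Set.mem_Ioi.1 ha).le (Set.mem_Ioi.1 hb).le two_ne_zero).1 h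
  have hcv := lintegral_image_eq_lintegral_abs_deriv_mul measurableSet_Ioi
    (f := fun r : ℝ => r ^ 2) (f' := fun r => 2 * r) (s := Set.Ioi (0 : ℝ))
    (fun x _ => by simpa using (hasDerivAt_pow 2 x).hasDerivWithinAt) hinj
    (fun u => ENNReal.ofReal (√u ^ (N - 1) / (2 * √u)) * K √u)
  rw [himg] at hcv
  rw [hcv]
  refine setLIntegral_congr_fun measurableSet_Ioi fun r hr => ?_
  have hr' : 0 < r := hr
  rw [Real.sqrt_sq hr'.le, ← mul_assoc, ← ENNReal.ofReal_mul (abs_nonneg _),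
    abs_of_pos (by positivity), mul_div_cancel₀ _ (by positivity)]

/-! ### Conditioning on the squared norms by Fourier inversion -/

section

/-- The configuration with squared norms `u x` and directions those of `S x`, when the `S x` lie
on the sphere of radius `√N`. -/
noncomputable def polarConfig {Λ : Type*} (N : ℕ) (u : Λ → ℝ)
    (S : Λ → EuclideanSpace ℝ (Fin N)) : Λ → EuclideanSpace ℝ (Fin N) :=
  fun x => √(u x / N) • S x

lemma continuous_polarConfig {Λ : Type*} (N : ℕ) :
    Continuous fun p : (Λ → ℝ) × (Λ → EuclideanSpace ℝ (Fin N)) => polarConfig N p.1 p.2 := by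
  unfold polarConfig
  fun_prop

lemma ae_norm_pi_unifSphere {Λ : Type*} [Fintype Λ] (N : ℕ) [NeZero N] :
    ∀ᵐ S ∂(Measure.pi fun _ : Λ => unifSphere N), ∀ x, ‖S x‖ = √(N : ℝ) := by
  rw [ae_all_iff]
  exact fun x => (measurePreserving_eval (fun _ : Λ => unifSphere N) x).quasiMeasurePreserving.ae
      (norm_ae_unifSphere N)

lemma norm_sq_polarConfig {Λ : Type*} {N : ℕ} [NeZero N] {u : Λ → ℝ} {x : Λ} (hu : 0 ≤ u x)
    {S : Λ → EuclideanSpace ℝ (Fin N)} (hS : ‖S x‖ = √(N : ℝ)) :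
    ‖polarConfig N u S x‖ ^ 2 = u x := by
  have hN : (N : ℝ) ≠ 0 := Nat.cast_ne_zero.2 (NeZero.ne N)
  rw [polarConfig, norm_smul, hS, mul_pow, Real.norm_of_nonneg (Real.sqrt_nonneg _),
    Real.sq_sqrt (by positivity), Real.sq_sqrt (by positivity), div_mul_cancel₀ _ hN]

/-- Polar coordinates at every site. -/
lemma measurePreserving_polarConfig (Λ : Type*) [Fintype Λ] (N : ℕ) [NeZero N] :
    MeasurePreserving (fun p : (Λ → ℝ) × (Λ → EuclideanSpace ℝ (Fin N)) => polarConfig N p.1 p.2)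
      (((volume : Measure (Λ → ℝ)).withDensity
        fun u => ∏ x, ENNReal.ofReal (radialDensity N (u x))).prod
          (Measure.pi fun _ : Λ => unifSphere N)) volume := by
  have hρ : Measurable fun u => ENNReal.ofReal (radialDensity N u) :=
    (measurable_radialDensity N).ennreal_ofReal
  have hsf : SigmaFinite ((volume : Measure ℝ).withDensity
      fun u => ENNReal.ofReal (radialDensity N u)) :=
    SigmaFinite.withDensity_of_ne_top (Eventually.of_forall fun _ => ENNReal.ofReal_ne_top)
  have h1 : MeasurePreserving (fun p : ℝ × EuclideanSpace ℝ (Fin N) => √(p.1 / N) • p.2)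
      (((volume : Measure ℝ).withDensity fun u => ENNReal.ofReal (radialDensity N u)).prod
        (unifSphere N)) volume := by
    have hm : Measurable (fun p : ℝ × EuclideanSpace ℝ (Fin N) => √(p.1 / N) • p.2) := by fun_prop
    refine ⟨hm, Measure.ext_of_lintegral _ fun F hF => ?_⟩
    rw [lintegral_map hF hm, lintegral_prod (fun p : ℝ × EuclideanSpace ℝ (Fin N) =>
      F (√(p.1 / N) • p.2)) (hF.comp hm).aemeasurable,
      lintegral_withDensity_eq_lintegral_mul _ hρ
        (Measurable.lintegral_prod_right' (f := fun p : ℝ × EuclideanSpace ℝ (Fin N) =>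
          F (√(p.1 / N) • p.2)) (hF.comp hm)), lintegral_eq_lintegral_polar N F hF]
    rfl
  have h2 := measurePreserving_pi (fun _ : Λ => ((volume : Measure ℝ).withDensity
    fun u => ENNReal.ofReal (radialDensity N u)).prod (unifSphere N)) (fun _ : Λ => volume)
    fun _ => h1
  have h3 := (measurePreserving_arrowProdEquivProdArrow ℝ (EuclideanSpace ℝ (Fin N)) Λ
    (fun _ => (volume : Measure ℝ).withDensity fun u => ENNReal.ofReal (radialDensity N u))
    (fun _ => unifSphere N)).symm
  rw [pi_withDensity (fun _ : Λ => (volume : Measure ℝ)) _ fun _ => hρ] at h3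
  exact h2.comp h3

variable {Λ : Type*} [Fintype Λ]

/-- The density at `u` of the squared norms `(‖φ x‖ ^ 2)_x`, when `φ` has density `H`. -/
noncomputable def sqNormDensity (N : ℕ) (H : (Λ → EuclideanSpace ℝ (Fin N)) → ℂ)
    (u : Λ → ℝ) : ℂ :=
  (∏ x, radialDensity N (u x)) • ∫ S, H (polarConfig N u S) ∂(Measure.pi fun _ => unifSphere N)

lemma toReal_prod_radialDensity (N : ℕ) (u : Λ → ℝ) :
    (∏ x, ENNReal.ofReal (radialDensity N (u x))).toReal = ∏ x, radialDensity N (u x) := by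
  rw [ENNReal.toReal_prod]
  exact Finset.prod_congr rfl fun x _ => ENNReal.toReal_ofReal (radialDensity_nonneg _ _)

lemma measurable_prod_radialDensity (N : ℕ) :
    Measurable fun u : Λ → ℝ => ∏ x, ENNReal.ofReal (radialDensity N (u x)) :=
  Finset.measurable_prod _ fun x _ =>
    ((measurable_radialDensity N).comp (measurable_pi_apply x)).ennreal_ofReal

lemma prod_ofReal_lt_top (N : ℕ) (u : Λ → ℝ) :
    ∏ x, ENNReal.ofReal (radialDensity N (u x)) < ∞ :=
  ENNReal.prod_lt_top fun _ _ => ENNReal.ofReal_lt_top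

/-- Disintegration of a complex measure on configurations according to the squared norms. -/
lemma integral_sqNormDensity {N : ℕ} [NeZero N] {H : (Λ → EuclideanSpace ℝ (Fin N)) → ℂ}
    (hH : Integrable H) :
    Integrable (sqNormDensity N H) ∧ ∫ u, sqNormDensity N H u = ∫ φ, H φ := by
  have hmp := measurePreserving_polarConfig Λ N
  have : SigmaFinite ((volume : Measure (Λ → ℝ)).withDensity
        fun u => ∏ x, ENNReal.ofReal (radialDensity N (u x))) :=
    SigmaFinite.withDensity_of_ne_top (Eventually.of_forall fun u => (prod_ofReal_lt_top N u).ne)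
  have hlt := Eventually.of_forall (f := ae (volume : Measure (Λ → ℝ))) fun u =>
    prod_ofReal_lt_top N u
  have hI := hmp.integrable_comp_of_integrable hH
  constructor
  · have := (integrable_withDensity_iff_integrable_smul' (measurable_prod_radialDensity N) hlt).1
      hI.integral_prod_left
    simp_rw [toReal_prod_radialDensity] at this
    exact this
  · rw [← hmp.map_eq, integral_map hmp.measurable.aemeasurable
      (by rw [hmp.map_eq]; exact hH.aestronglyMeasurable), integral_prod (fun p : (Λ → ℝ) × _ =>
      H (polarConfig N p.1 p.2)) hI,
      integral_withDensity_eq_integral_toReal_smul (measurable_prod_radialDensity N) hlt]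
    simp_rw [toReal_prod_radialDensity]
    rfl

lemma sqNormDensity_mul {N : ℕ} [NeZero N] (H : (Λ → EuclideanSpace ℝ (Fin N)) → ℂ)
    (K : (Λ → ℝ) → ℂ) (u : Λ → ℝ) :
    sqNormDensity N (fun φ => K (fun x => ‖φ x‖ ^ 2) * H φ) u = K u * sqNormDensity N H u := by
  unfold sqNormDensity
  by_cases hu : ∀ x, 0 ≤ u x
  · rw [mul_smul_comm, ← integral_const_mul]
    congr 1
    refine integral_congr_ae ?_
    filter_upwards [ae_norm_pi_unifSphere N] with S hS
    simp_rw [norm_sq_polarConfig (hu _) (hS _)]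
  · push Not at hu
    obtain ⟨x, hx⟩ := hu
    rw [Finset.prod_eq_zero (Finset.mem_univ x) (radialDensity_of_nonpos hx.le)]
    simp

lemma continuousAt_sqNormDensity {N : ℕ} [NeZero N] {H : (Λ → EuclideanSpace ℝ (Fin N)) → ℂ}
    (hc : Continuous H) {b : ℝ} (hb : ∀ φ, ‖H φ‖ ≤ b) {u : Λ → ℝ} (hu : ∀ x, 0 < u x) :
    ContinuousAt (sqNormDensity N H) u := by
  refine ContinuousAt.smul (f := fun u : Λ → ℝ => ∏ x, radialDensity N (u x))
    (tendsto_finsetProd _ fun x _ => ?_) (Continuous.continuousAt ?_)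
  · exact ContinuousAt.comp (f := fun u : Λ → ℝ => u x) (continuousAt_radialDensity N (hu x))
      (continuous_apply x).continuousAt
  · refine continuous_of_dominated (bound := fun _ => b) (fun v => ?_)
      (fun v => Eventually.of_forall fun S => hb _) (integrable_const _)
      (Eventually.of_forall fun S => ?_)
    · exact (hc.comp ((continuous_polarConfig N).comp (by fun_prop :
        Continuous fun S : Λ → EuclideanSpace ℝ (Fin N) => (v, S)))).aestronglyMeasurable
    · exact hc.comp ((continuous_polarConfig N).comp
        (by fun_prop : Continuous fun v : Λ → ℝ => (v, S)))

/-- Fourier inversion for the squared norms: conditioning on `‖φ x‖ ^ 2 = N` for all `x` is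
expressed through the Fourier transform `Φ` of the squared norms. -/
lemma integral_pi_unifSphere_eq {N : ℕ} [NeZero N] {H : (Λ → EuclideanSpace ℝ (Fin N)) → ℂ}
    (hc : Continuous H) {b : ℝ} (hb : ∀ φ, ‖H φ‖ ≤ b) (hH : Integrable H)
    {Φ : EuclideanSpace ℝ Λ → ℂ}
    (hΦ : ∀ w, Φ w = ∫ φ, Complex.exp ((-2 * Real.pi * ∑ x, w x * ‖φ x‖ ^ 2 : ℝ) * Complex.I) * H φ)
    (hI : Integrable Φ) :
    (radialDensity N N ^ Fintype.card Λ : ℝ) • ∫ S, H S ∂(Measure.pi fun _ : Λ => unifSphere N) =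
      ∫ w, Complex.exp ((2 * Real.pi * (N * ∑ x, w x) : ℝ) * Complex.I) * Φ w := by
  set g : EuclideanSpace ℝ Λ → ℂ := fun v => sqNormDensity N H (WithLp.ofLp v) with hg
  have hN : (0 : ℝ) < N := Nat.cast_pos.2 (Nat.pos_of_ne_zero (NeZero.ne N))
  have hgi : Integrable g :=
    (PiLp.volume_preserving_ofLp Λ).integrable_comp_of_integrable (integral_sqNormDensity hH).1
  have hF : FourierTransform.fourier g = Φ := by
    funext w
    rw [Real.fourier_eq', hΦ]
    have h1 := (integral_sqNormDensity (N := N) (Λ := Λ)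
      (H := fun φ => Complex.exp ((-2 * Real.pi * ∑ x, w x * ‖φ x‖ ^ 2 : ℝ) * Complex.I) * H φ)
      (hH.bdd_mul (c := 1) (Continuous.aestronglyMeasurable (by fun_prop))
        (Eventually.of_forall fun φ => by rw [Complex.norm_exp_ofReal_mul_I]))).2
    rw [← h1]
    have h2 := fun u : Λ → ℝ => sqNormDensity_mul (N := N) H
      (fun u => Complex.exp ((-2 * Real.pi * ∑ x, w x * u x : ℝ) * Complex.I)) u
    simp_rw [h2]
    rw [← (PiLp.volume_preserving_ofLp Λ).integral_comp
      (MeasurableEquiv.toLp 2 (Λ → ℝ)).symm.measurableEmbedding]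
    refine integral_congr_ae (Eventually.of_forall fun v => ?_)
    simp only [smul_eq_mul, hg, PiLp.inner_apply, RCLike.inner_apply, conj_trivial]
  have hinv := hgi.fourierInv_fourier_eq (by rw [hF]; exact hI)
    (v := WithLp.toLp 2 fun _ => (N : ℝ))
    (ContinuousAt.comp (f := (WithLp.ofLp : EuclideanSpace ℝ Λ → Λ → ℝ))
      (continuousAt_sqNormDensity hc hb fun _ => hN) (by fun_prop))
  rw [hF, Real.fourierInv_eq'] at hinv
  have hs : g (WithLp.toLp 2 fun _ => (N : ℝ)) = (radialDensity N N ^ Fintype.card Λ : ℝ) •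
      ∫ S, H S ∂(Measure.pi fun _ : Λ => unifSphere N) := by
    have hone : ∀ S : Λ → EuclideanSpace ℝ (Fin N), polarConfig N (fun _ => (N : ℝ)) S = S := by
      intro S
      funext x
      rw [polarConfig, div_self hN.ne', Real.sqrt_one, one_smul]
    simp only [hg, sqNormDensity, Finset.prod_const, Finset.card_univ, hone]
  rw [← hs, ← hinv]
  refine integral_congr_ae (Eventually.of_forall fun v => ?_)
  simp only [smul_eq_mul, PiLp.inner_apply, RCLike.inner_apply, conj_trivial, Finset.mul_sum]

end

/-! ### Gaussian vector fields and their density -/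

section

open scoped MatrixOrder

/-- The quadratic form `∑ B x y ⟨φ x, φ y⟩` in a vector-valued field `φ`. -/
noncomputable def quadEnergy {Λ : Type*} [Fintype Λ] {N : ℕ} (B : Matrix Λ Λ ℝ)
    (φ : Λ → EuclideanSpace ℝ (Fin N)) : ℝ :=
  ∑ x, ∑ y, B x y * inner ℝ (φ x) (φ y)

/-- `N` fields on `Λ`, seen as one field with values in `ℝ ^ N`. -/
noncomputable def vectorField {Λ : Type*} {N : ℕ} (Y : Fin N → EuclideanSpace ℝ Λ) :
    Λ → EuclideanSpace ℝ (Fin N) :=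
  fun x => WithLp.toLp 2 fun i => Y i x

lemma continuous_vectorField {Λ : Type*} {N : ℕ} : Continuous (vectorField (Λ := Λ) (N := N)) := by
  unfold vectorField
  fun_prop

lemma continuous_quadEnergy {Λ : Type*} [Fintype Λ] {N : ℕ} (B : Matrix Λ Λ ℝ) :
    Continuous (quadEnergy (N := N) B) := by
  unfold quadEnergy
  fun_prop

lemma sum_mul_eq_dotProduct_mulVec {Λ : Type*} [Fintype Λ] (B : Matrix Λ Λ ℝ) (w : Λ → ℝ) :
    ∑ x, ∑ y, B x y * (w x * w y) = w ⬝ᵥ (B.mulVec w) := by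
  simp only [dotProduct, Matrix.mulVec, Finset.mul_sum]
  exact Finset.sum_congr rfl fun x _ => Finset.sum_congr rfl fun y _ => by ring

variable {Λ : Type*} [Fintype Λ] [DecidableEq Λ]

/-- The map sending `N` independent white noises on `Λ` to a field with values in `ℝ ^ N` whose
components have covariance `R * Rᵀ`. -/
noncomputable def mixEquiv (N : ℕ) (R : Matrix Λ Λ ℝ) (hR : IsUnit R.det) :
    (Fin N → Λ → ℝ) ≃L[ℝ] (Λ → EuclideanSpace ℝ (Fin N)) :=
  LinearEquiv.toContinuousLinearEquiv
    { toFun := fun X x => WithLp.toLp 2 fun i => (R.mulVec (X i)) x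
      map_add' := by
        intro X Y
        ext x i
        simp [Matrix.mulVec_add]
      map_smul' := by
        intro c X
        ext x i
        simp [Matrix.mulVec_smul]
      invFun := fun φ i => R⁻¹.mulVec fun x => φ x i
      left_inv := by
        intro X
        ext i y
        simp [Matrix.mulVec_mulVec, Matrix.nonsing_inv_mul _ hR]
      right_inv := by
        intro φ
        ext x i
        simp [Matrix.mulVec_mulVec, Matrix.mul_nonsing_inv _ hR] }

lemma quadEnergy_mixEquiv {N : ℕ} {R B : Matrix Λ Λ ℝ} (hR : IsUnit R.det)
    (hRB : R.transpose * B * R = 1) (X : Fin N → Λ → ℝ) :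
    quadEnergy B (mixEquiv N R hR X) = ∑ i, ∑ x, X i x ^ 2 := by
  have h : ∀ v : Λ → ℝ, ∑ x, ∑ y, B x y * ((R.mulVec v) x * (R.mulVec v) y) = ∑ x, v x ^ 2 := by
    intro v
    calc _ = (R.mulVec v) ⬝ᵥ (B.mulVec (R.mulVec v)) := sum_mul_eq_dotProduct_mulVec B _
      _ = v ⬝ᵥ ((R.transpose * B * R).mulVec v) := by
          rw [Matrix.mul_assoc, ← Matrix.mulVec_mulVec v R.transpose,
            Matrix.dotProduct_mulVec v R.transpose, Matrix.vecMul_transpose,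
            ← Matrix.mulVec_mulVec]
      _ = _ := by
          rw [hRB, Matrix.one_mulVec]
          exact Finset.sum_congr rfl fun x _ => (sq _).symm
  simp_rw [← h]
  rw [quadEnergy, Finset.sum_comm]
  calc _ = ∑ y, ∑ x, ∑ i, B x y * ((R.mulVec (X i)) x * (R.mulVec (X i)) y) := by
        refine Finset.sum_congr rfl fun y _ => Finset.sum_congr rfl fun x _ => ?_
        rw [PiLp.inner_apply, Finset.mul_sum]
        refine Finset.sum_congr rfl fun i _ => ?_
        simp only [RCLike.inner_apply, conj_trivial]
        rw [mul_comm (R.mulVec (X i) x)]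
        rfl
    _ = _ := by
        rw [Finset.sum_comm]
        simp_rw [Finset.sum_comm (s := (Finset.univ : Finset Λ))
          (t := (Finset.univ : Finset (Fin N)))]

/-- `N` independent Gaussian fields with covariance `C = B⁻¹` have a joint density proportional to
`exp (-quadEnergy B / 2)`. -/
lemma exists_map_vectorField_eq (N : ℕ) {B C : Matrix Λ Λ ℝ} (hC : C.PosDef) (hBC : B * C = 1) :
    ∃ c : ℝ≥0∞, c ≠ 0 ∧ c ≠ ∞ ∧
      (Measure.pi fun _ : Fin N => multivariateGaussian 0 C).map vectorField =
        c • (volume : Measure (Λ → EuclideanSpace ℝ (Fin N))).withDensity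
          fun φ => ENNReal.ofReal (Real.exp (-quadEnergy B φ / 2)) := by
  set R := CFC.sqrt C with hRdef
  have hRR : R * R = C := CFC.sqrt_mul_sqrt_self C hC.posSemidef.nonneg
  have hRt : R.transpose = R := by
    have : R.IsHermitian := (Matrix.nonneg_iff_posSemidef.1 (CFC.sqrt_nonneg C)).isHermitian
    simpa [Matrix.IsHermitian] using this
  have hdet : IsUnit R.det := by
    have : IsUnit (R * R).det := by rw [hRR]; exact hC.det_pos.ne'.isUnit
    rw [Matrix.det_mul] at this
    exact isUnit_of_mul_isUnit_left this
  have hRB : R.transpose * B * R = 1 := by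
    have h1 : (B * R) * R = 1 := by rw [Matrix.mul_assoc, hRR, hBC]
    rw [hRt, Matrix.mul_assoc]
    exact mul_eq_one_comm.1 h1
  set L := mixEquiv N R hdet with hL
  set g : Measure (Fin N → Λ → ℝ) := Measure.pi fun _ => Measure.pi fun _ => gaussianReal 0 1
    with hg
  have h1 : (Measure.pi fun _ : Fin N => multivariateGaussian 0 C).map vectorField = g.map L := by
    have hm : ∀ i : Fin N, Measurable fun v : Λ → ℝ =>
        (0 : EuclideanSpace ℝ Λ) + Matrix.toEuclideanCLM (𝕜 := ℝ) R (WithLp.toLp 2 v) := by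
      intro i
      fun_prop
    have : (Measure.pi fun _ : Fin N => multivariateGaussian 0 C) =
        g.map fun X i => (0 : EuclideanSpace ℝ Λ) +
          Matrix.toEuclideanCLM (𝕜 := ℝ) R (WithLp.toLp 2 (X i)) := by
      have e : multivariateGaussian 0 C = (Measure.pi fun _ : Λ => gaussianReal 0 1).map
          fun v => (0 : EuclideanSpace ℝ Λ) +
            Matrix.toEuclideanCLM (𝕜 := ℝ) R (WithLp.toLp 2 v) := by
        rw [multivariateGaussian, ← map_pi_eq_stdGaussian, Measure.map_map (by fun_prop)
          (by fun_prop)]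
        rfl
      rw [hg, Measure.pi_map_pi fun i => (hm i).aemeasurable]
      simp_rw [e]
    rw [this, Measure.map_map continuous_vectorField.measurable
      (by fun_prop)]
    congr 1
    funext X
    ext x i
    simp only [Function.comp_apply, vectorField, zero_add]
    rfl
  have h2 : g = (volume : Measure (Fin N → Λ → ℝ)).withDensity
      fun X => ∏ i, ∏ x, gaussianPDF 0 1 (X i x) := by
    have hpdf : Measurable (gaussianPDF 0 1) := measurable_gaussianPDF 0 1
    have e0 : gaussianReal 0 1 = volume.withDensity (gaussianPDF 0 1) :=
      gaussianReal_of_var_ne_zero 0 one_ne_zero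
    have i0 : IsProbabilityMeasure ((volume : Measure ℝ).withDensity (gaussianPDF 0 1)) := by
      rw [← e0]; infer_instance
    have e1 : (Measure.pi fun _ : Λ => gaussianReal 0 1) =
        (volume : Measure (Λ → ℝ)).withDensity fun v => ∏ x, gaussianPDF 0 1 (v x) := by
      simp_rw [e0]
      exact pi_withDensity (fun _ : Λ => (volume : Measure ℝ)) _ fun _ => hpdf
    have i1 : IsProbabilityMeasure
        ((volume : Measure (Λ → ℝ)).withDensity fun v => ∏ x, gaussianPDF 0 1 (v x)) := by
      rw [← e1]; infer_instance
    rw [hg]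
    simp_rw [e1]
    exact pi_withDensity (fun _ : Fin N => (volume : Measure (Λ → ℝ)))
      (fun _ v => ∏ x, gaussianPDF 0 1 (v x)) fun _ => by fun_prop
  -- the image of the Lebesgue measure under `L` is a multiple of the Lebesgue measure
  have hhaar : ((volume : Measure (Fin N → Λ → ℝ)).map L).IsAddHaarMeasure :=
    L.isAddHaarMeasure_map _
  have hc := Measure.isAddLeftInvariant_eq_smul ((volume : Measure (Fin N → Λ → ℝ)).map L)
    (volume : Measure (Λ → EuclideanSpace ℝ (Fin N)))
  set c := ((volume : Measure (Fin N → Λ → ℝ)).map L).addHaarScalarFactor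
    (volume : Measure (Λ → EuclideanSpace ℝ (Fin N))) with hcdef
  have hc0 : c ≠ 0 := (Measure.addHaarScalarFactor_pos_of_isAddHaarMeasure _ _).ne'
  set k : ℝ := ((√(2 * Real.pi * (1 : NNReal)))⁻¹ ^ Fintype.card Λ) ^ N with hk
  have hk0 : 0 < k := by positivity
  have hD : ∀ X : Fin N → Λ → ℝ, ∏ i, ∏ x, gaussianPDF 0 1 (X i x) =
      ENNReal.ofReal k * ENNReal.ofReal (Real.exp (-quadEnergy B (L X) / 2)) := by
    intro X
    rw [hL, quadEnergy_mixEquiv hdet hRB, ← ENNReal.ofReal_mul hk0.le]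
    simp only [gaussianPDF, gaussianPDFReal]
    rw [show ∀ f : Fin N → Λ → ℝ, (∀ i x, 0 ≤ f i x) → ∏ i, ∏ x, ENNReal.ofReal (f i x) =
        ENNReal.ofReal (∏ i, ∏ x, f i x) from fun f hf => by
          rw [ENNReal.ofReal_prod_of_nonneg fun i _ => Finset.prod_nonneg fun x _ => hf i x]
          exact Finset.prod_congr rfl fun i _ =>
            (ENNReal.ofReal_prod_of_nonneg fun x _ => hf i x).symm]
    · congr 1
      simp only [Finset.prod_mul_distrib, Finset.prod_const, Finset.card_univ, Fintype.card_fin,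
        ← Real.exp_sum, hk]
      congr 2
      simp [Finset.sum_div, Finset.sum_neg_distrib, neg_div]
    · intro i x
      positivity
  refine ⟨c * ENNReal.ofReal k, ?_, ?_, ?_⟩
  · exact mul_ne_zero (by simpa using hc0) (by simpa using hk0)
  · exact ENNReal.mul_ne_top ENNReal.coe_ne_top ENNReal.ofReal_ne_top
  · have h3 := map_equiv_withDensity (volume : Measure (Fin N → Λ → ℝ))
      L.toHomeomorph.toMeasurableEquiv fun X => ∏ i, ∏ x, gaussianPDF 0 1 (X i x)
    rw [h1, h2]
    refine h3.trans ?_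
    have h4 : (volume : Measure (Fin N → Λ → ℝ)).map L.toHomeomorph.toMeasurableEquiv =
        c • volume := hc
    have h5 : ((fun X : Fin N → Λ → ℝ => ∏ i, ∏ x, gaussianPDF 0 1 (X i x)) ∘
        L.toHomeomorph.toMeasurableEquiv.symm) =
          ENNReal.ofReal k • fun φ => ENNReal.ofReal (Real.exp (-quadEnergy B φ / 2)) := by
      funext φ
      have := hD (L.symm φ)
      rw [L.apply_symm_apply] at this
      exact this
    rw [h4, h5, withDensity_smul _ (by
      have := continuous_quadEnergy (N := N) B
      fun_prop), show c • (volume : Measure (Λ → EuclideanSpace ℝ (Fin N))) =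
      (c : ℝ≥0∞) • volume from rfl, withDensity_smul_measure, smul_smul, mul_comm]

end

/-! ### Spin systems as ratios of Gaussian Fourier integrals -/

section

/-- The joint Fourier transform, under `γ`, of the field and of its squares. -/
noncomputable def sqCharFun {Λ : Type*} [Fintype Λ] (γ : Measure (EuclideanSpace ℝ Λ))
    (ξ t : Λ → ℝ) : ℂ :=
  ∫ y, Complex.exp ((∑ x, ξ x * y x + ∑ x, t x * y x ^ 2 : ℝ) * Complex.I) ∂γ

lemma norm_sqCharFun_le_one {Λ : Type*} [Fintype Λ] (γ : Measure (EuclideanSpace ℝ Λ))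
    [IsProbabilityMeasure γ] (ξ t : Λ → ℝ) : ‖sqCharFun γ ξ t‖ ≤ 1 := by
  refine (norm_integral_le_integral_norm _).trans ?_
  simp_rw [Complex.norm_exp_ofReal_mul_I]
  simp

lemma continuous_sqCharFun {Λ : Type*} [Fintype Λ] (γ : Measure (EuclideanSpace ℝ Λ))
    [IsProbabilityMeasure γ] (ξ : Λ → ℝ) : Continuous (sqCharFun γ ξ) := by
  refine continuous_of_dominated (bound := fun _ => 1) (fun t => ?_)
    (fun t => Eventually.of_forall fun y => (Complex.norm_exp_ofReal_mul_I _).le)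
    (integrable_const _) (Eventually.of_forall fun y => ?_)
  · exact Continuous.aestronglyMeasurable (by fun_prop)
  · fun_prop

variable {Λ : Type*} [Fintype Λ] [DecidableEq Λ]

/-- The linear functional of a vector field used to test its law. -/
noncomputable def fieldPairing {Λ : Type*} [Fintype Λ] {N : ℕ} (ξ : ℕ → Λ → ℝ)
    (φ : Λ → EuclideanSpace ℝ (Fin N)) : ℝ :=
  ∑ i : Fin N, ∑ x, ξ i x * φ x i

lemma continuous_fieldPairing {Λ : Type*} [Fintype Λ] {N : ℕ} (ξ : ℕ → Λ → ℝ) :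
    Continuous (fieldPairing (N := N) ξ) := by
  unfold fieldPairing
  fun_prop

lemma integrable_exp_neg_quadEnergy (N : ℕ) {B C : Matrix Λ Λ ℝ} (hC : C.PosDef)
    (hBC : B * C = 1) : Integrable fun φ : Λ → EuclideanSpace ℝ (Fin N) =>
      Real.exp (-quadEnergy B φ / 2) := by
  obtain ⟨c, hc0, hct, hc⟩ := exists_map_vectorField_eq N hC hBC
  have hcont := continuous_quadEnergy (N := N) B
  have h1 : (c • (volume : Measure (Λ → EuclideanSpace ℝ (Fin N))).withDensity
          fun φ => ENNReal.ofReal (Real.exp (-quadEnergy B φ / 2))) Set.univ = 1 := by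
    rw [← hc]
    exact (Measure.isProbabilityMeasure_map
      continuous_vectorField.measurable.aemeasurable).measure_univ
  refine ⟨Continuous.aestronglyMeasurable (by fun_prop), ?_⟩
  rw [hasFiniteIntegral_iff_ofReal (Eventually.of_forall fun φ => (Real.exp_pos _).le)]
  rw [Measure.smul_apply, withDensity_apply _ .univ, Measure.restrict_univ, smul_eq_mul] at h1
  refine lt_top_iff_ne_top.2 fun h => ?_
  rw [h, ENNReal.mul_top hc0] at h1
  simp at h1

/-- The Gaussian integral of exponentials of linear forms and of the squared norms factorizes over
the `N` components. -/
lemma exists_integral_exp_mul_eq (N : ℕ) {B C : Matrix Λ Λ ℝ} (hC : C.PosDef) (hBC : B * C = 1) :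
    ∃ c : ℝ, 0 < c ∧ ∀ (ξ : ℕ → Λ → ℝ) (t : Λ → ℝ),
      ∫ φ : Λ → EuclideanSpace ℝ (Fin N),
        Complex.exp ((∑ x, t x * ‖φ x‖ ^ 2 : ℝ) * Complex.I) *
          (Complex.exp (fieldPairing ξ φ * Complex.I) * Real.exp (-quadEnergy B φ / 2)) =
      c • ∏ i : Fin N, sqCharFun (multivariateGaussian 0 C) (ξ i) t := by
  obtain ⟨c, hc0, hct, hc⟩ := exists_map_vectorField_eq N hC hBC
  have hcp : 0 < c.toReal := ENNReal.toReal_pos hc0 hct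
  have hcont := continuous_quadEnergy (N := N) B
  refine ⟨c.toReal⁻¹, inv_pos.2 hcp, fun ξ t => ?_⟩
  have hcξ := continuous_fieldPairing (N := N) ξ
  simp only [sqCharFun]
  rw [← integral_fintype_prod_eq_prod (μ := fun _ : Fin N => multivariateGaussian 0 C)
    (f := fun (i : Fin N) (y : EuclideanSpace ℝ Λ) =>
      Complex.exp ((∑ x, ξ i x * y x + ∑ x, t x * y x ^ 2 : ℝ) * Complex.I))]
  have e : ∀ Y : Fin N → EuclideanSpace ℝ Λ,
      ∏ i : Fin N, Complex.exp ((∑ x, ξ i x * Y i x + ∑ x, t x * Y i x ^ 2 : ℝ) * Complex.I) =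
      (fun φ => Complex.exp ((∑ x, t x * ‖φ x‖ ^ 2 : ℝ) * Complex.I) *
        Complex.exp (fieldPairing ξ φ * Complex.I)) (vectorField Y) := by
    intro Y
    simp only
    rw [← Complex.exp_sum, ← Complex.exp_add, ← Finset.sum_mul, ← add_mul, ← Complex.ofReal_sum,
      ← Complex.ofReal_add]
    congr 3
    rw [Finset.sum_add_distrib, add_comm, fieldPairing]
    congr 1
    rw [Finset.sum_comm]
    refine Finset.sum_congr rfl fun x _ => ?_
    rw [EuclideanSpace.real_norm_sq_eq, Finset.mul_sum]
    rfl
  simp_rw [e]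
  rw [← integral_map (f := fun φ : Λ → EuclideanSpace ℝ (Fin N) =>
      Complex.exp ((∑ x, t x * ‖φ x‖ ^ 2 : ℝ) * Complex.I) *
        Complex.exp (fieldPairing ξ φ * Complex.I)) continuous_vectorField.measurable.aemeasurable
      (Continuous.aestronglyMeasurable (by fun_prop)), hc, integral_smul_measure,
    integral_withDensity_eq_integral_toReal_smul (by fun_prop)
      (Eventually.of_forall fun φ => ENNReal.ofReal_lt_top), smul_smul, inv_mul_cancel₀ hcp.ne',
    one_smul]
  refine integral_congr_ae (Eventually.of_forall fun φ => ?_)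
  simp only
  rw [ENNReal.toReal_ofReal (Real.exp_pos _).le, Complex.real_smul]
  ring

lemma quadEnergy_nonneg {N : ℕ} {B C : Matrix Λ Λ ℝ} (hC : C.PosDef) (hBC : B * C = 1)
    (φ : Λ → EuclideanSpace ℝ (Fin N)) : 0 ≤ quadEnergy B φ := by
  have hB : B = C⁻¹ := (Matrix.inv_eq_left_inv hBC).symm
  have hpsd : B.PosSemidef := by rw [hB]; exact hC.inv.posSemidef
  rw [quadEnergy]
  simp_rw [PiLp.inner_apply, Finset.mul_sum]
  simp_rw [Finset.sum_comm (s := (Finset.univ : Finset Λ)) (t := (Finset.univ : Finset (Fin N)))]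
  refine Finset.sum_nonneg fun i _ => ?_
  have := hpsd.dotProduct_mulVec_nonneg fun x => φ x i
  rw [star_trivial, ← sum_mul_eq_dotProduct_mulVec] at this
  refine this.trans_eq (Finset.sum_congr rfl fun x _ => Finset.sum_congr rfl fun y _ => ?_)
  simp only [RCLike.inner_apply, conj_trivial]
  ring

/-- The characteristic function of the `O(N)` spin system with quadratic energy `B`, as a ratio of
Fourier integrals of the Gaussian field with covariance `C = B⁻¹`. -/
lemma integral_exp_tilted_eq {N : ℕ} [NeZero N] {B C : Matrix Λ Λ ℝ} (hC : C.PosDef)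
    (hBC : B * C = 1)
    (ξ : ℕ → Λ → ℝ)
    (hI : ∀ η : ℕ → Λ → ℝ, η = ξ ∨ η = 0 → Integrable fun w : EuclideanSpace ℝ Λ =>
      ∏ i : Fin N, sqCharFun (multivariateGaussian 0 C) (η i) fun x => -2 * Real.pi * w x) :
    ∫ S, Complex.exp (fieldPairing ξ S * Complex.I)
      ∂(Measure.pi fun _ : Λ => unifSphere N).tilted (fun S => -quadEnergy B S / 2) =
    (∫ w : EuclideanSpace ℝ Λ, Complex.exp ((2 * Real.pi * (N * ∑ x, w x) : ℝ) * Complex.I) *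
      ∏ i : Fin N, sqCharFun (multivariateGaussian 0 C) (ξ i) fun x => -2 * Real.pi * w x) /
    (∫ w : EuclideanSpace ℝ Λ, Complex.exp ((2 * Real.pi * (N * ∑ x, w x) : ℝ) * Complex.I) *
      ∏ i : Fin N, sqCharFun (multivariateGaussian 0 C) 0 fun x => -2 * Real.pi * w x) := by
  obtain ⟨c, hc, hcξ⟩ := exists_integral_exp_mul_eq N hC hBC
  have hN : (0 : ℝ) < N := Nat.cast_pos.2 (Nat.pos_of_ne_zero (NeZero.ne N))
  set k : ℝ := radialDensity N N ^ Fintype.card Λ with hk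
  have hk0 : 0 < k := pow_pos (radialDensity_pos N hN) _
  have hcont := continuous_quadEnergy (N := N) B
  have key : ∀ η : ℕ → Λ → ℝ, η = ξ ∨ η = 0 → k • ∫ S, (Complex.exp (fieldPairing η S * Complex.I) *
      Real.exp (-quadEnergy B S / 2)) ∂(Measure.pi fun _ : Λ => unifSphere N) =
      c • ∫ w : EuclideanSpace ℝ Λ, Complex.exp ((2 * Real.pi * (N * ∑ x, w x) : ℝ) * Complex.I) *
      ∏ i : Fin N, sqCharFun (multivariateGaussian 0 C) (η i) fun x => -2 * Real.pi * w x := by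
    intro η hη
    have hcp := continuous_fieldPairing (N := N) η
    have := integral_pi_unifSphere_eq (N := N)
      (H := fun S : Λ → EuclideanSpace ℝ (Fin N) => Complex.exp (fieldPairing η S * Complex.I) *
        Real.exp (-quadEnergy B S / 2)) (by fun_prop) (b := 1) (fun φ => ?_)
      ((integrable_exp_neg_quadEnergy N hC hBC).ofReal.bdd_mul (c := 1)
        (Continuous.aestronglyMeasurable (by fun_prop))
        (Eventually.of_forall fun φ => by rw [Complex.norm_exp_ofReal_mul_I]))
      (Φ := fun w => c • ∏ i : Fin N, sqCharFun (multivariateGaussian 0 C) (η i)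
        fun x => -2 * Real.pi * w x) (fun w => ?_) ((hI η hη).smul c)
    · rw [← hk] at this
      rw [this, ← integral_smul]
      refine integral_congr_ae (Eventually.of_forall fun w => ?_)
      simp only [mul_smul_comm]
    · rw [norm_mul, Complex.norm_exp_ofReal_mul_I, one_mul, Complex.norm_real,
        Real.norm_of_nonneg (Real.exp_pos _).le, Real.exp_le_one_iff]
      have := quadEnergy_nonneg hC hBC φ
      linarith
    · rw [← hcξ]
      simp only [Finset.mul_sum, mul_assoc]
  rw [integral_tilted]
  have hZ : ((∫ S, Real.exp (-quadEnergy B S / 2) ∂(Measure.pi fun _ : Λ => unifSphere N) : ℝ) : ℂ)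
      = ∫ S, (Complex.exp (fieldPairing (0 : ℕ → Λ → ℝ) S * Complex.I) *
      Real.exp (-quadEnergy B S / 2)) ∂(Measure.pi fun _ : Λ => unifSphere N) := by
    rw [← integral_complex_ofReal]
    simp [fieldPairing]
  have hk' : (k : ℂ) ≠ 0 := by exact_mod_cast hk0.ne'
  have hc' : (c : ℂ) ≠ 0 := by exact_mod_cast hc.ne'
  have h1 := key ξ (Or.inl rfl)
  have h0 := key 0 (Or.inr rfl)
  rw [← hZ] at h0
  simp only [Complex.real_smul, Pi.zero_apply] at h0 h1
  have e1 : ∀ {a b : ℂ}, (k : ℂ) * a = c * b → a = c / k * b := by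
    intro a b h
    field_simp
    rw [mul_comm, h]
  have hd : (c / k : ℂ) ≠ 0 := div_ne_zero hc' hk'
  calc _ = (∫ S, (Complex.exp (fieldPairing ξ S * Complex.I) *
      Real.exp (-quadEnergy B S / 2)) ∂(Measure.pi fun _ : Λ => unifSphere N)) /
      ((∫ S, Real.exp (-quadEnergy B S / 2) ∂(Measure.pi fun _ : Λ => unifSphere N) : ℝ) : ℂ) := by
        rw [← integral_div]
        refine integral_congr_ae (Eventually.of_forall fun S => ?_)
        simp only [Complex.real_smul, Complex.ofReal_div]
        ring
    _ = _ := by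
        rw [e1 h1, e1 h0, mul_div_mul_left _ _ hd]

end

/-! ### Decay of the Fourier transform of the squares -/

section

open scoped MatrixOrder

/-- The joint Fourier transform of a standard normal variable and its square decays. -/
lemma norm_integral_cexp_gaussianReal_le (a b : ℝ) :
    ‖∫ g, Complex.exp ((a * g + b * g ^ 2 : ℝ) * Complex.I) ∂gaussianReal 0 1‖ ≤
      (1 + 4 * b ^ 2) ^ (-(1 / 4) : ℝ) := by
  set z : ℂ := -(1 / 2) + b * Complex.I with hz
  have hzre : z.re = -(1 / 2) := by simp [hz]
  have hzim : z.im = b := by simp [hz]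
  have hz0 : z ≠ 0 := fun h => by rw [h] at hzre; norm_num at hzre
  have hnz : ‖z‖ ^ 2 = (1 + 4 * b ^ 2) / 4 := by
    rw [Complex.sq_norm, Complex.normSq_apply, hzre, hzim]
    ring
  have hquad := integral_cexp_quadratic (b := z) (by rw [hzre]; norm_num) (a * Complex.I) 0
  rw [integral_gaussianReal_eq_integral_smul one_ne_zero]
  have e : ∀ g : ℝ, gaussianPDFReal 0 1 g • Complex.exp ((a * g + b * g ^ 2 : ℝ) * Complex.I) =
      ((√(2 * Real.pi))⁻¹ : ℝ) * Complex.exp (z * g ^ 2 + a * Complex.I * g + 0) := by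
    intro g
    rw [gaussianPDFReal, Complex.real_smul, Complex.ofReal_mul, mul_assoc, Complex.ofReal_exp,
      ← Complex.exp_add]
    congr 2
    · simp
    · rw [hz]
      push_cast
      ring
  simp_rw [e]
  rw [integral_const_mul, hquad, norm_mul, norm_mul, Complex.norm_real,
    Real.norm_of_nonneg (by positivity)]
  have h1 : ‖Complex.exp (0 - (a * Complex.I) ^ 2 / (4 * z))‖ ≤ 1 := by
    rw [Complex.norm_exp, Real.exp_le_one_iff]
    have : (0 - (a * Complex.I) ^ 2 / (4 * z) : ℂ) = ((a ^ 2 / 4 : ℝ) : ℂ) * z⁻¹ := by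
      rw [mul_pow, Complex.I_sq]
      push_cast
      field_simp
      ring
    rw [this, Complex.re_ofReal_mul, Complex.inv_re, hzre]
    have := Complex.normSq_nonneg z
    have h2 : -(1 / 2) / Complex.normSq z ≤ 0 := div_nonpos_of_nonpos_of_nonneg (by norm_num) this
    exact mul_nonpos_of_nonneg_of_nonpos (by positivity) h2
  have h2 : ‖((Real.pi : ℂ) / -z) ^ (1 / 2 : ℂ)‖ = √(Real.pi / ‖z‖) := by
    rw [show (1 / 2 : ℂ) = ((1 / 2 : ℝ) : ℂ) by push_cast; rfl, Complex.norm_cpow_real, norm_div,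
      norm_neg, Complex.norm_real, Real.norm_of_nonneg Real.pi_pos.le, Real.sqrt_eq_rpow]
  rw [h2]
  have hzp : 0 < ‖z‖ := norm_pos_iff.2 hz0
  have hzn : ‖z‖ = √(1 + 4 * b ^ 2) / 2 := by
    rw [← Real.sqrt_sq hzp.le, hnz, Real.sqrt_div (by positivity)]
    congr 1
    rw [show (4 : ℝ) = 2 ^ 2 by norm_num, Real.sqrt_sq (by norm_num)]
  have h3 : (√(2 * Real.pi))⁻¹ * √(Real.pi / ‖z‖) = (1 + 4 * b ^ 2) ^ (-(1 / 4) : ℝ) := by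
    rw [← Real.sqrt_inv, ← Real.sqrt_mul (by positivity), hzn]
    have : (2 * Real.pi)⁻¹ * (Real.pi / (√(1 + 4 * b ^ 2) / 2)) = (√(1 + 4 * b ^ 2))⁻¹ := by
      have : √(1 + 4 * b ^ 2) ≠ 0 := (Real.sqrt_pos.2 (by positivity)).ne'
      have := Real.pi_pos.ne'
      field_simp
    rw [this, ← Real.sqrt_inv, Real.sqrt_eq_rpow, Real.sqrt_eq_rpow,
      ← Real.rpow_mul (by positivity), Real.inv_rpow (by positivity),
      ← Real.rpow_neg (by positivity)]
    norm_num
  rw [← h3, ← mul_assoc]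
  exact mul_le_of_le_one_right (by positivity) h1

variable {Λ : Type*} [Fintype Λ] [DecidableEq Λ]

lemma exists_pos_posSemidef_sub {C : Matrix Λ Λ ℝ} (hC : C.PosDef) :
    ∃ c : ℝ, 0 < c ∧ (C - c • (1 : Matrix Λ Λ ℝ)).PosSemidef := by
  rcases isEmpty_or_nonempty Λ with h | h
  · refine ⟨1, one_pos, ?_⟩
    rw [Subsingleton.elim (C - (1 : ℝ) • (1 : Matrix Λ Λ ℝ)) 0]
    exact Matrix.PosSemidef.zero
  · obtain ⟨r, hr, hrC⟩ := (CFC.exists_pos_algebraMap_le_iff (a := C) hC.isHermitian).2 (by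
      intro x hx
      rw [hC.isHermitian.spectrum_real_eq_range_eigenvalues] at hx
      obtain ⟨i, rfl⟩ := hx
      exact hC.eigenvalues_pos i)
    refine ⟨r, hr, ?_⟩
    rw [Matrix.le_iff, Algebra.algebraMap_eq_smul_one] at hrC
    exact hrC

/-- A Gaussian vector with nondegenerate covariance contains an independent white noise; given the
rest, its squares have a Fourier transform that decays in every direction. -/
lemma exists_norm_sqCharFun_le {C : Matrix Λ Λ ℝ} (hC : C.PosDef) :
    ∃ c : ℝ, 0 < c ∧ ∀ t : Λ → ℝ, ‖sqCharFun (multivariateGaussian 0 C) 0 t‖ ≤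
      ∏ x, (1 + c * t x ^ 2) ^ (-(1 / 4) : ℝ) := by
  obtain ⟨c, hc, hpsd⟩ := exists_pos_posSemidef_sub hC
  set μ := multivariateGaussian 0 (C - c • (1 : Matrix Λ Λ ℝ)) with hμ
  set T : (Λ → ℝ) → EuclideanSpace ℝ Λ := fun v => √c • WithLp.toLp 2 v with hT
  have hTm : Measurable T := by fun_prop
  set π := Measure.pi fun _ : Λ => gaussianReal 0 1 with hπ
  have hconv : multivariateGaussian 0 C = μ ∗ (π.map T) := by
    have : IsProbabilityMeasure (π.map T) := Measure.isProbabilityMeasure_map hTm.aemeasurable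
    refine Measure.ext_of_charFun ?_
    funext s
    have e : π.map T = (stdGaussian (EuclideanSpace ℝ Λ)).map (√c • ·) := by
      rw [← map_pi_eq_stdGaussian, Measure.map_map (by fun_prop) (by fun_prop)]
      rfl
    rw [charFun_conv, e, charFun_map_smul, charFun_stdGaussian, hμ,
      charFun_multivariateGaussian hpsd, charFun_multivariateGaussian hC.posSemidef,
      ← Complex.exp_add]
    congr 1
    have hn : ‖√c • s‖ ^ 2 = c * ∑ x, s x ^ 2 := by
      rw [norm_smul, mul_pow, Real.norm_of_nonneg (Real.sqrt_nonneg _), Real.sq_sqrt hc.le,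
        EuclideanSpace.real_norm_sq_eq]
    rw [← Complex.ofReal_pow, hn, Matrix.sub_mulVec, dotProduct_sub, Matrix.smul_mulVec,
      Matrix.one_mulVec, dotProduct_smul]
    simp only [dotProduct, inner_zero_right, smul_eq_mul, sq]
    push_cast
    ring
  have hpT : IsProbabilityMeasure (π.map T) := Measure.isProbabilityMeasure_map hTm.aemeasurable
  refine ⟨4 * c ^ 2, by positivity, fun t => ?_⟩
  rw [sqCharFun, hconv, integral_conv (Integrable.of_bound (C := 1)
    (Continuous.aestronglyMeasurable (by fun_prop))
    (Eventually.of_forall fun y => (Complex.norm_exp_ofReal_mul_I _).le))]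
  refine (norm_integral_le_of_norm_le_const (μ := μ)
    (C := ∏ x, (1 + 4 * c ^ 2 * t x ^ 2) ^ (-(1 / 4) : ℝ))
    (Eventually.of_forall fun η => ?_)).trans_eq (by simp)
  rw [integral_map hTm.aemeasurable (Continuous.aestronglyMeasurable (by fun_prop))]
  have e : ∀ v : Λ → ℝ, Complex.exp ((∑ x, (0 : Λ → ℝ) x * (η + T v) x +
      ∑ x, t x * (η + T v) x ^ 2 : ℝ) * Complex.I) =
      Complex.exp ((∑ x, t x * η x ^ 2 : ℝ) * Complex.I) *
        ∏ x, Complex.exp (((2 * t x * η x * √c) * v x + (t x * c) * v x ^ 2 : ℝ) * Complex.I) := by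
    intro v
    rw [← Complex.exp_sum, ← Complex.exp_add, ← Finset.sum_mul, ← add_mul, ← Complex.ofReal_sum,
      ← Complex.ofReal_add, ← Finset.sum_add_distrib, ← Finset.sum_add_distrib]
    congr 3
    refine Finset.sum_congr rfl fun x _ => ?_
    simp only [hT, PiLp.add_apply, PiLp.smul_apply, smul_eq_mul, Pi.zero_apply]
    have := Real.sq_sqrt hc.le
    linear_combination (t x * v x ^ 2) * this
  simp_rw [e]
  rw [integral_const_mul, norm_mul, Complex.norm_exp_ofReal_mul_I, one_mul,
    integral_fintype_prod_eq_prod (μ := fun _ : Λ => gaussianReal 0 1)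
    (f := fun x (g : ℝ) => Complex.exp (((2 * t x * η x * √c) * g + (t x * c) * g ^ 2 : ℝ) *
      Complex.I)), norm_prod]
  refine Finset.prod_le_prod (fun x _ => norm_nonneg _) fun x _ => ?_
  refine (norm_integral_cexp_gaussianReal_le _ _).trans_eq ?_
  ring_nf

lemma integrable_prod_inv_one_add_sq (Λ : Type*) [Fintype Λ] {c : ℝ} (hc : 0 < c) :
    Integrable fun s : EuclideanSpace ℝ Λ => ∏ x, (1 + c * s x ^ 2)⁻¹ := by
  have h1 : Integrable fun u : ℝ => (1 + c * u ^ 2)⁻¹ := by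
    have := integrable_inv_one_add_sq.comp_mul_left' (Real.sqrt_pos.2 hc).ne'
    refine this.congr (Eventually.of_forall fun u => ?_)
    simp only [mul_pow, Real.sq_sqrt hc.le]
  have h2 : Integrable fun s : Λ → ℝ => ∏ x, (1 + c * s x ^ 2)⁻¹ :=
    Integrable.fintype_prod fun _ => h1
  exact (PiLp.volume_preserving_ofLp Λ).integrable_comp_of_integrable h2

/-- Uniform integrable bound for the rescaled Fourier transforms of the sum of `N - M` independent
copies of the squares. -/
lemma exists_norm_sqCharFun_pow_le {C : Matrix Λ Λ ℝ} (hC : C.PosDef) :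
    ∃ c : ℝ, 0 < c ∧ ∀ (M N : ℕ) (s : Λ → ℝ), 2 * M ≤ N → 8 ≤ N →
      ‖sqCharFun (multivariateGaussian 0 C) 0 fun x => s x / √N‖ ^ (N - M) ≤
        ∏ x, (1 + c * s x ^ 2)⁻¹ := by
  obtain ⟨c, hc, hb⟩ := exists_norm_sqCharFun_le hC
  refine ⟨c / 8, by positivity, fun M N s hM hN => ?_⟩
  have hN8 : (8 : ℝ) ≤ N := by exact_mod_cast hN
  have hM2 : (2 : ℝ) * M ≤ N := by exact_mod_cast hM
  refine (pow_le_pow_left₀ (norm_nonneg _) (hb _) _).trans ?_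
  rw [← Finset.prod_pow]
  refine Finset.prod_le_prod (fun x _ => by positivity) fun x _ => ?_
  rw [div_pow, Real.sq_sqrt (by positivity), ← Real.rpow_natCast, ← Real.rpow_mul (by positivity),
    Nat.cast_sub (by omega), neg_mul, Real.rpow_neg (by positivity)]
  refine inv_anti₀ (by positivity) ?_
  -- the exponent `(N - M) / 4` is at least `N / 8 ≥ 1`, so Bernoulli's inequality applies
  set y := c * (s x ^ 2 / N) with hy
  have hy0 : 0 ≤ y := by positivity
  calc 1 + c / 8 * s x ^ 2 = 1 + (N / 8) * y := by
        rw [hy]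
        field_simp
    _ ≤ (1 + y) ^ ((N : ℝ) / 8) :=
        one_add_mul_self_le_rpow_one_add (by linarith) (by linarith)
    _ ≤ _ := Real.rpow_le_rpow_of_exponent_le (by linarith) (by linarith)

end

/-! ### The limit of many components -/

section

variable {Λ : Type*} [Fintype Λ] [DecidableEq Λ]

/-- Central limit theorem for the squares of a Gaussian field of unit variance. -/
lemma exists_tendsto_sqCharFun_pow {C : Matrix Λ Λ ℝ} (hC : C.PosDef) (hdiag : ∀ x, C x x = 1)
    (s : Λ → ℝ) : ∃ v : ℝ, Tendsto (fun N : ℕ =>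
      (Complex.exp ((-(∑ x, s x) / √N : ℝ) * Complex.I) *
        sqCharFun (multivariateGaussian 0 C) 0 fun x => s x / √N) ^ N) atTop
      (𝓝 (Real.exp v : ℂ)) := by
  set γ := multivariateGaussian 0 C with hγ
  set Y : EuclideanSpace ℝ Λ → ℝ := fun y => ∑ x, s x * (y x ^ 2 - 1) with hY
  have hYc : Continuous Y := by fun_prop
  have hmem : ∀ x, MemLp (fun y : EuclideanSpace ℝ Λ => y x) 4 γ := fun x =>
    (EuclideanSpace.proj (𝕜 := ℝ) x : EuclideanSpace ℝ Λ →L[ℝ] ℝ).comp_memLp'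
      (IsGaussian.memLp_id γ 4 (by norm_num))
  have hsq : ∀ x, MemLp (fun y : EuclideanSpace ℝ Λ => y x ^ 2) 2 γ := by
    intro x
    have : ENNReal.HolderTriple 4 4 2 := ⟨by
      rw [← two_mul, show (4 : ℝ≥0∞) = 2 * 2 by norm_num,
        ENNReal.mul_inv (Or.inl (by norm_num)) (Or.inl (by norm_num)), ← mul_assoc,
        ENNReal.mul_inv_cancel (by norm_num) (by norm_num), one_mul]⟩
    exact ((hmem x).mul (hmem x)).ae_eq (Eventually.of_forall fun y => (sq _).symm)
  have hEsq : ∀ x, ∫ y, y x ^ 2 ∂γ = 1 := by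
    intro x
    have hv := variance_eval_multivariateGaussian (μ := 0) hC.posSemidef x
    have hm : ∫ y, y x ∂γ = 0 := by
      have := (EuclideanSpace.proj (𝕜 := ℝ) x : EuclideanSpace ℝ Λ →L[ℝ] ℝ).integral_comp_comm
        (IsGaussian.integrable_id (μ := γ))
      simpa [hγ] using this
    rw [← hγ, variance_of_integral_eq_zero (by fun_prop) hm, hdiag] at hv
    exact hv
  have hYmem : MemLp Y 2 γ := memLp_finsetSum _ fun x _ =>
    ((hsq x).sub (memLp_const 1)).const_mul (s x)
  have hYint : ∫ y, Y y ∂γ = 0 := by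
    have hi : ∀ x, Integrable (fun y : EuclideanSpace ℝ Λ => y x ^ 2) γ := fun x =>
      (hsq x).integrable (by norm_num)
    simp only [hY]
    have hi' : ∀ x, Integrable (fun y : EuclideanSpace ℝ Λ => s x * (y x ^ 2 - 1)) γ := fun x =>
      ((hi x).sub (integrable_const (1 : ℝ))).const_mul (s x)
    rw [integral_finsetSum _ fun x _ => hi' x]
    refine Finset.sum_eq_zero fun x _ => ?_
    rw [integral_const_mul, integral_sub (hi x) (integrable_const 1), hEsq]
    simp
  have hchar : ∀ N : ℕ, Complex.exp ((-(∑ x, s x) / √N : ℝ) * Complex.I) *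
        sqCharFun γ 0 (fun x => s x / √N) = charFun (γ.map Y) (√N)⁻¹ := by
    intro N
    rw [charFun_apply_real, integral_map (by fun_prop)
      (Continuous.aestronglyMeasurable (by fun_prop)), sqCharFun, ← integral_const_mul]
    refine integral_congr_ae (Eventually.of_forall fun y => ?_)
    simp only
    rw [← Complex.exp_add, ← add_mul, ← Complex.ofReal_add, ← Complex.ofReal_mul]
    congr 3
    simp only [Pi.zero_apply, zero_mul, Finset.sum_const_zero, zero_add, hY, Finset.mul_sum,
      mul_sub, Finset.sum_sub_distrib]
    have : -(∑ x, s x) / √(N : ℝ) = - ∑ x, (√(N : ℝ))⁻¹ * (s x * 1) := by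
      rw [← Finset.mul_sum, neg_div, div_eq_inv_mul]
      simp
    rw [this, neg_add_eq_sub]
    congr 1
    exact Finset.sum_congr rfl fun x _ => by ring
  simp_rw [hchar]
  set v := ∫ y, Y y ^ 2 ∂γ with hv
  have hv0 : 0 ≤ v := integral_nonneg fun y => sq_nonneg _
  refine ⟨-v / 2, ?_⟩
  rcases hv0.eq_or_lt with h0 | hpos
  · have hae : Y =ᵐ[γ] fun _ => 0 := by
      have := (integral_eq_zero_iff_of_nonneg (fun y => sq_nonneg (Y y))
        hYmem.integrable_sq).1 h0.symm
      filter_upwards [this] with y hy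
      exact pow_eq_zero_iff two_ne_zero |>.1 hy
    rw [Measure.map_congr hae, ← h0]
    simp [charFun_dirac]
  · set X : EuclideanSpace ℝ Λ → ℝ := fun y => (√v)⁻¹ * Y y with hX
    have hs0 : √v ≠ 0 := (Real.sqrt_pos.2 hpos).ne'
    have hclt := tendsto_charFun_inv_sqrt_mul_pow (P := γ) (X := X) (by fun_prop)
      (by rw [hX, integral_const_mul, hYint, mul_zero])
      (by
        simp only [hX, Pi.pow_apply, mul_pow]
        rw [integral_const_mul, ← hv, inv_pow, Real.sq_sqrt hv0, inv_mul_cancel₀ hpos.ne']) (√v)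
    have e : ∀ r : ℝ, charFun (γ.map X) (r * √v) = charFun (γ.map Y) r := by
      intro r
      have : γ.map X = (γ.map Y).map ((√v)⁻¹ * ·) := by
        rw [Measure.map_map (by fun_prop) (by fun_prop)]
        rfl
      rw [this, charFun_map_mul]
      congr 1
      field_simp
    simp_rw [e] at hclt
    convert hclt using 2
    rw [← Complex.ofReal_pow, Real.sq_sqrt hv0]
    push_cast
    rfl

/-- As `N → ∞`, any finite number of components of the `O(N)` spin system with quadratic energy
`C⁻¹` become independent Gaussian fields with covariance `C`, if `C` has unit diagonal. In the ratio
of Fourier integrals, substitute `s = -2 π √N w`: by the central limit theorem the factors of the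
`N - M` untested components and the phase tend to the same Gaussian weight in the numerator and in
the denominator, while the `M` tested factors tend to the characteristic function of the field. -/
theorem tendsto_integral_exp_tilted {B C : Matrix Λ Λ ℝ} (hC : C.PosDef) (hBC : B * C = 1)
    (hdiag : ∀ x, C x x = 1) {M : ℕ} {ξ : ℕ → Λ → ℝ} (hξ : ∀ i, M ≤ i → ξ i = 0) :
    Tendsto (fun N : ℕ => ∫ S : Λ → EuclideanSpace ℝ (Fin N),
        Complex.exp (fieldPairing ξ S * Complex.I)
          ∂(Measure.pi fun _ : Λ => unifSphere N).tilted (fun S => -quadEnergy B S / 2)) atTop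
      (𝓝 (∏ i ∈ Finset.range M, charFun (multivariateGaussian 0 C) (WithLp.toLp 2 (ξ i)))) := by
  set γ := multivariateGaussian 0 C with hγ
  obtain ⟨c, hc, hdom⟩ := exists_norm_sqCharFun_pow_le hC
  choose v hv using exists_tendsto_sqCharFun_pow hC hdiag
  set D : EuclideanSpace ℝ Λ → ℝ := fun s => ∏ x, (1 + c * s x ^ 2)⁻¹ with hD
  have hDint : Integrable D := integrable_prod_inv_one_add_sq Λ hc
  -- the rescaled integrand
  set F : (ℕ → Λ → ℝ) → ℕ → EuclideanSpace ℝ Λ → ℂ := fun η N s =>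
    ∏ i : Fin N, sqCharFun γ (η i) fun x => s x / √N with hF
  set E : ℕ → EuclideanSpace ℝ Λ → ℂ := fun N s =>
    Complex.exp ((-(√N * ∑ x, s x) : ℝ) * Complex.I) with hE
  have hsplit : ∀ η : ℕ → Λ → ℝ, (∀ i, M ≤ i → η i = 0) → ∀ N, M ≤ N → ∀ s,
      F η N s = (∏ i ∈ Finset.range M, sqCharFun γ (η i) fun x => s x / √N) *
        (sqCharFun γ 0 fun x => s x / √N) ^ (N - M) := by
    intro η hη N hN s
    simp only [hF]
    rw [Finset.prod_range (fun i => sqCharFun γ (η i) fun x => s x / √N) |>.symm,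
      ← Finset.prod_range_mul_prod_Ico _ hN]
    congr 1
    rw [Finset.prod_congr rfl fun i hi => by rw [hη i (Finset.mem_Ico.1 hi).1], Finset.prod_const,
      Nat.card_Ico]
  have hbound : ∀ η : ℕ → Λ → ℝ, (∀ i, M ≤ i → η i = 0) → ∀ N, 2 * M ≤ N → 8 ≤ N → ∀ s,
      ‖F η N s‖ ≤ D s := by
    intro η hη N hN hN8 s
    rw [hsplit η hη N (by omega) s, norm_mul, norm_pow, norm_prod]
    refine (mul_le_of_le_one_left (by positivity) ?_).trans (hdom M N s hN hN8)
    exact Finset.prod_le_one (fun _ _ => norm_nonneg _) fun i _ => norm_sqCharFun_le_one γ _ _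
  have hFcont : ∀ η N, Continuous (F η N) := by
    intro η N
    refine continuous_finsetProd _ fun i _ => (continuous_sqCharFun γ _).comp ?_
    fun_prop
  have hEcont : ∀ N, Continuous (E N) := by
    intro N
    fun_prop
  have hEnorm : ∀ N s, ‖E N s‖ = 1 := fun N s => Complex.norm_exp_ofReal_mul_I _
  have hFint : ∀ η : ℕ → Λ → ℝ, (∀ i, M ≤ i → η i = 0) → ∀ N, 2 * M ≤ N → 8 ≤ N →
      Integrable (F η N) := fun η hη N hN hN8 =>
    hDint.mono' (hFcont η N).aestronglyMeasurable (Eventually.of_forall (hbound η hη N hN hN8))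
  have hpt : ∀ η : ℕ → Λ → ℝ, (∀ i, M ≤ i → η i = 0) → ∀ s,
      Tendsto (fun N => E N s * F η N s) atTop
        (𝓝 ((∏ i ∈ Finset.range M, sqCharFun γ (η i) 0) * (Real.exp (v s) : ℂ))) := by
    intro η hη s
    have hz : Tendsto (fun N : ℕ => fun x => s x / √(N : ℝ)) atTop (𝓝 (0 : Λ → ℝ)) := by
      rw [tendsto_pi_nhds]
      intro x
      exact Tendsto.const_div_atTop
        (Real.tendsto_sqrt_atTop.comp tendsto_natCast_atTop_atTop) _
    have hψ : ∀ ζ : Λ → ℝ, Tendsto (fun N : ℕ => sqCharFun γ ζ fun x => s x / √(N : ℝ)) atTop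
        (𝓝 (sqCharFun γ ζ 0)) := fun ζ => ((continuous_sqCharFun γ ζ).tendsto 0).comp hz
    set a : ℕ → ℂ := fun N => Complex.exp ((-(∑ x, s x) / √N : ℝ) * Complex.I) *
      sqCharFun γ 0 fun x => s x / √N with ha
    have ha1 : Tendsto a atTop (𝓝 1) := by
      have h1 : Tendsto (fun N : ℕ => Complex.exp ((-(∑ x, s x) / √N : ℝ) * Complex.I)) atTop
          (𝓝 (Complex.exp ((0 : ℝ) * Complex.I))) := by
        have : Continuous fun r : ℝ => Complex.exp (r * Complex.I) := by fun_prop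
        exact (this.tendsto 0).comp (Tendsto.const_div_atTop
          (Real.tendsto_sqrt_atTop.comp tendsto_natCast_atTop_atTop) _)
      have h2 := h1.mul (hψ 0)
      have h3 : sqCharFun γ 0 0 = 1 := by simp [sqCharFun]
      rw [h3] at h2
      rw [Complex.ofReal_zero, zero_mul, Complex.exp_zero, one_mul] at h2
      exact h2
    have haM : Tendsto (fun N => a N ^ (N - M)) atTop (𝓝 (Real.exp (v s) : ℂ)) := by
      have h1 := (hv s).div (ha1.pow M) (by simp)
      rw [one_pow, div_one] at h1
      refine h1.congr' ?_
      filter_upwards [ha1.eventually_ne one_ne_zero, eventually_ge_atTop M] with N hN hNM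
      change a N ^ N / a N ^ M = a N ^ (N - M)
      rw [div_eq_iff (pow_ne_zero _ hN), ← pow_add, Nat.sub_add_cancel hNM]
    -- the phases of the first `M` factors tend to `1`
    have hphase : Tendsto (fun N : ℕ =>
        Complex.exp ((-(∑ x, s x) / √N : ℝ) * Complex.I) ^ M) atTop (𝓝 1) := by
      have : Continuous fun r : ℝ => Complex.exp (r * Complex.I) ^ M := by fun_prop
      have h := (this.tendsto 0).comp (Tendsto.const_div_atTop
          (Real.tendsto_sqrt_atTop.comp tendsto_natCast_atTop_atTop) (-(∑ x, s x)))
      rw [Complex.ofReal_zero, zero_mul, Complex.exp_zero, one_pow] at h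
      exact h
    have h := (hphase.mul (tendsto_finsetProd (Finset.range M) fun i _ => hψ (η i))).mul haM
    rw [one_mul] at h
    refine h.congr' ?_
    filter_upwards [eventually_ge_atTop M, eventually_ge_atTop 1] with N hN hN1
    rw [hsplit η hη N hN s]
    have hN0 : √(N : ℝ) ≠ 0 := by positivity
    have hEe : E N s = Complex.exp ((-(∑ x, s x) / √N : ℝ) * Complex.I) ^ N := by
      simp only [hE]
      rw [← Complex.exp_nat_mul, ← mul_assoc]
      congr 2
      rw [← Complex.ofReal_natCast, ← Complex.ofReal_mul]
      congr 1
      rw [mul_div_assoc']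
      nth_rewrite 2 [← Real.mul_self_sqrt (Nat.cast_nonneg N)]
      field_simp
    rw [hEe]
    have hNM : Complex.exp ((-(∑ x, s x) / √N : ℝ) * Complex.I) ^ N =
        Complex.exp ((-(∑ x, s x) / √N : ℝ) * Complex.I) ^ M *
          Complex.exp ((-(∑ x, s x) / √N : ℝ) * Complex.I) ^ (N - M) := by
      rw [← pow_add, Nat.add_sub_cancel' hN]
    rw [hNM]
    simp only [ha, mul_pow]
    ring
  have hlim : ∀ η : ℕ → Λ → ℝ, (∀ i, M ≤ i → η i = 0) →
      Tendsto (fun N => ∫ s, E N s * F η N s) atTop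
        (𝓝 ((∏ i ∈ Finset.range M, sqCharFun γ (η i) 0) *
          ((∫ s : EuclideanSpace ℝ Λ, Real.exp (v s) : ℝ) : ℂ))) := by
    intro η hη
    rw [← integral_complex_ofReal, ← integral_const_mul]
    refine tendsto_integral_filter_of_dominated_convergence D
      (Eventually.of_forall fun N => ((hEcont N).mul (hFcont η N)).aestronglyMeasurable) ?_ hDint
      (Eventually.of_forall fun s => hpt η hη s)
    · filter_upwards [eventually_ge_atTop (2 * M), eventually_ge_atTop 8] with N hN hN8
      refine Eventually.of_forall fun s => ?_
      rw [norm_mul, hEnorm, one_mul]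
      exact hbound η hη N hN hN8 s
  -- undoing the rescaling
  have hscale : ∀ η : ℕ → Λ → ℝ, ∀ N : ℕ, 1 ≤ N →
      ∫ s, E N s * F η N s = |((-2 * Real.pi * √N) ^ Module.finrank ℝ (EuclideanSpace ℝ Λ))| •
        ∫ w : EuclideanSpace ℝ Λ, Complex.exp ((2 * Real.pi * (N * ∑ x, w x) : ℝ) * Complex.I) *
          ∏ i : Fin N, sqCharFun γ (η i) fun x => -2 * Real.pi * w x := by
    intro η N hN
    have hN0 : √(N : ℝ) ≠ 0 := by positivity
    have hR : (-2 * Real.pi * √N) ≠ 0 := mul_ne_zero (by simp [Real.pi_ne_zero]) hN0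
    have := Measure.integral_comp_smul (volume : Measure (EuclideanSpace ℝ Λ))
      (fun s => E N s * F η N s) (-2 * Real.pi * √N)
    rw [abs_inv, eq_inv_smul_iff₀ (by positivity)] at this
    rw [← this]
    congr 1
    refine integral_congr_ae (Eventually.of_forall fun w => ?_)
    simp only [hE, hF, PiLp.smul_apply, smul_eq_mul]
    congr 1
    · congr 3
      rw [← Finset.mul_sum]
      have := Real.mul_self_sqrt (Nat.cast_nonneg (α := ℝ) N)
      linear_combination (2 * Real.pi * ∑ x, w x) * this
    · refine Finset.prod_congr rfl fun i _ => ?_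
      congr 1
      funext x
      field_simp
  have hFscale : ∀ η : ℕ → Λ → ℝ, ∀ N : ℕ, 1 ≤ N → Integrable (F η N) →
      Integrable fun w : EuclideanSpace ℝ Λ =>
        ∏ i : Fin N, sqCharFun γ (η i) fun x => -2 * Real.pi * w x := by
    intro η N hN hi
    have hN0 : √(N : ℝ) ≠ 0 := by positivity
    have hR : (-2 * Real.pi * √N) ≠ 0 := mul_ne_zero (by simp [Real.pi_ne_zero]) hN0
    refine (hi.comp_smul hR).congr (Eventually.of_forall fun w => ?_)
    simp only [hF, PiLp.smul_apply, smul_eq_mul]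
    refine Finset.prod_congr rfl fun i _ => ?_
    congr 1
    funext x
    field_simp
  have hzero : ∀ i, M ≤ i → (0 : ℕ → Λ → ℝ) i = 0 := fun _ _ => rfl
  have hψ0 : ∀ ζ : Λ → ℝ, sqCharFun γ ζ 0 = charFun γ (WithLp.toLp 2 ζ) := by
    intro ζ
    rw [charFun_apply, sqCharFun]
    refine integral_congr_ae (Eventually.of_forall fun y => ?_)
    simp only [Pi.zero_apply, zero_mul, Finset.sum_const_zero, add_zero, PiLp.inner_apply,
      RCLike.inner_apply, conj_trivial]
  have hv0 : ((∫ s : EuclideanSpace ℝ Λ, Real.exp (v s) : ℝ) : ℂ) ≠ 0 := by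
    have hlim0 : ∀ s, Tendsto (fun N => E N s * F 0 N s) atTop (𝓝 (Real.exp (v s) : ℂ)) := by
      intro s
      have := hpt 0 hzero s
      simpa [sqCharFun] using this
    have hi : Integrable fun s : EuclideanSpace ℝ Λ => (Real.exp (v s) : ℂ) := by
      refine hDint.mono' (aestronglyMeasurable_of_tendsto_ae atTop
        (fun N => ((hEcont N).mul (hFcont 0 N)).aestronglyMeasurable)
        (Eventually.of_forall hlim0)) (Eventually.of_forall fun s => ?_)
      refine le_of_tendsto (hlim0 s).norm ?_
      filter_upwards [eventually_ge_atTop (2 * M), eventually_ge_atTop 8] with N hN hN8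
      rw [norm_mul, hEnorm, one_mul]
      exact hbound 0 hzero N hN hN8 s
    have hi' : Integrable fun s : EuclideanSpace ℝ Λ => Real.exp (v s) := hi.re
    exact_mod_cast (integral_exp_pos hi').ne'
  have hratio := (hlim ξ hξ).div (hlim 0 hzero) (by
    refine mul_ne_zero ?_ hv0
    simp [hψ0])
  have hone : ∏ i ∈ Finset.range M, sqCharFun γ ((0 : ℕ → Λ → ℝ) i) 0 = 1 := by
    simp [sqCharFun]
  rw [hone, one_mul, mul_div_cancel_right₀ _ hv0] at hratio
  simp_rw [hψ0] at hratio
  refine hratio.congr' ?_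
  filter_upwards [eventually_ge_atTop (2 * M), eventually_ge_atTop 8] with N hN hN8
  have : NeZero N := ⟨by omega⟩
  have hN0 : √(N : ℝ) ≠ 0 := by
    have : (0 : ℝ) < N := by exact_mod_cast (by omega : 0 < N)
    positivity
  rw [integral_exp_tilted_eq hC hBC ξ (by
    rintro η (rfl | rfl)
    · exact hFscale _ N (by omega) (hFint _ hξ N hN hN8)
    · exact hFscale _ N (by omega) (hFint _ hzero N hN hN8)), Pi.div_apply,
    hscale _ N (by omega), hscale _ N (by omega), Complex.real_smul, Complex.real_smul,
    mul_div_mul_left]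
  · rfl
  · rw [Ne, Complex.ofReal_eq_zero, abs_eq_zero]
    exact pow_ne_zero _ (mul_ne_zero (by simp [Real.pi_ne_zero]) hN0)

end

/-! ### The spin model on a fixed torus -/

/-- For a translation-invariant symmetric matrix `A`, some shift `l - A` is positive definite with
an inverse of unit diagonal. -/
lemma exists_posDef_unit_diag {Λ : Type*} [Fintype Λ] [DecidableEq Λ] [AddGroup Λ]
    {A : Matrix Λ Λ ℝ} (hA : A.IsHermitian) (hinv : ∀ x y z, A (x + z) (y + z) = A x y) :
    ∃ (l : ℝ) (C : Matrix Λ Λ ℝ), C.PosDef ∧ (l • (1 : Matrix Λ Λ ℝ) - A) * C = 1 ∧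
      (∀ x y z, C (x + z) (y + z) = C x y) ∧ ∀ x, C x x = 1 := by
  set U : Matrix Λ Λ ℝ := (hA.eigenvectorUnitary : Matrix Λ Λ ℝ) with hU
  have hUU : U * star U = 1 := Unitary.coe_mul_star_self _
  have hUU' : star U * U = 1 := Unitary.coe_star_mul_self _
  have hUu : IsUnit U := ⟨⟨U, star U, hUU, hUU'⟩, rfl⟩
  set a := hA.eigenvalues with ha
  have hspec : A = U * Matrix.diagonal a * star U := by
    have := hA.spectral_theorem
    rwa [Unitary.conjStarAlgAut_apply] at this
  set m : ℝ := (Fintype.card Λ : ℝ) with hm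
  have hm1 : 1 ≤ m := by
    have : 1 ≤ Fintype.card Λ := Fintype.card_pos
    rw [hm]
    exact_mod_cast this
  have hm0 : 0 < m := by linarith
  obtain ⟨j, -, hj⟩ := Finset.exists_max_image Finset.univ a Finset.univ_nonempty
  have hj' : ∀ i, a i ≤ a j := fun i => hj i (Finset.mem_univ i)
  -- the trace of `(l - A)⁻¹` crosses `m` between these two values of `l`
  obtain ⟨l, hl, hfl⟩ : ∃ l ∈ Set.Icc (a j + 1 / m) (a j + 1), ∑ i, (l - a i)⁻¹ = m := by
    have hmle : a j + 1 / m ≤ a j + 1 := by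
      have : 1 / m ≤ 1 := by rw [div_le_one hm0]; exact hm1
      linarith
    have hpos : ∀ l ∈ Set.Icc (a j + 1 / m) (a j + 1), ∀ i, 0 < l - a i := by
      intro l hl i
      have : 0 < 1 / m := by positivity
      linarith [hl.1, hj' i]
    have hcont : ContinuousOn (fun l => ∑ i, (l - a i)⁻¹) (Set.Icc (a j + 1 / m) (a j + 1)) :=
      continuousOn_finsetSum _ fun i _ => ContinuousOn.inv₀ (by fun_prop)
        fun l hl => (hpos l hl i).ne'
    refine intermediate_value_Icc' hmle hcont ⟨?_, ?_⟩
    · calc ∑ i, (a j + 1 - a i)⁻¹ ≤ ∑ _i : Λ, (1 : ℝ) := by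
            refine Finset.sum_le_sum fun i _ => inv_le_one_of_one_le₀ ?_
            linarith [hj' i]
        _ = m := by simp [hm]
    · calc m = (a j + 1 / m - a j)⁻¹ := by rw [add_sub_cancel_left, one_div, inv_inv]
        _ ≤ _ := Finset.single_le_sum (f := fun i => (a j + 1 / m - a i)⁻¹)
            (fun i _ => (inv_pos.2 (hpos _ ⟨le_rfl, hmle⟩ i)).le) (Finset.mem_univ j)
  have hpos : ∀ i, 0 < l - a i := by
    intro i
    have : 0 < 1 / m := by positivity
    linarith [hl.1, hj' i]
  set C := U * Matrix.diagonal (fun i => (l - a i)⁻¹) * star U with hC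
  have hCpd : C.PosDef := (Matrix.IsUnit.posDef_star_right_conjugate_iff hUu).2
    (Matrix.posDef_diagonal_iff.2 fun i => inv_pos.2 (hpos i))
  have hB : l • (1 : Matrix Λ Λ ℝ) - A = U * Matrix.diagonal (fun i => l - a i) * star U := by
    have h1 : Matrix.diagonal (fun i => l - a i) = l • (1 : Matrix Λ Λ ℝ) - Matrix.diagonal a := by
      rw [← Matrix.diagonal_one, ← Matrix.diagonal_smul, Matrix.diagonal_sub]
      congr 1
      funext i
      simp
    rw [h1, mul_sub, sub_mul, ← hspec, mul_smul_comm, mul_one, smul_mul_assoc, hUU]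
  have hBC : (l • (1 : Matrix Λ Λ ℝ) - A) * C = 1 := by
    rw [hB, hC]
    calc _ = U * Matrix.diagonal (fun i => l - a i) * (star U * U) *
          Matrix.diagonal (fun i => (l - a i)⁻¹) * star U := by simp only [mul_assoc]
      _ = U * (Matrix.diagonal (fun i => l - a i) *
          Matrix.diagonal (fun i => (l - a i)⁻¹)) * star U := by
            rw [hUU', mul_one]
            simp only [mul_assoc]
      _ = 1 := by
          rw [Matrix.diagonal_mul_diagonal]
          simp_rw [mul_inv_cancel₀ (hpos _).ne']
          rw [Matrix.diagonal_one, mul_one, hUU]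
  have hCinv : ∀ x y z, C (x + z) (y + z) = C x y := by
    intro x y z
    set e : Λ ≃ Λ := Equiv.addRight z
    have h1 : (l • (1 : Matrix Λ Λ ℝ) - A).submatrix e e = l • (1 : Matrix Λ Λ ℝ) - A := by
      ext x y
      simp [e, hinv, Matrix.one_apply]
    have h2 : (l • (1 : Matrix Λ Λ ℝ) - A) * C.submatrix e e = 1 := by
      nth_rewrite 1 [← h1]
      rw [Matrix.submatrix_mul_equiv, hBC, Matrix.submatrix_one_equiv]
    have h3 : C.submatrix e e = C := by
      have h4 := mul_eq_one_comm.1 hBC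
      calc C.submatrix e e = C * ((l • (1 : Matrix Λ Λ ℝ) - A) * C.submatrix e e) := by
            rw [← mul_assoc, h4, one_mul]
        _ = C := by rw [h2, mul_one]
    exact congrFun (congrFun h3 x) y
  refine ⟨l, C, hCpd, hBC, hCinv, fun x => ?_⟩
  have htr : C.trace = m := by
    rw [hC, Matrix.trace_mul_comm, ← mul_assoc, hUU', one_mul, Matrix.trace_diagonal, hfl]
  have hall : ∀ y, C y y = C x x := by
    intro y
    have := hCinv x x (-x + y)
    rwa [add_neg_cancel_left] at this
  rw [Matrix.trace] at htr
  simp only [Matrix.diag_apply, hall, Finset.sum_const, Finset.card_univ, nsmul_eq_mul] at htr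
  exact mul_left_cancel₀ hm0.ne' (htr.trans (mul_one m).symm)

open Classical in
/-- The adjacency matrix of the discrete torus. -/
noncomputable def torusAdj (d n : ℕ) : Matrix (Torus d n) (Torus d n) ℝ :=
  Matrix.of fun x y => if (latticeGraph d (ZMod n)).Adj x y then 1 else 0

lemma torusAdj_isHermitian (d n : ℕ) : (torusAdj d n).IsHermitian := by
  classical
  ext x y
  simp only [torusAdj, Matrix.conjTranspose_apply, Matrix.of_apply, star_trivial]
  exact if_congr ((latticeGraph d (ZMod n)).adj_comm y x) rfl rfl

lemma latticeGraph_adj_add {d : ℕ} {R : Type} [CommRing R] (x y z : Fin d → R) :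
    (latticeGraph d R).Adj (x + z) (y + z) ↔ (latticeGraph d R).Adj x y := by
  simp only [latticeGraph, ne_eq, add_left_inj, add_right_comm _ z]

lemma torusAdj_add (d n : ℕ) (x y z : Torus d n) :
    torusAdj d n (x + z) (y + z) = torusAdj d n x y := by
  classical
  simp only [torusAdj, Matrix.of_apply]
  exact if_congr (latticeGraph_adj_add x y z) rfl rfl

/-- On the spheres the diagonal of the quadratic form is constant, so the energy can be shifted. -/
lemma energy_eq (d n N : ℕ) [NeZero n] (β l : ℝ) {S : Torus d n → EuclideanSpace ℝ (Fin N)}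
    (hS : ∀ x, ‖S x‖ = √(N : ℝ)) :
    energy d n N β S = -quadEnergy (l • (1 : Matrix (Torus d n) (Torus d n) ℝ) - β • torusAdj d n) S
      / 2 + l * Fintype.card (Torus d n) * N / 2 := by
  have h1 : quadEnergy (l • (1 : Matrix (Torus d n) (Torus d n) ℝ) - β • torusAdj d n) S =
      l * Fintype.card (Torus d n) * N - 2 * energy d n N β S := by
    have e1 : ∑ x, ∑ y, (l • (1 : Matrix (Torus d n) (Torus d n) ℝ)) x y * inner ℝ (S x) (S y) =
        l * Fintype.card (Torus d n) * N := by
      simp only [Matrix.smul_apply, Matrix.one_apply, smul_eq_mul, mul_ite, mul_one, mul_zero,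
        ite_mul, zero_mul, Finset.sum_ite_eq, Finset.mem_univ, if_true, real_inner_self_eq_norm_sq,
        hS, Real.sq_sqrt (Nat.cast_nonneg N), Finset.sum_const, Finset.card_univ, nsmul_eq_mul]
      ring
    rw [quadEnergy, ← e1, energy, Finset.mul_sum, Finset.mul_sum, ← Finset.sum_sub_distrib]
    refine Finset.sum_congr rfl fun x _ => ?_
    rw [Finset.mul_sum, Finset.mul_sum, ← Finset.sum_sub_distrib]
    refine Finset.sum_congr rfl fun y _ => ?_
    simp only [torusAdj, Matrix.sub_apply, Matrix.smul_apply, Matrix.of_apply, smul_eq_mul]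
    split_ifs <;> ring
  rw [h1]
  ring

lemma spinMeasure_eq_tilted (d n N : ℕ) [NeZero n] [NeZero N] (β l : ℝ) :
    spinMeasure d n N β = (Measure.pi fun _ : Torus d n => unifSphere N).tilted fun S =>
      -quadEnergy (l • (1 : Matrix (Torus d n) (Torus d n) ℝ) - β • torusAdj d n) S / 2 := by
  set k : ℝ := l * Fintype.card (Torus d n) * N / 2 with hk
  set f : (Torus d n → EuclideanSpace ℝ (Fin N)) → ℝ := fun S =>
    -quadEnergy (l • (1 : Matrix (Torus d n) (Torus d n) ℝ) - β • torusAdj d n) S / 2 with hf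
  have h1 : energy d n N β =ᵐ[Measure.pi fun _ : Torus d n => unifSphere N] fun S => f S + k := by
    filter_upwards [ae_norm_pi_unifSphere N] with S hS
    exact energy_eq d n N β l hS
  rw [spinMeasure, tilted_congr h1, Measure.tilted, Measure.tilted]
  congr 1
  funext S
  simp_rw [Real.exp_add]
  rw [integral_mul_const, mul_div_mul_right _ _ (Real.exp_pos _).ne']

/-- The law on `U × {1, …, M}` of `M` independent Gaussian fields on the torus with covariance
`C`. -/
noncomputable def torusGaussianLaw (d n M : ℕ) [NeZero n] (U : Finset (Fin d → ℤ))
    (C : Matrix (Torus d n) (Torus d n) ℝ) : ProbabilityMeasure (U → Fin M → ℝ) :=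
  ⟨(Measure.pi fun _ : Fin M => multivariateGaussian 0 C).map
    (fun φ x i => φ i (toTorus n (x : Fin d → ℤ))),
    Measure.isProbabilityMeasure_map (Measurable.aemeasurable (by fun_prop))⟩

/-- The test function on the torus obtained from a test function on `U`. -/
noncomputable def pushTest {d : ℕ} (n : ℕ) {U : Finset (Fin d → ℤ)} {M : ℕ}
    (ζ : Fin M → U → ℝ) (i : ℕ) (z : Torus d n) : ℝ :=
  if h : i < M then ∑ x : U, if toTorus n (x : Fin d → ℤ) = z then ζ ⟨i, h⟩ x else 0 else 0

lemma sum_pushTest_mul {d n : ℕ} [NeZero n] {U : Finset (Fin d → ℤ)} {M : ℕ} (ζ : Fin M → U → ℝ)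
    (i : Fin M) (f : Torus d n → ℝ) :
    ∑ z, pushTest n ζ i z * f z = ∑ x : U, ζ i x * f (toTorus n x) := by
  simp only [pushTest, i.2, dif_pos, Finset.sum_mul, ite_mul, zero_mul]
  rw [Finset.sum_comm]
  simp

lemma fieldPairing_pushTest {d n N M : ℕ} [NeZero n] (hMN : M ≤ N) {U : Finset (Fin d → ℤ)}
    (ζ : Fin M → U → ℝ) (S : Torus d n → EuclideanSpace ℝ (Fin N)) :
    fieldPairing (pushTest n ζ) S = ∑ i, ∑ x, ζ i x * firstCoords n N M U S x i := by
  obtain ⟨K, rfl⟩ := Nat.exists_eq_add_of_le hMN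
  rw [fieldPairing, Fin.sum_univ_add]
  have h0 : ∀ i : Fin K, ∑ z, pushTest n ζ (Fin.natAdd M i : Fin (M + K)) z *
      S z (Fin.natAdd M i) = 0 := by
    intro i
    refine Finset.sum_eq_zero fun z _ => ?_
    simp [pushTest]
  simp_rw [h0]
  rw [Finset.sum_const_zero, add_zero]
  refine Finset.sum_congr rfl fun i _ => ?_
  rw [Fin.val_castAdd, sum_pushTest_mul ζ i fun z => S z (Fin.castAdd K i)]
  refine Finset.sum_congr rfl fun x _ => ?_
  have : (i : ℕ) < M + K := by omega
  simp only [firstCoords, this, dif_pos]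
  rfl

lemma integral_exp_torusGaussianLaw {d n M : ℕ} [NeZero n] {U : Finset (Fin d → ℤ)}
    (C : Matrix (Torus d n) (Torus d n) ℝ) (ζ : Fin M → U → ℝ) :
    ∫ s, Complex.exp ((∑ i, ∑ x, ζ i x * s x i : ℝ) * Complex.I)
      ∂(torusGaussianLaw d n M U C : Measure (U → Fin M → ℝ)) =
    ∏ i ∈ Finset.range M,
      charFun (multivariateGaussian 0 C) (WithLp.toLp 2 (pushTest n ζ i)) := by
  change ∫ s, _ ∂((Measure.pi fun _ : Fin M => multivariateGaussian 0 C).map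
    (fun φ (x : U) i => φ i (toTorus n (x : Fin d → ℤ)))) = _
  rw [integral_map (Measurable.aemeasurable (by fun_prop))
    (Continuous.aestronglyMeasurable (by fun_prop)), Finset.prod_range]
  simp only [charFun_apply]
  rw [← integral_fintype_prod_eq_prod (μ := fun _ : Fin M => multivariateGaussian 0 C)
    (f := fun (i : Fin M) (y : EuclideanSpace ℝ (Torus d n)) =>
      Complex.exp (inner ℝ y (WithLp.toLp 2 (pushTest n ζ i)) * Complex.I))]
  refine integral_congr_ae (Eventually.of_forall fun φ => ?_)
  simp only
  rw [← Complex.exp_sum, ← Finset.sum_mul, ← Complex.ofReal_sum]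
  congr 3
  refine Finset.sum_congr rfl fun i _ => ?_
  rw [PiLp.inner_apply, ← sum_pushTest_mul]
  simp only [RCLike.inner_apply, conj_trivial]

/-- The limit `N → ∞` of the spin `O(N)` model on a fixed torus. -/
theorem tendsto_spinLaw (d : ℕ) {β : ℝ} (n : ℕ+) (M : ℕ) (U : Finset (Fin d → ℤ))
    {l : ℝ} {C : Matrix (Torus d n) (Torus d n) ℝ} (hC : C.PosDef)
    (hBC : (l • (1 : Matrix (Torus d n) (Torus d n) ℝ) - β • torusAdj d n) * C = 1)
    (hdiag : ∀ x, C x x = 1) :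
    Tendsto (fun N => spinLaw d β M U n N) atTop (𝓝 (torusGaussianLaw d n M U C)) := by
  refine tendsto_array_of_tendsto_charFun fun ζ => ?_
  rw [integral_exp_torusGaussianLaw]
  have h := tendsto_integral_exp_tilted hC hBC hdiag (M := M) (ξ := pushTest n ζ)
    (fun i hi => by
      funext z
      simp [pushTest, not_lt.2 hi])
  refine (h.comp tendsto_PNat_val_atTop_atTop).congr' ?_
  filter_upwards [tendsto_PNat_val_atTop_atTop.eventually_ge_atTop M] with N hN
  change _ = ∫ s, _ ∂((spinMeasure d n N β).map (firstCoords n N M U))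
  rw [integral_map (measurable_firstCoords _ _ _ _).aemeasurable
    (Continuous.aestronglyMeasurable (by fun_prop)), spinMeasure_eq_tilted d n N β l]
  simp only [Function.comp_apply, fieldPairing_pushTest hN]

/-! ### Random walks on the torus and on the lattice -/

lemma toTorus_add {d : ℕ} (n : ℕ) (x y : Fin d → ℤ) :
    toTorus n (x + y) = toTorus n x + toTorus n y := by
  funext i
  simp [toTorus]

lemma toTorus_neg {d : ℕ} (n : ℕ) (x : Fin d → ℤ) : toTorus n (-x) = -toTorus n x := by
  funext i
  simp [toTorus]

lemma toTorus_zero {d : ℕ} (n : ℕ) : toTorus n (0 : Fin d → ℤ) = 0 := by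
  funext i
  simp [toTorus]

lemma toTorus_single {d : ℕ} (n : ℕ) (i : Fin d) :
    toTorus n (Pi.single i 1) = Pi.single i 1 := by
  funext j
  rcases eq_or_ne j i with rfl | h
  · simp [toTorus]
  · simp [toTorus, h]

lemma single_one_injective {d n : ℕ} (hn : 3 ≤ n) {i j : Fin d}
    (h : (Pi.single i 1 : Torus d n) = Pi.single j 1) : i = j := by
  have : Fact (1 < n) := ⟨by omega⟩
  by_contra hij
  have := congrFun h i
  rw [Pi.single_eq_same, Pi.single_eq_of_ne hij] at this
  exact one_ne_zero this

lemma single_one_ne_neg {d n : ℕ} (hn : 3 ≤ n) (i j : Fin d) :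
    (Pi.single i 1 : Torus d n) ≠ -Pi.single j 1 := by
  have : Fact (1 < n) := ⟨by omega⟩
  intro h
  have h1 := congrFun h i
  rcases eq_or_ne i j with rfl | hij
  · rw [Pi.neg_apply, Pi.single_eq_same, eq_neg_iff_add_eq_zero] at h1
    have h2 : ((2 : ℕ) : ZMod n) = 0 := by
      push_cast
      rw [← h1]
      norm_num
    rw [ZMod.natCast_eq_zero_iff] at h2
    exact absurd (Nat.le_of_dvd two_pos h2) (by omega)
  · rw [Pi.neg_apply, Pi.single_eq_same, Pi.single_eq_of_ne hij, neg_zero] at h1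
    exact one_ne_zero h1

/-- For `n ≥ 3` the `2 d` neighbours `x ± e i` in the torus are distinct. -/
lemma torusAdj_apply {d n : ℕ} (hn : 3 ≤ n) (x y : Torus d n) :
    torusAdj d n x y = ∑ i : Fin d, ((if y = x + Pi.single i 1 then 1 else 0) +
      (if y = x - Pi.single i 1 then 1 else 0)) := by
  have : Fact (1 < n) := ⟨by omega⟩
  have hne : ∀ i : Fin d, (Pi.single i 1 : Torus d n) ≠ 0 := by
    intro i h
    have := congrFun h i
    rw [Pi.single_eq_same] at this
    exact one_ne_zero this
  by_cases h : (latticeGraph d (ZMod n)).Adj x y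
  · rw [torusAdj, Matrix.of_apply, if_pos h]
    obtain ⟨-, j, hj | hj⟩ := h
    · subst hj
      rw [Finset.sum_eq_single j]
      · rw [if_pos rfl, if_neg, add_zero]
        rw [sub_eq_add_neg, add_right_inj]
        exact single_one_ne_neg hn j j
      · intro i _ hij
        rw [if_neg, if_neg, add_zero]
        · rw [sub_eq_add_neg, add_right_inj]
          exact single_one_ne_neg hn j i
        · rw [add_right_inj]
          exact fun h => hij (single_one_injective hn h).symm
      · simp
    · have hy : y = x - Pi.single j 1 := by rw [hj]; abel
      subst hy
      rw [Finset.sum_eq_single j]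
      · rw [if_pos rfl, if_neg, zero_add]
        rw [sub_eq_add_neg, add_right_inj]
        exact (single_one_ne_neg hn j j).symm
      · intro i _ hij
        rw [if_neg, if_neg, add_zero]
        · rw [sub_right_inj]
          exact fun h => hij (single_one_injective hn h).symm
        · rw [sub_eq_add_neg, add_right_inj]
          exact (single_one_ne_neg hn i j).symm
      · simp
  · rw [torusAdj, Matrix.of_apply, if_neg h, eq_comm]
    refine Finset.sum_eq_zero fun i _ => ?_
    rw [if_neg, if_neg, add_zero]
    · intro hy
      refine h ⟨?_, i, Or.inr (by rw [hy]; abel)⟩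
      rw [hy]
      intro hx
      exact hne i (by simpa using hx.symm)
    · intro hy
      refine h ⟨?_, i, Or.inl hy⟩
      rw [hy]
      intro hx
      exact hne i (by simpa using hx.symm)

lemma sum_torusAdj_mul {d n : ℕ} [NeZero n] (hn : 3 ≤ n) (x : Torus d n) (f : Torus d n → ℝ) :
    ∑ y, torusAdj d n x y * f y =
      ∑ i : Fin d, (f (x + Pi.single i 1) + f (x - Pi.single i 1)) := by
  simp_rw [torusAdj_apply hn, Finset.sum_mul]
  rw [Finset.sum_comm]
  refine Finset.sum_congr rfl fun i _ => ?_
  simp [add_mul, Finset.sum_add_distrib]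

lemma torusAdj_nonneg (d n : ℕ) (x y : Torus d n) : 0 ≤ torusAdj d n x y := by
  rw [torusAdj, Matrix.of_apply]
  split_ifs <;> norm_num

lemma torusAdj_pow_nonneg (d n : ℕ) [NeZero n] (k : ℕ) (x y : Torus d n) :
    0 ≤ (torusAdj d n ^ k) x y := by
  induction k generalizing x y with
  | zero =>
    rw [pow_zero, Matrix.one_apply]
    split_ifs <;> norm_num
  | succ k ih =>
    rw [pow_succ, Matrix.mul_apply]
    exact Finset.sum_nonneg fun z _ => mul_nonneg (ih _ _) (torusAdj_nonneg _ _ _ _)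

lemma sum_torusAdj_pow {d n : ℕ} [NeZero n] (hn : 3 ≤ n) (k : ℕ) (x : Torus d n) :
    ∑ y, (torusAdj d n ^ k) x y = (2 * d : ℝ) ^ k := by
  induction k generalizing x with
  | zero => simp [Matrix.one_apply]
  | succ k ih =>
    simp_rw [pow_succ', Matrix.mul_apply]
    rw [Finset.sum_comm]
    simp_rw [← Finset.mul_sum, ih]
    rw [sum_torusAdj_mul hn x fun _ => (2 * d : ℝ) ^ k]
    simp only [Finset.sum_const, Finset.card_univ, Fintype.card_fin, nsmul_eq_mul]
    ring

lemma torusAdj_pow_le {d n : ℕ} [NeZero n] (hn : 3 ≤ n) (k : ℕ) (x y : Torus d n) :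
    (torusAdj d n ^ k) x y ≤ (2 * d : ℝ) ^ k := by
  rw [← sum_torusAdj_pow hn k x]
  exact Finset.single_le_sum (f := fun y => (torusAdj d n ^ k) x y)
    (fun z _ => torusAdj_pow_nonneg d n k x z) (Finset.mem_univ y)

/-- Walks that are too short to wind around the torus do not see the difference with the lattice. -/
lemma torusAdj_pow_eq {d n : ℕ} [NeZero n] (hd : d ≠ 0) (hn : 3 ≤ n) (k : ℕ) (x y : Fin d → ℤ)
    (h : ∀ i, |x i - y i| + k < n) :
    (torusAdj d n ^ k) (toTorus n x) (toTorus n y) = (2 * d : ℝ) ^ k * walkProb d k x y := by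
  induction k generalizing x with
  | zero =>
    rw [pow_zero, pow_zero, one_mul, walkProb, Matrix.one_apply]
    refine if_congr ⟨fun hxy => ?_, fun hxy => by rw [hxy]⟩ rfl rfl
    funext i
    have h1 := congrFun hxy i
    simp only [toTorus] at h1
    rw [eq_comm, ZMod.intCast_eq_intCast_iff_dvd_sub] at h1
    have h2 := h i
    rw [Nat.cast_zero, add_zero] at h2
    have := Int.eq_zero_of_abs_lt_dvd h1 h2
    omega
  | succ k ih =>
    rw [pow_succ', Matrix.mul_apply, sum_torusAdj_mul hn _
      fun z => (torusAdj d n ^ k) z (toTorus n y), walkProb]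
    have hstep : ∀ (e : Fin d → ℤ), (∀ i, |e i| ≤ 1) →
        (torusAdj d n ^ k) (toTorus n (x + e)) (toTorus n y) =
          (2 * d : ℝ) ^ k * walkProb d k (x + e) y := by
      intro e he
      refine ih (x + e) fun i => ?_
      have h1 := h i
      have h2 : |(x + e) i - y i| ≤ |x i - y i| + |e i| := by
        rw [Pi.add_apply, add_sub_right_comm]
        exact abs_add_le _ _
      have h3 := he i
      push_cast at h1
      omega
    have hs : ∀ i j : Fin d, |(Pi.single i 1 : Fin d → ℤ) j| ≤ 1 := by
      intro i j
      rcases eq_or_ne j i with rfl | hij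
      · simp
      · simp [hij]
    have h1 : ∀ i : Fin d, (torusAdj d n ^ k) (toTorus n x + Pi.single i 1) (toTorus n y) =
        (2 * d : ℝ) ^ k * walkProb d k (x + Pi.single i 1) y := by
      intro i
      rw [← hstep _ (hs i), toTorus_add, toTorus_single]
    have h2 : ∀ i : Fin d, (torusAdj d n ^ k) (toTorus n x - Pi.single i 1) (toTorus n y) =
        (2 * d : ℝ) ^ k * walkProb d k (x - Pi.single i 1) y := by
      intro i
      have := hstep (-Pi.single i 1) fun j => by rw [Pi.neg_apply, abs_neg]; exact hs i j
      rw [toTorus_add, toTorus_neg, toTorus_single, ← sub_eq_add_neg, ← sub_eq_add_neg] at this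
      exact this
    simp_rw [h1, h2, ← mul_add, ← Finset.mul_sum]
    have : (d : ℝ) ≠ 0 := Nat.cast_ne_zero.2 hd
    rw [pow_succ]
    field_simp

lemma eventually_torusAdj_pow_eq {d : ℕ} (hd : d ≠ 0) (k : ℕ) (x y : Fin d → ℤ) :
    ∀ᶠ n : ℕ+ in atTop, (torusAdj d n ^ k) (toTorus n x) (toTorus n y) =
      (2 * d : ℝ) ^ k * walkProb d k x y := by
  have h3 := tendsto_PNat_val_atTop_atTop.eventually_ge_atTop 3
  have hi := eventually_all.2 fun i : Fin d =>
    tendsto_PNat_val_atTop_atTop.eventually_gt_atTop (|x i - y i|.toNat + k)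
  filter_upwards [h3, hi] with n hn h
  refine torusAdj_pow_eq hd hn k x y fun i => ?_
  have h1 := h i
  have h2 : ((|x i - y i|.toNat : ℕ) : ℤ) = |x i - y i| := Int.toNat_of_nonneg (abs_nonneg _)
  omega

lemma walkProb_nonneg (d k : ℕ) (x y : Fin d → ℤ) : 0 ≤ walkProb d k x y := by
  induction k generalizing x with
  | zero =>
    rw [walkProb]
    split_ifs <;> norm_num
  | succ k ih =>
    rw [walkProb]
    exact mul_nonneg (by positivity) (Finset.sum_nonneg fun i _ => add_nonneg (ih _) (ih _))

lemma walkProb_le_one {d : ℕ} (hd : d ≠ 0) (k : ℕ) (x y : Fin d → ℤ) : walkProb d k x y ≤ 1 := by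
  induction k generalizing x with
  | zero =>
    rw [walkProb]
    split_ifs <;> norm_num
  | succ k ih =>
    rw [walkProb]
    have hd' : (0 : ℝ) < d := Nat.cast_pos.2 (Nat.pos_of_ne_zero hd)
    calc _ ≤ 1 / (2 * (d : ℝ)) * ∑ _i : Fin d, (1 + 1 : ℝ) := by
          gcongr
          · exact ih _
          · exact ih _
      _ = 1 := by
          simp only [Finset.sum_const, Finset.card_univ, Fintype.card_fin, nsmul_eq_mul]
          field_simp
          norm_num

lemma walkProb_add (d k : ℕ) (x y z : Fin d → ℤ) :
    walkProb d k (x + z) (y + z) = walkProb d k x y := by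
  induction k generalizing x with
  | zero => simp [walkProb]
  | succ k ih =>
    rw [walkProb, walkProb]
    congr 1
    refine Finset.sum_congr rfl fun i _ => ?_
    rw [add_right_comm, ih, add_sub_right_comm, ih]

lemma green_add (d : ℕ) (m2 : ℝ) (x y z : Fin d → ℤ) :
    green d m2 (x + z) (y + z) = green d m2 x y := by
  simp only [green, walkProb_add]

lemma green_eq_green_zero (d : ℕ) (m2 : ℝ) (x y : Fin d → ℤ) :
    green d m2 x y = green d m2 0 (y - x) := by
  have := green_add d m2 0 (y - x) x
  rwa [zero_add, sub_add_cancel] at this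

/-- The terms of the random walk expansion of the Green's function `(2 d + m2 - A)⁻¹`. -/
noncomputable def greenTerm (d : ℕ) (m2 : ℝ) (x y : Fin d → ℤ) (k : ℕ) : ℝ :=
  (2 * d : ℝ) ^ k * walkProb d k x y / (2 * d + m2) ^ (k + 1)

lemma greenTerm_nonneg {d : ℕ} {m2 : ℝ} (hm : 0 ≤ m2) (x y : Fin d → ℤ) (k : ℕ) :
    0 ≤ greenTerm d m2 x y k := by
  have := walkProb_nonneg d k x y
  unfold greenTerm
  positivity

lemma green_eq_tsum {d : ℕ} (hd : d ≠ 0) {m2 : ℝ} (hm : 0 ≤ m2) (x y : Fin d → ℤ) :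
    green d m2 x y = ∑' k, ENNReal.ofReal (greenTerm d m2 x y k) := by
  have hd' : (0 : ℝ) < d := Nat.cast_pos.2 (Nat.pos_of_ne_zero hd)
  unfold green greenTerm
  refine tsum_congr fun k => ?_
  congr 1
  have h1 : 1 - m2 / (2 * d + m2) = 2 * d / (2 * d + m2) := by
    field_simp
    ring
  rw [h1, div_pow, pow_succ]
  field_simp

lemma green_eq_ofReal_tsum {d : ℕ} (hd : d ≠ 0) {m2 : ℝ} (hm : 0 ≤ m2) {x y : Fin d → ℤ}
    (hs : Summable (greenTerm d m2 x y)) :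
    green d m2 x y = ENNReal.ofReal (∑' k, greenTerm d m2 x y k) := by
  rw [green_eq_tsum hd hm, ENNReal.ofReal_tsum_of_nonneg (greenTerm_nonneg hm x y) hs]

lemma toReal_green {d : ℕ} (hd : d ≠ 0) {m2 : ℝ} (hm : 0 ≤ m2) (x y : Fin d → ℤ) :
    (green d m2 x y).toReal = ∑' k, greenTerm d m2 x y k := by
  rw [green_eq_tsum hd hm, ENNReal.tsum_toReal_eq fun _ => ENNReal.ofReal_ne_top]
  exact tsum_congr fun k => ENNReal.toReal_ofReal (greenTerm_nonneg hm x y k)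

lemma summable_greenTerm_of_ne_top {d : ℕ} (hd : d ≠ 0) {m2 : ℝ} (hm : 0 ≤ m2) {x y : Fin d → ℤ}
    (h : green d m2 x y ≠ ∞) : Summable (greenTerm d m2 x y) := by
  rw [green_eq_tsum hd hm] at h
  have := ENNReal.summable_toReal h
  exact this.congr fun k => ENNReal.toReal_ofReal (greenTerm_nonneg hm x y k)

/-- The geometric bound on the terms of the massive Green's function. -/
lemma summable_geometric_bound {d : ℕ} {m2 : ℝ} (hm : 0 < m2) :
    Summable fun k : ℕ => (2 * d : ℝ) ^ k / (2 * d + m2) ^ (k + 1) := by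
  have h : Summable fun k : ℕ => (2 * d / (2 * d + m2) : ℝ) ^ k * (2 * d + m2)⁻¹ := by
    refine (summable_geometric_of_lt_one (by positivity) ?_).mul_right _
    rw [div_lt_one (by positivity)]
    linarith
  refine h.congr fun k => ?_
  rw [div_pow, pow_succ]
  field_simp

lemma tsum_geometric_bound {d : ℕ} {m2 : ℝ} (hm : 0 < m2) :
    ∑' k : ℕ, (2 * d : ℝ) ^ k / (2 * d + m2) ^ (k + 1) = 1 / m2 := by
  have hr : (2 * d / (2 * d + m2) : ℝ) < 1 := by
    rw [div_lt_one (by positivity)]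
    linarith
  have h : ∀ k : ℕ, (2 * d : ℝ) ^ k / (2 * d + m2) ^ (k + 1) =
      (2 * d / (2 * d + m2) : ℝ) ^ k * (2 * d + m2)⁻¹ := by
    intro k
    rw [div_pow, pow_succ]
    field_simp
  simp_rw [h]
  rw [tsum_mul_right, tsum_geometric_of_lt_one (by positivity) hr]
  have : (2 * d + m2 : ℝ) ≠ 0 := by positivity
  have h2 : 1 - 2 * d / (2 * d + m2) = m2 / (2 * d + m2) := by
    field_simp
    ring
  rw [h2]
  field_simp

lemma greenTerm_le {d : ℕ} (hd : d ≠ 0) {m2 : ℝ} (hm : 0 ≤ m2) (x y : Fin d → ℤ) (k : ℕ) :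
    greenTerm d m2 x y k ≤ (2 * d : ℝ) ^ k / (2 * d + m2) ^ (k + 1) := by
  unfold greenTerm
  have := walkProb_le_one hd k x y
  have hd' : (0 : ℝ) < d := Nat.cast_pos.2 (Nat.pos_of_ne_zero hd)
  gcongr
  exact mul_le_of_le_one_right (by positivity) this

lemma summable_greenTerm {d : ℕ} (hd : d ≠ 0) {m2 : ℝ} (hm : 0 < m2) (x y : Fin d → ℤ) :
    Summable (greenTerm d m2 x y) :=
  Summable.of_nonneg_of_le (greenTerm_nonneg hm.le x y) (greenTerm_le hd hm.le x y)
    (summable_geometric_bound hm)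

/-! ### The Green's matrix of the torus -/

/-- `G` is the Green's matrix `(2 d + m - A)⁻¹` of the torus with squared mass `m`, the matrix `A`
being the adjacency matrix. -/
structure IsTorusGreen (d n : ℕ) [NeZero n] (m : ℝ) (G : Matrix (Torus d n) (Torus d n) ℝ) :
    Prop where
  posDef : G.PosDef
  mul_eq_one : ((2 * d + m) • (1 : Matrix (Torus d n) (Torus d n) ℝ) - torusAdj d n) * G = 1
  add_right : ∀ x y z, G (x + z) (y + z) = G x y

lemma torusAdj_comm (d n : ℕ) (x y : Torus d n) : torusAdj d n x y = torusAdj d n y x := by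
  have := (torusAdj_isHermitian d n).apply x y
  rwa [star_trivial, eq_comm] at this

lemma torusAdj_pow_add (d n : ℕ) [NeZero n] (k : ℕ) (x y z : Torus d n) :
    (torusAdj d n ^ k) (x + z) (y + z) = (torusAdj d n ^ k) x y := by
  induction k generalizing x y with
  | zero => simp [Matrix.one_apply]
  | succ k ih =>
    rw [pow_succ, Matrix.mul_apply, Matrix.mul_apply, ← Equiv.sum_comp (Equiv.addRight z)]
    simp only [Equiv.coe_addRight, ih, torusAdj_add]

/-- The variogram of a translation-invariant positive semidefinite matrix is nonnegative. -/
lemma apply_zero_le_of_posSemidef {Λ : Type*} [AddGroup Λ] {H : Matrix Λ Λ ℝ}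
    (hH : H.PosSemidef) (hinv : ∀ x y z, H (x + z) (y + z) = H x y) (x : Λ) : H 0 x ≤ H 0 0 := by
  have h1 := hinv 0 0 x
  have h2 := hH.isHermitian.apply x 0
  have h3 := (hH.submatrix ![0, x]).dotProduct_mulVec_nonneg ![1, -1]
  rw [zero_add] at h1
  rw [star_trivial] at h2
  simp [dotProduct, Matrix.mulVec, Fin.sum_univ_two] at h3
  linarith

/-- The variogram of a translation-invariant positive semidefinite matrix is the square of a
distance, hence satisfies the triangle inequality up to a factor `2`. -/
lemma variogram_add_le {Λ : Type*} [AddCommGroup Λ] {H : Matrix Λ Λ ℝ}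
    (hH : H.PosSemidef) (hinv : ∀ x y z, H (x + z) (y + z) = H x y) (x y : Λ) :
    H 0 0 - H 0 (x + y) ≤ 2 * (H 0 0 - H 0 x) + 2 * (H 0 0 - H 0 y) := by
  have h1 := hinv 0 0 x
  have h2 := hinv 0 0 (x + y)
  have h3 := hinv 0 y x
  have h4 := hH.isHermitian.apply x 0
  have h5 := hH.isHermitian.apply (x + y) 0
  have h6 := hH.isHermitian.apply (x + y) x
  -- the square distance between `x` and the midpoint of `0` and `x + y` is nonnegative
  have h7 := (hH.submatrix ![0, x, x + y]).dotProduct_mulVec_nonneg ![1, -2, 1]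
  rw [zero_add] at h1 h2 h3
  rw [add_comm y x] at h3
  rw [star_trivial] at h4 h5 h6
  simp [dotProduct, Matrix.mulVec, Fin.sum_univ_three] at h7
  linarith

namespace IsTorusGreen

variable {d n : ℕ} [NeZero n] {m : ℝ} {G : Matrix (Torus d n) (Torus d n) ℝ}

/-- The mass is positive, since the constant function is an eigenvector of `2 d + m - A` for the
eigenvalue `m`. -/
lemma mass_pos (h : IsTorusGreen d n m G) (hn : 3 ≤ n) : 0 < m := by
  have h1 : ∀ z, ∑ x, ((2 * d + m) • (1 : Matrix (Torus d n) (Torus d n) ℝ) - torusAdj d n) x z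
      = m := by
    intro z
    simp only [Matrix.sub_apply, Matrix.smul_apply, Matrix.one_apply, smul_eq_mul, mul_ite,
      mul_one, mul_zero, Finset.sum_sub_distrib, Finset.sum_ite_eq', Finset.mem_univ, if_true]
    simp_rw [torusAdj_comm d n _ z]
    have := sum_torusAdj_pow hn 1 z
    rw [pow_one, pow_one] at this
    linarith
  have h2 : (Fintype.card (Torus d n) : ℝ) = m * ∑ z, ∑ y, G z y := by
    calc (Fintype.card (Torus d n) : ℝ)
        = ∑ y, ∑ x, (1 : Matrix (Torus d n) (Torus d n) ℝ) x y := by simp [Matrix.one_apply]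
      _ = ∑ y, ∑ z, m * G z y := by
          rw [← h.mul_eq_one]
          refine Finset.sum_congr rfl fun y _ => ?_
          simp_rw [Matrix.mul_apply]
          rw [Finset.sum_comm]
          simp_rw [← Finset.sum_mul, h1]
      _ = m * ∑ z, ∑ y, G z y := by
          rw [Finset.sum_comm]
          simp_rw [← Finset.mul_sum]
  have h3 : 0 < ∑ z, ∑ y, G z y := by
    have := h.posDef.dotProduct_mulVec_pos (x := fun _ => 1)
      (fun h => one_ne_zero (congrFun h (0 : Torus d n)))
    simpa [dotProduct, Matrix.mulVec] using this
  have h4 : (0 : ℝ) < Fintype.card (Torus d n) := Nat.cast_pos.2 Fintype.card_pos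
  rw [h2] at h4
  exact (pos_iff_pos_of_mul_pos h4).2 h3

lemma adj_mul (h : IsTorusGreen d n m G) : torusAdj d n * G = (2 * d + m) • G - 1 := by
  have := h.mul_eq_one
  rw [sub_mul, smul_mul_assoc, one_mul] at this
  rw [← this]
  abel

lemma commute (h : IsTorusGreen d n m G) : Commute (torusAdj d n) G := by
  have := mul_eq_one_comm.1 h.mul_eq_one
  rw [mul_sub, mul_smul_comm, mul_one] at this
  rw [Commute, SemiconjBy, h.adj_mul, ← this]
  abel

/-- The random walk expansion of the Green's matrix, with remainder. -/
lemma eq_sum_add (h : IsTorusGreen d n m G) (hm : 0 < m) (K : ℕ) :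
    G = ∑ k ∈ Finset.range K, ((2 * d + m) ^ (k + 1))⁻¹ • torusAdj d n ^ k +
      ((2 * d + m) ^ K)⁻¹ • (torusAdj d n ^ K * G) := by
  have h0 : (2 * d + m : ℝ) ≠ 0 := by positivity
  induction K with
  | zero => simp
  | succ K ih =>
    rw [Finset.sum_range_succ, pow_succ (torusAdj d n), mul_assoc, h.adj_mul, mul_sub, mul_one,
      smul_sub, mul_smul_comm, smul_smul]
    have h1 : ((2 * d + m) ^ (K + 1))⁻¹ * (2 * d + m) = (((2 * d + m) ^ K)⁻¹ : ℝ) := by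
      rw [pow_succ]
      field_simp
    rw [h1, add_assoc, add_sub_cancel]
    exact ih

lemma apply_eq (h : IsTorusGreen d n m G) (hm : 0 < m) (K : ℕ) (x y : Torus d n) :
    G x y = ∑ k ∈ Finset.range K, (torusAdj d n ^ k) x y / (2 * d + m) ^ (k + 1) +
      (torusAdj d n ^ K * G) x y / (2 * d + m) ^ K := by
  conv_lhs => rw [h.eq_sum_add hm K]
  simp only [Matrix.add_apply, Matrix.sum_apply, Matrix.smul_apply, smul_eq_mul]
  rw [inv_mul_eq_div]
  congr 1
  exact Finset.sum_congr rfl fun k _ => by rw [inv_mul_eq_div]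

lemma hasSum (h : IsTorusGreen d n m G) (hn : 3 ≤ n) (x y : Torus d n) :
    HasSum (fun k => (torusAdj d n ^ k) x y / (2 * d + m) ^ (k + 1)) (G x y) := by
  have hm := h.mass_pos hn
  rw [hasSum_iff_tendsto_nat_of_nonneg fun k =>
    div_nonneg (torusAdj_pow_nonneg d n k x y) (by positivity)]
  have h1 : Tendsto (fun K => (torusAdj d n ^ K * G) x y / (2 * d + m) ^ K) atTop (𝓝 0) := by
    have h2 : Tendsto (fun K : ℕ => (2 * d / (2 * d + m) : ℝ) ^ K * ∑ z, |G z y|) atTop (𝓝 0) := by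
      rw [← zero_mul (∑ z, |G z y|)]
      refine (tendsto_pow_atTop_nhds_zero_of_lt_one (by positivity) ?_).mul_const _
      rw [div_lt_one (by positivity)]
      linarith
    refine squeeze_zero_norm (fun K => ?_) h2
    rw [norm_div, Real.norm_of_nonneg (by positivity : 0 ≤ (2 * d + m : ℝ) ^ K), div_pow,
      div_mul_eq_mul_div]
    refine div_le_div_of_nonneg_right ?_ (by positivity)
    rw [Matrix.mul_apply, Finset.mul_sum]
    refine (norm_sum_le _ _).trans (Finset.sum_le_sum fun z _ => ?_)
    rw [norm_mul, Real.norm_of_nonneg (torusAdj_pow_nonneg d n K x z), Real.norm_eq_abs]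
    exact mul_le_mul_of_nonneg_right (torusAdj_pow_le hn K x z) (abs_nonneg _)
  have h3 : (fun K => ∑ k ∈ Finset.range K, (torusAdj d n ^ k) x y / (2 * d + m) ^ (k + 1)) =
      fun K => G x y - (torusAdj d n ^ K * G) x y / (2 * d + m) ^ K := by
    funext K
    rw [h.apply_eq hm K x y]
    ring
  rw [h3]
  simpa using h1.const_sub (G x y)

lemma pow_mul_mul_pow (h : IsTorusGreen d n m G) (j : ℕ) :
    torusAdj d n ^ j * G * torusAdj d n ^ j = torusAdj d n ^ (2 * j) * G := by
  rw [mul_assoc, ((h.commute.pow_left j).eq).symm, ← mul_assoc, ← pow_add, two_mul]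

/-- Only even powers of `A` are used here, since odd ones need not be positive semidefinite. -/
lemma posSemidef_pow_mul (h : IsTorusGreen d n m G) (j : ℕ) :
    (torusAdj d n ^ (2 * j) * G).PosSemidef := by
  have h1 := h.posDef.posSemidef.mul_mul_conjTranspose_same (torusAdj d n ^ j)
  rwa [((torusAdj_isHermitian d n).pow j).eq, h.pow_mul_mul_pow] at h1

lemma pow_mul_add (h : IsTorusGreen d n m G) (k : ℕ) (x y z : Torus d n) :
    (torusAdj d n ^ k * G) (x + z) (y + z) = (torusAdj d n ^ k * G) x y := by
  rw [Matrix.mul_apply, Matrix.mul_apply, ← Equiv.sum_comp (Equiv.addRight z)]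
  simp only [Equiv.coe_addRight, torusAdj_pow_add, h.add_right]

/-- By the defining equation of `G`, the variogram of `A ^ (2 j) G` sums, over the neighbours of the
origin, to `A ^ (2 j) (0, 0) - m (A ^ (2 j) G) (0, 0)`. -/
lemma sum_variogram_le (h : IsTorusGreen d n m G) (hn : 3 ≤ n) (j : ℕ) :
    ∑ i : Fin d, (((torusAdj d n ^ (2 * j) * G) 0 0 -
        (torusAdj d n ^ (2 * j) * G) 0 (Pi.single i 1)) +
      ((torusAdj d n ^ (2 * j) * G) 0 0 - (torusAdj d n ^ (2 * j) * G) 0 (-Pi.single i 1))) ≤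
    (torusAdj d n ^ (2 * j)) 0 0 := by
  set H := torusAdj d n ^ (2 * j) * G with hH
  have hHpsd := h.posSemidef_pow_mul j
  rw [← hH] at hHpsd
  have hsymm : ∀ x y, H x y = H y x := by
    intro x y
    have := hHpsd.isHermitian.apply x y
    rwa [star_trivial, eq_comm] at this
  have h1 := sum_torusAdj_mul hn 0 fun y => H 0 0 - H 0 y
  simp only [zero_add, zero_sub] at h1
  rw [← h1]
  have h2 : torusAdj d n * H = (2 * d + m) • H - torusAdj d n ^ (2 * j) := by
    rw [hH, ← mul_assoc, ← pow_succ', pow_succ, mul_assoc, h.adj_mul, mul_sub, mul_one,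
      mul_smul_comm]
  have h3 := congrFun (congrFun h2 0) 0
  rw [Matrix.mul_apply, Matrix.sub_apply, Matrix.smul_apply, smul_eq_mul] at h3
  have h4 := sum_torusAdj_pow hn 1 (0 : Torus d n)
  rw [pow_one, pow_one] at h4
  simp_rw [mul_sub, Finset.sum_sub_distrib, ← Finset.sum_mul, h4, hsymm 0]
  rw [h3]
  have h5 : 0 ≤ H 0 0 := hHpsd.diag_nonneg
  nlinarith [mul_nonneg (h.mass_pos hn).le h5]

end IsTorusGreen

/-- The variogram of `A ^ (2 j) G` at a lattice point is controlled by the return probabilities,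
uniformly in the size of the torus. -/
lemma exists_variogram_le {d : ℕ} (x : Fin d → ℤ) :
    ∃ c : ℝ, ∀ (n : ℕ) [NeZero n] (m : ℝ) (G : Matrix (Torus d n) (Torus d n) ℝ) (j : ℕ),
      IsTorusGreen d n m G → 3 ≤ n →
      (torusAdj d n ^ (2 * j) * G) 0 0 - (torusAdj d n ^ (2 * j) * G) 0 (toTorus n x) ≤
        c * (torusAdj d n ^ (2 * j)) 0 0 := by
  set p : (Fin d → ℤ) → Prop := fun x => ∃ c : ℝ, ∀ (n : ℕ) [NeZero n] (m : ℝ)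
    (G : Matrix (Torus d n) (Torus d n) ℝ) (j : ℕ), IsTorusGreen d n m G → 3 ≤ n →
      (torusAdj d n ^ (2 * j) * G) 0 0 - (torusAdj d n ^ (2 * j) * G) 0 (toTorus n x) ≤
        c * (torusAdj d n ^ (2 * j)) 0 0 with hp
  have h0 : p 0 := ⟨0, fun n _ m G j _ _ => by rw [toTorus_zero]; simp⟩
  have hadd : ∀ x y, p x → p y → p (x + y) := by
    rintro x y ⟨c, hc⟩ ⟨c', hc'⟩
    refine ⟨2 * c + 2 * c', fun n _ m G j hG hn => ?_⟩
    rw [toTorus_add]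
    have h1 := variogram_add_le (hG.posSemidef_pow_mul j) (hG.pow_mul_add (2 * j)) (toTorus n x)
      (toTorus n y)
    have h2 := hc n m G j hG hn
    have h3 := hc' n m G j hG hn
    linarith
  have hunit : ∀ i : Fin d, p (Pi.single i 1) ∧ p (-Pi.single i 1) := by
    intro i
    have hle : ∀ (n : ℕ) [NeZero n] (m : ℝ) (G : Matrix (Torus d n) (Torus d n) ℝ) (j : ℕ),
        IsTorusGreen d n m G → 3 ≤ n →
        ((torusAdj d n ^ (2 * j) * G) 0 0 - (torusAdj d n ^ (2 * j) * G) 0 (Pi.single i 1)) +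
        ((torusAdj d n ^ (2 * j) * G) 0 0 - (torusAdj d n ^ (2 * j) * G) 0 (-Pi.single i 1)) ≤
        (torusAdj d n ^ (2 * j)) 0 0 := by
      intro n _ m G j hG hn
      have h1 := fun x => apply_zero_le_of_posSemidef (hG.posSemidef_pow_mul j)
        (hG.pow_mul_add (2 * j)) x
      refine le_trans ?_ (hG.sum_variogram_le hn j)
      exact Finset.single_le_sum (f := fun i : Fin d =>
        ((torusAdj d n ^ (2 * j) * G) 0 0 - (torusAdj d n ^ (2 * j) * G) 0 (Pi.single i 1)) +
        ((torusAdj d n ^ (2 * j) * G) 0 0 - (torusAdj d n ^ (2 * j) * G) 0 (-Pi.single i 1)))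
        (fun i _ => add_nonneg (sub_nonneg.2 (h1 _)) (sub_nonneg.2 (h1 _))) (Finset.mem_univ i)
    refine ⟨⟨1, fun n _ m G j hG hn => ?_⟩, ⟨1, fun n _ m G j hG hn => ?_⟩⟩
    · have h1 := hle n m G j hG hn
      have h2 := apply_zero_le_of_posSemidef (hG.posSemidef_pow_mul j)
        (hG.pow_mul_add (2 * j)) (-Pi.single i 1)
      rw [toTorus_single]
      linarith
    · have h1 := hle n m G j hG hn
      have h2 := apply_zero_le_of_posSemidef (hG.posSemidef_pow_mul j)
        (hG.pow_mul_add (2 * j)) (Pi.single i 1)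
      rw [toTorus_neg, toTorus_single]
      linarith
  have hsingle : ∀ (i : Fin d) (k : ℤ), p (Pi.single i k) := by
    intro i k
    induction k using Int.induction_on with
    | zero => rwa [Pi.single_zero]
    | succ k ih =>
      rw [Pi.single_add]
      exact hadd _ _ ih (hunit i).1
    | pred k ih =>
      have h1 := (hunit i).2
      rw [← Pi.single_neg] at h1
      rw [sub_eq_add_neg, Pi.single_add]
      exact hadd _ _ ih h1
  have : p (∑ i, Pi.single i (x i)) :=
    Finset.sum_induction _ p hadd h0 fun i _ => hsingle i (x i)
  rwa [Finset.univ_sum_single] at this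

/-- The increments of the Green's matrix are given by the first terms of the random walk expansion,
up to an error controlled by the return probabilities, uniformly in the size of the torus. -/
lemma exists_green_increment_bound {d : ℕ} (x : Fin d → ℤ) :
    ∃ c : ℝ, 0 ≤ c ∧ ∀ (n : ℕ) [NeZero n] (m : ℝ) (G : Matrix (Torus d n) (Torus d n) ℝ) (j : ℕ),
      IsTorusGreen d n m G → 3 ≤ n →
      |G 0 0 - G 0 (toTorus n x) - (∑ k ∈ Finset.range (2 * j),
        (torusAdj d n ^ k) 0 0 / (2 * d + m) ^ (k + 1) -
        ∑ k ∈ Finset.range (2 * j), (torusAdj d n ^ k) 0 (toTorus n x) / (2 * d + m) ^ (k + 1))| ≤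
      c * ((torusAdj d n ^ (2 * j)) 0 0 / (2 * d + m) ^ (2 * j)) := by
  obtain ⟨c, hc⟩ := exists_variogram_le x
  refine ⟨|c|, abs_nonneg c, fun n _ m G j hG hn => ?_⟩
  have hm := hG.mass_pos hn
  have h1 := hG.apply_eq hm (2 * j) 0 0
  have h2 := hG.apply_eq hm (2 * j) 0 (toTorus n x)
  have h3 := apply_zero_le_of_posSemidef (hG.posSemidef_pow_mul j)
    (hG.pow_mul_add (2 * j)) (toTorus n x)
  have h4 := hc n m G j hG hn
  have h5 : G 0 0 - G 0 (toTorus n x) - (∑ k ∈ Finset.range (2 * j),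
        (torusAdj d n ^ k) 0 0 / (2 * d + m) ^ (k + 1) -
        ∑ k ∈ Finset.range (2 * j), (torusAdj d n ^ k) 0 (toTorus n x) / (2 * d + m) ^ (k + 1)) =
      ((torusAdj d n ^ (2 * j) * G) 0 0 - (torusAdj d n ^ (2 * j) * G) 0 (toTorus n x)) /
        (2 * d + m) ^ (2 * j) := by
    rw [sub_div]
    linarith
  have hpos : (0 : ℝ) < (2 * d + m) ^ (2 * j) := by positivity
  rw [h5, abs_of_nonneg (div_nonneg (sub_nonneg.2 h3) hpos.le), ← mul_div_assoc]
  refine div_le_div_of_nonneg_right (h4.trans ?_) hpos.le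
  exact mul_le_mul_of_nonneg_right (le_abs_self c) (torusAdj_pow_nonneg d n _ _ _)

/-! ### The limit of large tori -/

lemma eventually_le_pnat (K : ℕ) : ∀ᶠ n : ℕ+ in atTop, K ≤ (n : ℕ) :=
  tendsto_PNat_val_atTop_atTop.eventually_ge_atTop K

lemma tendsto_torus_term {d : ℕ} (hd : d ≠ 0) {m : ℕ+ → ℝ} {m0 : ℝ} (hm0 : 0 ≤ m0)
    (hm : Tendsto m atTop (𝓝 m0)) (x y : Fin d → ℤ) (k : ℕ) :
    Tendsto (fun n : ℕ+ => (torusAdj d n ^ k) (toTorus n x) (toTorus n y) /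
      (2 * d + m n) ^ (k + 1)) atTop (𝓝 (greenTerm d m0 x y k)) := by
  have hd' : (0 : ℝ) < d := Nat.cast_pos.2 (Nat.pos_of_ne_zero hd)
  have h1 : Tendsto (fun n : ℕ+ => (2 * d : ℝ) ^ k * walkProb d k x y / (2 * d + m n) ^ (k + 1))
      atTop (𝓝 (greenTerm d m0 x y k)) :=
    tendsto_const_nhds.div ((hm.const_add _).pow _) (by positivity)
  refine h1.congr' ?_
  filter_upwards [eventually_torusAdj_pow_eq hd k x y] with n hn
  rw [hn]

lemma summable_torus_term {d n : ℕ} [NeZero n] (hn : 3 ≤ n) {m : ℝ} (hm : 0 < m)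
    (x y : Torus d n) : Summable fun k => (torusAdj d n ^ k) x y / (2 * d + m) ^ (k + 1) :=
  Summable.of_nonneg_of_le
    (fun k => div_nonneg (torusAdj_pow_nonneg d n k x y) (by positivity))
    (fun k => div_le_div_of_nonneg_right (torusAdj_pow_le hn k x y) (by positivity))
    (summable_geometric_bound hm)

/-- The massive Green's function of the torus converges to that of the lattice. -/
lemma tendsto_torus_tsum {d : ℕ} (hd : d ≠ 0) {m : ℕ+ → ℝ} {m0 : ℝ} (hm0 : 0 < m0)
    (hm : Tendsto m atTop (𝓝 m0)) (x y : Fin d → ℤ) :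
    Tendsto (fun n : ℕ+ => ∑' k, (torusAdj d n ^ k) (toTorus n x) (toTorus n y) /
      (2 * d + m n) ^ (k + 1)) atTop (𝓝 (∑' k, greenTerm d m0 x y k)) := by
  refine tendsto_tsum_of_dominated_convergence 
    (summable_geometric_bound (d := d) (half_pos hm0))
    (fun k => tendsto_torus_term hd hm0.le hm x y k) ?_
  filter_upwards [hm.eventually (lt_mem_nhds (half_lt_self hm0)), eventually_le_pnat 3] with n h1 hn
  intro k
  have h2 : (0 : ℝ) < 2 * d + m0 / 2 := by positivity
  have h3 : (0 : ℝ) < 2 * d + m n := by linarith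
  rw [Real.norm_of_nonneg (div_nonneg (torusAdj_pow_nonneg d n k _ _) (by positivity))]
  gcongr
  exact torusAdj_pow_le hn k _ _

/-- The Green's function at the origin strictly decreases with the mass. -/
lemma tsum_greenTerm_lt {d : ℕ} (hd : d ≠ 0) {a b : ℝ} (ha : 0 ≤ a) (hab : a < b)
    (hs : Summable (greenTerm d a 0 0)) :
    ∑' k, greenTerm d b 0 0 k < ∑' k, greenTerm d a 0 0 k := by
  have hd' : (0 : ℝ) < d := Nat.cast_pos.2 (Nat.pos_of_ne_zero hd)
  refine Summable.tsum_lt_tsum (i := 0) (fun k => ?_) ?_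
    (summable_greenTerm hd (ha.trans_lt hab) 0 0) hs
  · have := walkProb_nonneg d k 0 0
    unfold greenTerm
    gcongr
  · simp only [greenTerm, walkProb, pow_zero, if_true, mul_one, zero_add, pow_one]
    gcongr

lemma continuousOn_tsum_greenTerm {d : ℕ} (hd : d ≠ 0) {a : ℝ} (ha : 0 < a) (x y : Fin d → ℤ) :
    ContinuousOn (fun m => ∑' k, greenTerm d m x y k) (Set.Ici a) := by
  refine continuousOn_tsum (u := fun k => (2 * d : ℝ) ^ k / (2 * d + a) ^ (k + 1)) (fun k => ?_)
    (summable_geometric_bound ha) fun k m (hm : a ≤ m) => ?_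
  · unfold greenTerm
    refine ContinuousOn.div (by fun_prop) (by fun_prop) fun m (hm : a ≤ m) => ?_
    have : 0 < m := by linarith
    positivity
  · have hm0 : 0 < m := by linarith
    rw [Real.norm_of_nonneg (greenTerm_nonneg hm0.le x y k)]
    refine (greenTerm_le hd hm0.le x y k).trans ?_
    gcongr

/-- Below the critical inverse temperature the Green's function takes the value `β` at the origin
for some positive mass. -/
lemma exists_mass {d : ℕ} (hd : d ≠ 0) {β : ℝ} (hβ : 0 < β) (h : ENNReal.ofReal β < betaC d) :
    ∃ m2 : ℝ, 0 < m2 ∧ ∑' k, greenTerm d m2 0 0 k = β := by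
  have hd' : (0 : ℝ) < d := Nat.cast_pos.2 (Nat.pos_of_ne_zero hd)
  -- a partial sum exceeds `β` at mass `0`, hence also at a small positive mass
  obtain ⟨K, hK⟩ : ∃ K, β < ∑ k ∈ Finset.range K, greenTerm d 0 0 0 k := by
    by_contra! hK
    refine h.not_ge ?_
    rw [betaC, green_eq_tsum hd le_rfl]
    refine ENNReal.tsum_le_of_sum_range_le fun K => ?_
    rw [← ENNReal.ofReal_sum_of_nonneg fun k _ => greenTerm_nonneg le_rfl 0 0 k]
    exact ENNReal.ofReal_le_ofReal (hK K)
  have hcont : Tendsto (fun m => ∑ k ∈ Finset.range K, greenTerm d m 0 0 k) (𝓝[>] 0)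
      (𝓝 (∑ k ∈ Finset.range K, greenTerm d 0 0 0 k)) := by
    refine tendsto_finsetSum _ fun k _ => ?_
    refine Tendsto.mono_left ?_ nhdsWithin_le_nhds
    have : ContinuousAt (fun m => greenTerm d m 0 0 k) 0 := by
      unfold greenTerm
      refine ContinuousAt.div (by fun_prop) (by fun_prop) ?_
      positivity
    exact this
  have hβ' : (0 : ℝ) < 1 / β := by positivity
  have hlt : ∀ᶠ a in 𝓝[>] (0 : ℝ), a < 1 / β := nhdsWithin_le_nhds (gt_mem_nhds hβ')
  have hpos : ∀ᶠ a in 𝓝[>] (0 : ℝ), 0 < a := self_mem_nhdsWithin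
  obtain ⟨a, ha1, ha0, ha2⟩ := ((hcont.eventually (lt_mem_nhds hK)).and (hpos.and hlt)).exists
  have hlow : ∑' k, greenTerm d (1 / β) 0 0 k ≤ β := by
    calc ∑' k, greenTerm d (1 / β) 0 0 k ≤
          ∑' k : ℕ, (2 * d : ℝ) ^ k / (2 * d + 1 / β) ^ (k + 1) :=
          (summable_greenTerm hd hβ' 0 0).tsum_le_tsum
            (fun k => greenTerm_le hd hβ'.le 0 0 k) (summable_geometric_bound hβ')
      _ = β := by rw [tsum_geometric_bound hβ', one_div_one_div]
  have hhigh : β ≤ ∑' k, greenTerm d a 0 0 k :=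
    ha1.le.trans ((summable_greenTerm hd ha0 0 0).sum_le_tsum _
      fun k _ => greenTerm_nonneg ha0.le 0 0 k)
  obtain ⟨m2, hm2, hval⟩ := intermediate_value_Icc' ha2.le
    ((continuousOn_tsum_greenTerm hd ha0 0 0).mono Set.Icc_subset_Ici_self) ⟨hlow, hhigh⟩
  exact ⟨m2, ha0.trans_le hm2.1, hval⟩

section Limit

variable {d : ℕ} {β : ℝ} {m : ℕ+ → ℝ} {G : ∀ n : ℕ+, Matrix (Torus d n) (Torus d n) ℝ}

lemma tsum_torus_le_of_le {n : ℕ} [NeZero n] (hn : 3 ≤ n) {a b : ℝ} (ha : 0 < a) (hab : a ≤ b)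
    (x y : Torus d n) : ∑' k, (torusAdj d n ^ k) x y / (2 * d + b) ^ (k + 1) ≤
      ∑' k, (torusAdj d n ^ k) x y / (2 * d + a) ^ (k + 1) := by
  refine (summable_torus_term hn (ha.trans_le hab) x y).tsum_le_tsum (fun k => ?_)
    (summable_torus_term hn ha x y)
  have := torusAdj_pow_nonneg d n k x y
  gcongr

lemma eventually_mass_lt (hd : d ≠ 0) (hG : ∀ n : ℕ+, IsTorusGreen d n (m n) (G n))
    (hdiag : ∀ (n : ℕ+) x, G n x x = β) {a : ℝ} (ha : 0 < a)
    (hlt : ∑' k, greenTerm d a 0 0 k < β) : ∀ᶠ n in atTop, m n < a := by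
  filter_upwards [(tendsto_torus_tsum hd ha tendsto_const_nhds 0 0).eventually (gt_mem_nhds hlt),
    eventually_le_pnat 3] with n h1 hn
  by_contra! h2
  have h3 := tsum_torus_le_of_le hn ha h2 (toTorus n (0 : Fin d → ℤ)) (toTorus n 0)
  rw [((hG n).hasSum hn _ _).tsum_eq, hdiag] at h3
  linarith

lemma eventually_lt_mass (hd : d ≠ 0) (hG : ∀ n : ℕ+, IsTorusGreen d n (m n) (G n))
    (hdiag : ∀ (n : ℕ+) x, G n x x = β) {a : ℝ} (ha : 0 < a)
    (hlt : β < ∑' k, greenTerm d a 0 0 k) : ∀ᶠ n in atTop, a < m n := by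
  filter_upwards [(tendsto_torus_tsum hd ha tendsto_const_nhds 0 0).eventually (lt_mem_nhds hlt),
    eventually_le_pnat 3] with n h1 hn
  by_contra! h2
  have h3 := tsum_torus_le_of_le hn ((hG n).mass_pos hn) h2 (toTorus n (0 : Fin d → ℤ))
    (toTorus n 0)
  rw [((hG n).hasSum hn _ _).tsum_eq, hdiag] at h3
  linarith

/-- The limit of the Green's matrices in the subcritical regime. -/
lemma tendsto_green_of_mass_pos (hd : d ≠ 0) (hG : ∀ n : ℕ+, IsTorusGreen d n (m n) (G n))
    (hdiag : ∀ (n : ℕ+) x, G n x x = β) {m2 : ℝ} (hm2 : 0 < m2)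
    (hβ : ∑' k, greenTerm d m2 0 0 k = β) (x y : Fin d → ℤ) :
    Tendsto (fun n : ℕ+ => G n (toTorus n x) (toTorus n y)) atTop
      (𝓝 (green d m2 x y).toReal) := by
  have hm : Tendsto m atTop (𝓝 m2) := by
    refine tendsto_order.2 ⟨fun a ha => ?_, fun a ha => ?_⟩
    · have h1 : max a (m2 / 2) < m2 := max_lt ha (half_lt_self hm2)
      have h2 : 0 < max a (m2 / 2) := lt_max_of_lt_right (half_pos hm2)
      have h3 := tsum_greenTerm_lt hd h2.le h1 (summable_greenTerm hd h2 0 0)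
      rw [hβ] at h3
      exact (eventually_lt_mass hd hG hdiag h2 h3).mono fun n hn => (le_max_left _ _).trans_lt hn
    · have h3 := tsum_greenTerm_lt hd hm2.le ha (summable_greenTerm hd hm2 0 0)
      rw [hβ] at h3
      exact eventually_mass_lt hd hG hdiag (hm2.trans ha) h3
  rw [toReal_green hd hm2.le]
  refine (tendsto_torus_tsum hd hm2 hm x y).congr' ?_
  filter_upwards [eventually_le_pnat 3] with n hn
  exact ((hG n).hasSum hn _ _).tsum_eq

/-- From the critical inverse temperature on, the masses vanish in the limit. -/
lemma tendsto_mass_zero (hd : d ≠ 0) (hG : ∀ n : ℕ+, IsTorusGreen d n (m n) (G n))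
    (hdiag : ∀ (n : ℕ+) x, G n x x = β) (hs : Summable (greenTerm d 0 0 0))
    (hβ : ∑' k, greenTerm d 0 0 0 k ≤ β) : Tendsto m atTop (𝓝 0) := by
  refine tendsto_order.2 ⟨fun a ha => ?_, fun a ha => ?_⟩
  · filter_upwards [eventually_le_pnat 3] with n hn
    exact ha.trans ((hG n).mass_pos hn)
  · exact eventually_mass_lt hd hG hdiag ha ((tsum_greenTerm_lt hd le_rfl ha hs).trans_le hβ)

/-- The massless expansion converges away from the origin too: its partial sums are limits of
partial sums for the Green's matrices, which are bounded by their diagonal. -/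
lemma summable_greenTerm_zero (hd : d ≠ 0) (hG : ∀ n : ℕ+, IsTorusGreen d n (m n) (G n))
    (hdiag : ∀ (n : ℕ+) x, G n x x = β) (hm : Tendsto m atTop (𝓝 0)) (x : Fin d → ℤ) :
    Summable (greenTerm d 0 0 x) := by
  refine summable_of_sum_range_le (c := β) (greenTerm_nonneg le_rfl 0 x) fun K => ?_
  refine le_of_tendsto (tendsto_finsetSum _ fun k _ => tendsto_torus_term hd le_rfl hm 0 x k) ?_
  filter_upwards [eventually_le_pnat 3] with n hn
  have hm := (hG n).mass_pos hn
  refine (sum_le_hasSum _ (fun k _ => div_nonneg (torusAdj_pow_nonneg d n k _ _) ?_)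
    ((hG n).hasSum hn _ _)).trans ?_
  · positivity
  · rw [toTorus_zero, ← hdiag n 0]
    exact apply_zero_le_of_posSemidef (hG n).posDef.posSemidef (hG n).add_right _

/-- At a critical or supercritical inverse temperature the increments of the Green's matrices
converge to those of the massless Green's function, because the tail of the random walk expansion
of the increments is bounded by return probabilities, uniformly in the torus. -/
lemma tendsto_green_increment (hd : d ≠ 0) (hG : ∀ n : ℕ+, IsTorusGreen d n (m n) (G n))
    (hdiag : ∀ (n : ℕ+) x, G n x x = β) (hm : Tendsto m atTop (𝓝 0)) (x : Fin d → ℤ) :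
    Tendsto (fun n : ℕ+ => G n 0 0 - G n 0 (toTorus n x)) atTop
      (𝓝 (∑' k, greenTerm d 0 0 0 k - ∑' k, greenTerm d 0 0 x k)) := by
  obtain ⟨c, hc0, hc⟩ := exists_green_increment_bound x
  have hs0 := summable_greenTerm_zero hd hG hdiag hm 0
  have hsx := summable_greenTerm_zero hd hG hdiag hm x
  have h2j : Tendsto (fun j : ℕ => 2 * j) atTop atTop := tendsto_id.const_mul_atTop' two_pos
  have hpart := ((hs0.hasSum.tendsto_sum_nat.comp h2j).sub (hsx.hasSum.tendsto_sum_nat.comp h2j))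
  have herr : Tendsto (fun j : ℕ => c * ((2 * d + 0) * greenTerm d 0 0 0 (2 * j))) atTop (𝓝 0) := by
    have := ((hs0.tendsto_atTop_zero.comp h2j).const_mul (2 * d + 0 : ℝ)).const_mul c
    simpa using this
  rw [Metric.tendsto_nhds]
  intro ε hε
  obtain ⟨j, hj1, hj2⟩ := ((Metric.tendsto_nhds.1 hpart (ε / 3) (by positivity)).and
    (herr.eventually (gt_mem_nhds (by positivity : 0 < ε / 3)))).exists
  have hn1 := (tendsto_finsetSum (Finset.range (2 * j)) fun k _ =>
    tendsto_torus_term hd le_rfl hm (0 : Fin d → ℤ) 0 k).sub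
    (tendsto_finsetSum (Finset.range (2 * j)) fun k _ =>
      tendsto_torus_term hd le_rfl hm (0 : Fin d → ℤ) x k)
  have hn2 := (((hm.const_add (2 * d : ℝ)).mul
    (tendsto_torus_term hd le_rfl hm (0 : Fin d → ℤ) 0 (2 * j))).const_mul c)
  filter_upwards [Metric.tendsto_nhds.1 hn1 (ε / 3) (by positivity),
    hn2.eventually (gt_mem_nhds hj2), eventually_le_pnat 3] with n h1 h2 hn
  have hmn := (hG n).mass_pos hn
  have h3 := hc n (m n) (G n) j (hG n) hn
  have h4 : (2 * d + m n) * ((torusAdj d n ^ (2 * j)) (toTorus n (0 : Fin d → ℤ)) (toTorus n 0) /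
      (2 * d + m n) ^ (2 * j + 1)) =
      (torusAdj d n ^ (2 * j)) 0 0 / (2 * d + m n) ^ (2 * j) := by
    have : (2 * d + m n : ℝ) ≠ 0 := by positivity
    rw [toTorus_zero, pow_succ]
    field_simp
  rw [h4] at h2
  rw [toTorus_zero, Real.dist_eq] at h1
  rw [Real.dist_eq] at hj1 ⊢
  simp only [Function.comp_apply] at hj1
  rw [abs_lt] at h1 hj1 ⊢
  rw [abs_le] at h3
  constructor <;> linarith [h1.1, h1.2, hj1.1, hj1.2, h3.1, h3.2]

/-- The limit of the Green's matrices in the critical and supercritical regimes. -/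
lemma tendsto_green_of_betaC_le (hd : d ≠ 0) (hG : ∀ n : ℕ+, IsTorusGreen d n (m n) (G n))
    (hdiag : ∀ (n : ℕ+) x, G n x x = β) (hβ0 : 0 ≤ β) (hβ : betaC d ≤ ENNReal.ofReal β)
    (x y : Fin d → ℤ) :
    Tendsto (fun n : ℕ+ => G n (toTorus n x) (toTorus n y)) atTop
      (𝓝 ((green d 0 x y).toReal + (β - (betaC d).toReal))) := by
  have hne : green d 0 0 0 ≠ ∞ := (hβ.trans_lt ENNReal.ofReal_lt_top).ne
  have hle : ∑' k, greenTerm d 0 0 0 k ≤ β := by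
    rw [← toReal_green hd le_rfl]
    exact ENNReal.toReal_le_of_le_ofReal hβ0 hβ
  have hm := tendsto_mass_zero hd hG hdiag (summable_greenTerm_of_ne_top hd le_rfl hne) hle
  have h1 := (tendsto_green_increment hd hG hdiag hm (y - x)).const_sub β
  rw [green_eq_green_zero, betaC, toReal_green hd le_rfl, toReal_green hd le_rfl]
  have h2 : β - (∑' k, greenTerm d 0 0 0 k - ∑' k, greenTerm d 0 0 (y - x) k) =
      ∑' k, greenTerm d 0 0 (y - x) k + (β - ∑' k, greenTerm d 0 0 0 k) := by ring
  rw [h2] at h1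
  refine h1.congr fun n => ?_
  have h3 := (hG n).add_right 0 (toTorus n (y - x)) (toTorus n x)
  rw [zero_add, ← toTorus_add, sub_add_cancel] at h3
  rw [hdiag, h3]
  ring

/-- A pointwise limit of the Green's matrices is positive semidefinite. -/
lemma posSemidef_of_tendsto (hG : ∀ n : ℕ+, IsTorusGreen d n (m n) (G n))
    {g : (Fin d → ℤ) → (Fin d → ℤ) → ℝ}
    (hg : ∀ x y, Tendsto (fun n : ℕ+ => G n (toTorus n x) (toTorus n y)) atTop (𝓝 (g x y)))
    (U : Finset (Fin d → ℤ)) : (Matrix.of fun x y : U => g x y).PosSemidef := by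
  have hpsd : ∀ n : ℕ+, ((G n).submatrix (fun x : U => toTorus n (x : Fin d → ℤ))
      fun x : U => toTorus n (x : Fin d → ℤ)).PosSemidef :=
    fun n => (hG n).posDef.posSemidef.submatrix _
  refine Matrix.PosSemidef.of_dotProduct_mulVec_nonneg ?_ fun v => ?_
  · ext x y
    rw [Matrix.conjTranspose_apply, Matrix.of_apply, Matrix.of_apply, star_trivial]
    refine tendsto_nhds_unique (hg y x) ((hg x y).congr fun n => ?_)
    have := (hpsd n).isHermitian.apply x y
    rw [star_trivial] at this
    exact this.symm
  · have hlim : Tendsto (fun n : ℕ+ => star v ⬝ᵥ ((G n).submatrix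
        (fun x : U => toTorus n (x : Fin d → ℤ)) fun x : U => toTorus n (x : Fin d → ℤ)).mulVec v)
        atTop (𝓝 (star v ⬝ᵥ (Matrix.of fun x y : U => g x y).mulVec v)) := by
      simp only [dotProduct, Matrix.mulVec, Matrix.submatrix_apply, Matrix.of_apply]
      refine tendsto_finsetSum _ fun x _ => Tendsto.const_mul _ ?_
      refine tendsto_finsetSum _ fun y _ => Tendsto.mul_const _ ?_
      exact hg x y
    exact ge_of_tendsto' hlim fun n => (hpsd n).dotProduct_mulVec_nonneg v

end Limit

/-! ### Characteristic functions of the limit laws -/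

lemma charFun_multivariateGaussian_zero {Λ : Type*} [Fintype Λ] [DecidableEq Λ] {K : Matrix Λ Λ ℝ}
    (hK : K.PosSemidef) (w : Λ → ℝ) :
    charFun (multivariateGaussian 0 K) (WithLp.toLp 2 w) =
      Complex.exp ((-(∑ x, ∑ y, K x y * (w x * w y)) / 2 : ℝ) : ℂ) := by
  rw [charFun_multivariateGaussian hK, inner_zero_right, sum_mul_eq_dotProduct_mulVec K w]
  congr 1
  push_cast
  ring

lemma integral_exp_torusGaussianLaw_eq {d n M : ℕ} [NeZero n] {U : Finset (Fin d → ℤ)}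
    {C : Matrix (Torus d n) (Torus d n) ℝ} (hC : C.PosSemidef) (ζ : Fin M → U → ℝ) :
    ∫ s, Complex.exp ((∑ i, ∑ x, ζ i x * s x i : ℝ) * Complex.I)
      ∂(torusGaussianLaw d n M U C : Measure (U → Fin M → ℝ)) =
    ∏ i, Complex.exp ((-(∑ x : U, ∑ y : U, C (toTorus n x) (toTorus n y) *
      (ζ i x * ζ i y)) / 2 : ℝ) : ℂ) := by
  rw [integral_exp_torusGaussianLaw, Finset.prod_range]
  refine Finset.prod_congr rfl fun i _ => ?_
  rw [charFun_multivariateGaussian_zero hC]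
  congr 4
  calc ∑ z, ∑ z', C z z' * (pushTest n ζ i z * pushTest n ζ i z')
      = ∑ z, pushTest n ζ i z * ∑ z', pushTest n ζ i z' * C z z' := by
        simp_rw [Finset.mul_sum]
        exact Finset.sum_congr rfl fun z _ => Finset.sum_congr rfl fun z' _ => by ring
    _ = _ := by
        rw [sum_pushTest_mul]
        refine Finset.sum_congr rfl fun x _ => ?_
        rw [sum_pushTest_mul, Finset.mul_sum]
        exact Finset.sum_congr rfl fun y _ => by ring

lemma integral_exp_gffLaw {d : ℕ} {m2 : ℝ} {U : Finset (Fin d → ℤ)}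
    (hK : (Matrix.of fun x y : U => (green d m2 x y).toReal).PosSemidef) (w : U → ℝ) :
    ∫ φ, Complex.exp ((∑ x, w x * φ x : ℝ) * Complex.I) ∂gffLaw d m2 U =
      Complex.exp ((-(∑ x : U, ∑ y : U, (green d m2 x y).toReal * (w x * w y)) / 2 : ℝ) : ℂ) := by
  have h := charFun_multivariateGaussian_zero hK w
  simp only [Matrix.of_apply] at h
  rw [← h, gffLaw, integral_map (by fun_prop) (Continuous.aestronglyMeasurable (by fun_prop)),
    charFun_apply]
  simp only [PiLp.inner_apply, RCLike.inner_apply, conj_trivial]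

lemma integral_exp_pi_gffLaw {d : ℕ} {β : ℝ} (hβ : 0 < β) {m2 : ℝ} {M : ℕ}
    {U : Finset (Fin d → ℤ)}
    (hK : (Matrix.of fun x y : U => (green d m2 x y).toReal).PosSemidef) (ζ : Fin M → U → ℝ) :
    ∫ φ, Complex.exp ((∑ i, ∑ x, ζ i x * (1 / √β * φ i x) : ℝ) * Complex.I)
      ∂(Measure.pi fun _ : Fin M => gffLaw d m2 U) =
    ∏ i, Complex.exp ((-(∑ x : U, ∑ y : U, (green d m2 x y).toReal / β *
      (ζ i x * ζ i y)) / 2 : ℝ) : ℂ) := by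
  have hprod := integral_fintype_prod_eq_prod (μ := fun _ : Fin M => gffLaw d m2 U)
    (f := fun (i : Fin M) (φ : U → ℝ) =>
      Complex.exp ((∑ x, (ζ i x * (1 / √β)) * φ x : ℝ) * Complex.I))
  simp_rw [integral_exp_gffLaw hK] at hprod
  have hsq : (1 / √β) * (1 / √β) = 1 / β := by
    rw [div_mul_div_comm, one_mul, Real.mul_self_sqrt hβ.le]
  have hquad : ∀ i, ∑ x : U, ∑ y : U, (green d m2 x y).toReal *
      ((ζ i x * (1 / √β)) * (ζ i y * (1 / √β))) =
      ∑ x : U, ∑ y : U, (green d m2 x y).toReal / β * (ζ i x * ζ i y) := by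
    intro i
    refine Finset.sum_congr rfl fun x _ => Finset.sum_congr rfl fun y _ => ?_
    rw [mul_mul_mul_comm (ζ i x), hsq]
    ring
  simp_rw [hquad] at hprod
  rw [← hprod]
  refine integral_congr_ae (Eventually.of_forall fun φ => ?_)
  simp only
  rw [← Complex.exp_sum, ← Finset.sum_mul, ← Complex.ofReal_sum]
  simp only [mul_assoc]

lemma integral_exp_scaledGFF {d : ℕ} {β : ℝ} (hβ : 0 < β) {m2 : ℝ} {M : ℕ}
    {U : Finset (Fin d → ℤ)}
    (hK : (Matrix.of fun x y : U => (green d m2 x y).toReal).PosSemidef) (ζ : Fin M → U → ℝ) :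
    ∫ s, Complex.exp ((∑ i, ∑ x, ζ i x * s x i : ℝ) * Complex.I)
      ∂(scaledGFF d β m2 M U : Measure (U → Fin M → ℝ)) =
    ∏ i, Complex.exp ((-(∑ x : U, ∑ y : U, (green d m2 x y).toReal / β *
      (ζ i x * ζ i y)) / 2 : ℝ) : ℂ) := by
  change ∫ s, _ ∂((Measure.pi fun _ : Fin M => gffLaw d m2 U).map
    (fun φ (x : U) i => 1 / √β * φ i x)) = _
  rw [integral_map (Measurable.aemeasurable (by fun_prop))
    (Continuous.aestronglyMeasurable (by fun_prop)), integral_exp_pi_gffLaw hβ hK]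

lemma integral_exp_pi_gaussianReal {M : ℕ} (w : Fin M → ℝ) :
    ∫ z, Complex.exp ((∑ i, w i * z i : ℝ) * Complex.I)
      ∂(Measure.pi fun _ : Fin M => gaussianReal 0 1) =
    ∏ i, Complex.exp ((-(w i ^ 2) / 2 : ℝ) : ℂ) := by
  have hprod := integral_fintype_prod_eq_prod (μ := fun _ : Fin M => gaussianReal 0 1)
    (f := fun (i : Fin M) (z : ℝ) => Complex.exp ((w i : ℂ) * z * Complex.I))
  simp_rw [← charFun_apply_real, charFun_gaussianReal] at hprod
  have hexp : ∀ i, Complex.exp ((w i : ℂ) * (0 : ℝ) * Complex.I -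
      ((1 : NNReal) : ℝ) * (w i : ℂ) ^ 2 / 2) = Complex.exp ((-(w i ^ 2) / 2 : ℝ) : ℂ) := by
    intro i
    congr 1
    push_cast
    ring
  simp_rw [hexp] at hprod
  rw [← hprod]
  refine integral_congr_ae (Eventually.of_forall fun z => ?_)
  simp only
  rw [← Complex.exp_sum, ← Finset.sum_mul]
  push_cast
  rfl

lemma integral_exp_scaledGFFDrift {d : ℕ} {β : ℝ} (hβ : 0 < β) (c : ℝ) {M : ℕ}
    {U : Finset (Fin d → ℤ)}
    (hK : (Matrix.of fun x y : U => (green d 0 x y).toReal).PosSemidef) (ζ : Fin M → U → ℝ) :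
    ∫ s, Complex.exp ((∑ i, ∑ x, ζ i x * s x i : ℝ) * Complex.I)
      ∂(scaledGFFDrift d β c M U : Measure (U → Fin M → ℝ)) =
    ∏ i, Complex.exp ((-(∑ x : U, ∑ y : U, ((green d 0 x y).toReal / β + c ^ 2) *
      (ζ i x * ζ i y)) / 2 : ℝ) : ℂ) := by
  change ∫ s, _ ∂((gffNormalLaw d 0 M U).map
    (fun p (x : U) i => 1 / √β * p.1 i x + c * p.2 i)) = _
  rw [integral_map (Measurable.aemeasurable (by fun_prop))
    (Continuous.aestronglyMeasurable (by fun_prop)), gffNormalLaw]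
  have hsplit : ∀ p : (Fin M → U → ℝ) × (Fin M → ℝ),
      Complex.exp ((∑ i, ∑ x, ζ i x * (1 / √β * p.1 i x + c * p.2 i) : ℝ) * Complex.I) =
      Complex.exp ((∑ i, ∑ x, ζ i x * (1 / √β * p.1 i x) : ℝ) * Complex.I) *
        Complex.exp ((∑ i, (c * ∑ x, ζ i x) * p.2 i : ℝ) * Complex.I) := by
    intro p
    rw [← Complex.exp_add, ← add_mul, ← Complex.ofReal_add, ← Finset.sum_add_distrib]
    congr 3
    refine Finset.sum_congr rfl fun i _ => ?_
    rw [Finset.mul_sum, Finset.sum_mul, ← Finset.sum_add_distrib]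
    exact Finset.sum_congr rfl fun x _ => by ring
  simp_rw [hsplit]
  rw [integral_prod_mul (fun φ : Fin M → U → ℝ =>
      Complex.exp ((∑ i, ∑ x, ζ i x * (1 / √β * φ i x) : ℝ) * Complex.I))
    (fun z : Fin M → ℝ => Complex.exp ((∑ i, (c * ∑ x, ζ i x) * z i : ℝ) * Complex.I)),
    integral_exp_pi_gffLaw hβ hK, integral_exp_pi_gaussianReal, ← Finset.prod_mul_distrib]
  refine Finset.prod_congr rfl fun i _ => ?_
  rw [← Complex.exp_add, ← Complex.ofReal_add]
  congr 2
  have h1 : (c * ∑ x, ζ i x) ^ 2 = ∑ x, ∑ y, c ^ 2 * (ζ i x * ζ i y) := by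
    rw [mul_pow, sq (∑ x, ζ i x), Finset.sum_mul_sum, Finset.mul_sum]
    simp_rw [Finset.mul_sum]
  simp_rw [add_mul, Finset.sum_add_distrib]
  rw [h1]
  ring

/-- For every `β > 0` some mass makes the diagonal of the Green's matrix of the torus equal to
`β`. -/
lemma exists_isTorusGreen (d n : ℕ) [NeZero n] {β : ℝ} (hβ : 0 < β) :
    ∃ (m : ℝ) (G : Matrix (Torus d n) (Torus d n) ℝ), IsTorusGreen d n m G ∧ ∀ x, G x x = β := by
  obtain ⟨l, C, hC, hmul, hadd, hdiag⟩ := exists_posDef_unit_diag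
    (A := β • torusAdj d n) ((torusAdj_isHermitian d n).smul (by simp [IsSelfAdjoint]))
    fun x y z => by simp only [Matrix.smul_apply, torusAdj_add]
  refine ⟨l / β - 2 * d, β • C, ⟨hC.smul hβ, ?_, fun x y z => ?_⟩, fun x => ?_⟩
  · rw [add_sub_cancel, mul_smul_comm, ← smul_mul_assoc, smul_sub, smul_smul,
      mul_div_cancel₀ _ hβ.ne', hmul]
  · rw [Matrix.smul_apply, Matrix.smul_apply, hadd]
  · rw [Matrix.smul_apply, hdiag, smul_eq_mul, mul_one]

/-- If the Green's matrices with diagonal `β` converge to `g`, then the iterated limit of the spin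
model is Gaussian with covariance `g / β`. -/
lemma iteratedLimit_spinLaw {d : ℕ} {β : ℝ} (hβ : 0 < β) {m : ℕ+ → ℝ}
    {G : ∀ n : ℕ+, Matrix (Torus d n) (Torus d n) ℝ}
    (hG : ∀ n : ℕ+, IsTorusGreen d n (m n) (G n)) (hdiag : ∀ (n : ℕ+) x, G n x x = β)
    {g : (Fin d → ℤ) → (Fin d → ℤ) → ℝ}
    (hg : ∀ x y, Tendsto (fun n : ℕ+ => G n (toTorus n x) (toTorus n y)) atTop (𝓝 (g x y)))
    {M : ℕ} {U : Finset (Fin d → ℤ)} {ν : ProbabilityMeasure (U → Fin M → ℝ)}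
    (hν : ∀ ζ : Fin M → U → ℝ, ∫ s, Complex.exp ((∑ i, ∑ x, ζ i x * s x i : ℝ) * Complex.I)
        ∂(ν : Measure (U → Fin M → ℝ)) =
      ∏ i, Complex.exp ((-(∑ x : U, ∑ y : U, g x y / β * (ζ i x * ζ i y)) / 2 : ℝ) : ℂ)) :
    IteratedLimit (spinLaw d β M U) ν := by
  have hC : ∀ n, (β⁻¹ • G n).PosDef := fun n => (hG n).posDef.smul (inv_pos.2 hβ)
  refine ⟨fun n => torusGaussianLaw d n M U (β⁻¹ • G n), fun n => ?_, ?_⟩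
  · refine tendsto_spinLaw d n M U (l := β * (2 * d + m n)) (hC n) ?_ fun x => ?_
    · rw [← smul_smul, ← smul_sub, smul_mul_smul_comm, mul_inv_cancel₀ hβ.ne', one_smul,
        (hG n).mul_eq_one]
    · rw [Matrix.smul_apply, hdiag, smul_eq_mul, inv_mul_cancel₀ hβ.ne']
  · refine tendsto_array_of_tendsto_charFun fun ζ => ?_
    rw [hν]
    simp_rw [fun n => integral_exp_torusGaussianLaw_eq (M := M) (U := U) (hC n).posSemidef]
    refine tendsto_finsetProd _ fun i _ => ?_
    refine (Complex.continuous_exp.tendsto _).comp ((Complex.continuous_ofReal.tendsto _).comp ?_)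
    refine Tendsto.div_const (Tendsto.neg ?_) 2
    refine tendsto_finsetSum _ fun x _ => tendsto_finsetSum _ fun y _ => Tendsto.mul_const _ ?_
    simp_rw [Matrix.smul_apply, smul_eq_mul, inv_mul_eq_div]
    exact (hg x y).div_const β

/-- The massless Green's function is positive semidefinite, as the limit of the Green's matrices of
the torus at the critical inverse temperature. Thus `gffLaw` has the covariance it names, since
`multivariateGaussian` takes a junk value when its matrix is not positive semidefinite. -/
lemma posSemidef_green_zero {d : ℕ} (hd : d ≠ 0) (hfin : betaC d ≠ ∞) (U : Finset (Fin d → ℤ)) :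
    (Matrix.of fun x y : U => (green d 0 x y).toReal).PosSemidef := by
  have hd' : (0 : ℝ) < d := Nat.cast_pos.2 (Nat.pos_of_ne_zero hd)
  have hpos : 0 < (betaC d).toReal := by
    have hs := summable_greenTerm_of_ne_top hd le_rfl hfin
    rw [betaC, toReal_green hd le_rfl]
    refine hs.tsum_pos (greenTerm_nonneg le_rfl 0 0) 0 ?_
    simp only [greenTerm, walkProb, if_true]
    positivity
  choose m G hG hdiag using fun n : ℕ+ => exists_isTorusGreen d n hpos
  refine posSemidef_of_tendsto hG (g := fun x y => (green d 0 x y).toReal) (fun x y => ?_) U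
  have h := tendsto_green_of_betaC_le hd hG hdiag hpos.le (ENNReal.ofReal_toReal hfin).ge x y
  rwa [sub_self, add_zero] at h

end SpinON

theorem theorem4p2 (d : ℕ) (hd : 2 ≤ d) (β : ℝ) (hβ : 0 < β) :
    (ENNReal.ofReal β < SpinON.betaC d →
      ∃ m2 : ℝ, 0 < m2 ∧
        (∀ x : Fin d → ℤ, SpinON.green d m2 x x = ENNReal.ofReal β) ∧
        ∀ (M : ℕ) (U : Finset (Fin d → ℤ)),
          SpinON.IteratedLimit (SpinON.spinLaw d β M U) (SpinON.scaledGFF d β m2 M U)) ∧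
    (ENNReal.ofReal β = SpinON.betaC d →
      ∀ (M : ℕ) (U : Finset (Fin d → ℤ)),
        SpinON.IteratedLimit (SpinON.spinLaw d β M U) (SpinON.scaledGFF d β 0 M U)) ∧
    (SpinON.betaC d < ENNReal.ofReal β →
      ∀ (M : ℕ) (U : Finset (Fin d → ℤ)),
        SpinON.IteratedLimit (SpinON.spinLaw d β M U)
          (SpinON.scaledGFFDrift d β (√((β - (SpinON.betaC d).toReal) / β)) M U)) := by
  have hd0 : d ≠ 0 := by omega
  choose m G hG hdiag using fun n : ℕ+ => SpinON.exists_isTorusGreen d n hβ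
  refine ⟨fun h => ?_, fun h M U => ?_, fun h M U => ?_⟩
  · obtain ⟨m2, hm2, hval⟩ := SpinON.exists_mass hd0 hβ h
    have hg := SpinON.tendsto_green_of_mass_pos hd0 hG hdiag hm2 hval
    refine ⟨m2, hm2, fun x => ?_, fun M U => ?_⟩
    · rw [SpinON.green_eq_green_zero, sub_self, SpinON.green_eq_ofReal_tsum hd0 hm2.le
        (SpinON.summable_greenTerm hd0 hm2 0 0), hval]
    · exact SpinON.iteratedLimit_spinLaw hβ hG hdiag hg
        (SpinON.integral_exp_scaledGFF hβ (SpinON.posSemidef_of_tendsto hG hg U))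
  · have hK := SpinON.posSemidef_green_zero hd0 (h ▸ ENNReal.ofReal_ne_top) U
    have hg := SpinON.tendsto_green_of_betaC_le hd0 hG hdiag hβ.le h.ge
    rw [← h, ENNReal.toReal_ofReal hβ.le, sub_self] at hg
    simp_rw [add_zero] at hg
    exact SpinON.iteratedLimit_spinLaw hβ hG hdiag hg (SpinON.integral_exp_scaledGFF hβ hK)
  · have hK := SpinON.posSemidef_green_zero hd0 (h.trans ENNReal.ofReal_lt_top).ne U
    have hg := SpinON.tendsto_green_of_betaC_le hd0 hG hdiag hβ.le h.le
    refine SpinON.iteratedLimit_spinLaw hβ hG hdiag hg fun ζ => ?_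
    have hc : 0 ≤ (β - (SpinON.betaC d).toReal) / β :=
      div_nonneg (sub_nonneg.2 (ENNReal.toReal_le_of_le_ofReal hβ.le h.le)) hβ.le
    rw [SpinON.integral_exp_scaledGFFDrift hβ _ hK, Real.sq_sqrt hc]
    simp_rw [add_div]
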